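/- \textbf{Setting.} Let $n\ge 2$ nodes have local functions $f_1,\dots,f_n:\mathbb{R}^d\to\mathbb{R}$ that are differentiable, with $L$-Lipschitz gradients and $\mu$-strongly convex ($L,\mu>0$), and let $x^*$ be the minimizer of $\frac1n\sum_i f_i$. Let $Q=[q_{ij}]\in\mathbb{R}^{n\times n}$ be symmetric and doubly stochastic with eigenvalues $1=\lambda_1>\lambda_2\ge\dots\ge\lambda_n>-1$. With step size $\alpha>0$ and noise attenuation parameter $\gamma$, the algorithm IC-GT starts at square-integrable $x_{i,0}$ with $y_{i,0}=\nabla F_i(x_{i,0},\xi_{i,0})$ and iterates, for $k\ge 0$ and all $i$, $$v_{i,k}=(1-\gamma)x_{i,k}+\gamma q_{ii}x_{i,k}+\gamma\sum_{j\ne i}q_{ij}(x_{j,k}+\epsilon_{j,k}),\qquad x_{i,k+1}=v_{i,k}-\alpha y_{i,k},$$ $$y_{i,k+1}=(1-\gamma)y_{i,k}+\gamma q_{ii}y_{i,k}+\gamma\sum_{j\ne i}q_{ij}(y_{j,k}+\epsilon_{j,k})+\nabla F_i(x_{i,k+1},\xi_{i,k+1})-\nabla F_i(x_{i,k},\xi_{i,k}).$$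 Let $\mathcal F_k=\sigma(x_0,\xi_0,\epsilon_0,\dots,\xi_{k-1},\epsilon_{k-1})$. The communication noise satisfies $\mathbb{E}[\epsilon_{i,k}\mid\mathcal F_k]=0$ and $\mathbb{E}\|\epsilon_{i,k}\|^2\le\sigma_c^2$; the gradient samples satisfy $\mathbb{E}[\nabla F_i(x_{i,k},\xi_{i,k})\mid\mathcal F_k]=\nabla f_i(x_{i,k})$ and $\mathbb{E}\|g_{i,k}\|^2\le\sigma_g^2$, where $g_{i,k}=\nabla F_i(x_{i,k},\xi_{i,k})-\nabla f_i(x_{i,k})$. Within each round the noises are uncorrelated: $\mathbb{E}\langle\epsilon_{i,k},\epsilon_{j,k}\rangle=\mathbb{E}\langle g_{i,k},g_{j,k}\rangle=0$ for $i\ne j$, and $\mathbb{E}\langle g_{i,k},\epsilon_{j,k}\rangle=0$ for all $i,j$ (as holds if they are independent given $\mathcal F_k$). Write $\bar x_k=\frac1n\sum_i x_{i,k}$, let $\Delta z$ denote a stacked vector $z=(z_1,\dots,z_n)$ minus its node average, and put $\Psi_0=(\Delta v_0,\Delta x_0,\alpha\Delta y_0)$. \textbf{Theorem (convergence rate of IC-GT).}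 (a) Suppose $0<\gamma<1/4$ and $0<\alpha\le\min\{1,\frac{1}{161280\,\tau L}\}$, where $$\tau=\left\lceil\frac{2}{\gamma(1-\lambda_2)}\max\left\{4\ln\frac{2}{\gamma(1-\lambda_2)},\ \gamma(1-\lambda_2)+\ln 16\right\}\right\rceil .$$ Then for every $T\in\mathbb{N}$ the quantities $\|\bar x_T-x^*\|^2$ and $\|\Psi_0\|^2$ are integrable and $$\mathbb{E}\|\bar x_T-x^*\|^2\le\left(1-\tfrac{\alpha\mu}{4}\right)^T\left(\mathbb{E}\|\bar x_0-x^*\|^2+\frac{800(1+\tau^2)L}{n(1-\alpha\mu/4)\mu}\,\mathbb{E}\|\Psi_0\|^2\right)+\left(\frac{4\alpha}{\mu}+\frac{101920\,L(\tau+1)n\alpha^2}{\mu}\right)\frac{\sigma_g^2}{n}$$ $$+\left(\frac{4(1+2\mu^{-1}T\alpha)}{\mu}\frac{\gamma^2}{\alpha}+\frac{33280\,(2+\alpha^2(\tau^2+\frac12)+\alpha^2T)L}{\mu}\,n\tau\gamma^2\right)\frac{\sigma_c^2}{n}.$$ (b) Consequently IC-GT has iteration complexity $\tilde{\mathcal O}(1/\varepsilon)$: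 for fixed problem data $n,d,Q,f_i,L,\mu,\sigma_g,\sigma_c$ and every $R$ there are constants $C$ and $p\in\mathbb{N}$ such that for every $\varepsilon\in(0,1/2]$ there are $\alpha,\gamma$ satisfying the conditions in (a) and $T\le C\,\varepsilon^{-1}\ln(1/\varepsilon)^p$ such that $\mathbb{E}\|\bar x_T-x^*\|^2\le\varepsilon$ for every run with these parameters, with $\mathbb{E}\|\bar x_0-x^*\|^2\le R$ and $\mathbb{E}\|\Psi_0\|^2\le R$. -/

import Mathlib

open MeasureTheory ProbabilityTheory

universe u v

noncomputable section

namespace ICGT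

/-- The decision space `ℝ^d` with its Euclidean norm. -/
abbrev Vec (d : ℕ) : Type := EuclideanSpace ℝ (Fin d)

/-- A stacked vector `(z_1, …, z_n) ∈ ℝ^{nd}`. -/
abbrev Stack (n d : ℕ) : Type := Fin n → Vec d

/-- The node average `(1/n) ∑ z_i`. -/
def avg {n d : ℕ} (z : Stack n d) : Vec d := (n : ℝ)⁻¹ • ∑ i, z i

/-- The consensus error `Δz = z - z̄`. -/
def dev {n d : ℕ} (z : Stack n d) : Stack n d := fun i => z i - avg z

/-- The squared `ℓ²` norm of a stacked vector. -/
def sqNorm {n d : ℕ} (z : Stack n d) : ℝ := ∑ i, ‖z i‖ ^ 2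

/-! ### Mixing matrix -/

theorem isHermitian_of_isSymm {n : ℕ} {Q : Matrix (Fin n) (Fin n) ℝ} (h : Q.IsSymm) :
    Q.IsHermitian := by
  unfold Matrix.IsHermitian
  rw [Matrix.conjTranspose_eq_transpose_of_trivial]
  exact h

/-- The eigenvalues `λ_1 ≥ λ_2 ≥ … ≥ λ_n` of a real symmetric matrix, with multiplicity, in
decreasing order; `eig h j` is `λ_{j+1}`. -/
def eig {n : ℕ} {Q : Matrix (Fin n) (Fin n) ℝ} (h : Q.IsSymm) (j : Fin n) : ℝ :=
  (isHermitian_of_isSymm h).eigenvalues₀ (Fin.cast (Fintype.card_fin n).symm j)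

/-- Symmetric, doubly stochastic, with `1 = λ_1 > λ_2 ≥ … ≥ λ_n > -1`
(so that there are at least two nodes). -/
structure IsMixing {n : ℕ} (hn : 2 ≤ n) (Q : Matrix (Fin n) (Fin n) ℝ) : Prop where
  symm : Q.IsSymm
  stoch : Q ∈ doublyStochastic ℝ (Fin n)
  eig_first : eig symm ⟨0, by omega⟩ = 1
  eig_second : eig symm ⟨1, by omega⟩ < 1
  eig_all : ∀ j, -1 < eig symm j

/-- The second largest eigenvalue `λ_2`. -/
def lam2 {n : ℕ} {hn : 2 ≤ n} {Q : Matrix (Fin n) (Fin n) ℝ} (hQ : IsMixing hn Q) : ℝ :=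
  eig hQ.symm ⟨1, by omega⟩

/-- `τ = ⌈ 2 / (γ (1 - λ₂)) · max { 4 ln (2 / (γ (1 - λ₂))), γ (1 - λ₂) + ln 16 } ⌉`. -/
def tau (γ l2 : ℝ) : ℕ :=
  ⌈2 / (γ * (1 - l2)) *
    max (4 * Real.log (2 / (γ * (1 - l2)))) (γ * (1 - l2) + Real.log 16)⌉₊

/-! ### The objective -/

/-- Every local function is differentiable with `L`-Lipschitz gradient and `μ`-strongly convex. -/
structure IsRegular {n d : ℕ} (f : Fin n → Vec d → ℝ) (L μ : ℝ) : Prop where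
  diff : ∀ i, Differentiable ℝ (f i)
  smooth : ∀ i x y, ‖gradient (f i) x - gradient (f i) y‖ ≤ L * ‖x - y‖
  strong : ∀ i, StrongConvexOn Set.univ μ (f i)

/-- `x*` minimises `x ↦ (1/n) ∑ f_i(x)` over `ℝ^d`. -/
def IsOptimal {n d : ℕ} (f : Fin n → Vec d → ℝ) (xs : Vec d) : Prop :=
  ∀ x, (n : ℝ)⁻¹ * ∑ i, f i xs ≤ (n : ℝ)⁻¹ * ∑ i, f i x

/-- The sampled gradient `∇F_i(x, s)`, the gradient being taken in the first variable. -/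
def sampleGrad {n d : ℕ} {S : Fin n → Type v} (F : (i : Fin n) → Vec d → S i → ℝ)
    (i : Fin n) (x : Vec d) (s : S i) : Vec d :=
  gradient (fun z => F i z s) x

/-! ### The algorithm, for one realisation of the samples and of the noise -/

/-- The neighbours of node `i`: the nodes `j ≠ i` with `q_ij > 0`. -/
def neighbors {n : ℕ} (Q : Matrix (Fin n) (Fin n) ℝ) (i : Fin n) : Finset (Fin n) :=
  {j | j ≠ i ∧ 0 < Q i j}

/-- One inexact averaging step: node `i` receives `z_j + e_j` from each neighbour `j`. -/
def mix {n d : ℕ} (Q : Matrix (Fin n) (Fin n) ℝ) (γ : ℝ) (z e : Stack n d) : Stack n d :=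
  fun i => (1 - γ) • z i + (γ * Q i i) • z i + γ • ∑ j ∈ neighbors Q i, Q i j • (z j + e j)

/-- The pair `(x_k, y_k)` of IC-GT, started at `x0`, when the samples are `s k i` and the
communication noise of node `j` in round `k` is `e k j` (the same in the `x` and `y` channel). -/
def iter {n d : ℕ} {S : Fin n → Type v} (Q : Matrix (Fin n) (Fin n) ℝ) (α γ : ℝ)
    (F : (i : Fin n) → Vec d → S i → ℝ) (x0 : Stack n d)
    (s : ℕ → (i : Fin n) → S i) (e : ℕ → Stack n d) : ℕ → Stack n d × Stack n d
  | 0 => (x0, fun i => sampleGrad F i (x0 i) (s 0 i))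
  | k + 1 =>
    let x := (iter Q α γ F x0 s e k).1
    let y := (iter Q α γ F x0 s e k).2
    let x' : Stack n d := fun i => mix Q γ x (e k) i - α • y i
    (x', fun i => mix Q γ y (e k) i + sampleGrad F i (x' i) (s (k + 1) i)
      - sampleGrad F i (x i) (s k i))

/-! ### The random iterates -/

section Random

variable {n d : ℕ} {Ω : Type u} {S : Fin n → Type v}

/-- The random iterate `x_k`. -/
def xIter (Q : Matrix (Fin n) (Fin n) ℝ) (α γ : ℝ) (F : (i : Fin n) → Vec d → S i → ℝ)
    (x0 : Ω → Stack n d) (ξ : ℕ → (i : Fin n) → Ω → S i) (ε : ℕ → Fin n → Ω → Vec d)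
    (k : ℕ) (ω : Ω) : Stack n d :=
  (iter Q α γ F (x0 ω) (fun k i => ξ k i ω) (fun k i => ε k i ω) k).1

/-- The random gradient tracker `y_k`. -/
def yIter (Q : Matrix (Fin n) (Fin n) ℝ) (α γ : ℝ) (F : (i : Fin n) → Vec d → S i → ℝ)
    (x0 : Ω → Stack n d) (ξ : ℕ → (i : Fin n) → Ω → S i) (ε : ℕ → Fin n → Ω → Vec d)
    (k : ℕ) (ω : Ω) : Stack n d :=
  (iter Q α γ F (x0 ω) (fun k i => ξ k i ω) (fun k i => ε k i ω) k).2

/-- The random vector `v_k`. -/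
def vIter (Q : Matrix (Fin n) (Fin n) ℝ) (α γ : ℝ) (F : (i : Fin n) → Vec d → S i → ℝ)
    (x0 : Ω → Stack n d) (ξ : ℕ → (i : Fin n) → Ω → S i) (ε : ℕ → Fin n → Ω → Vec d)
    (k : ℕ) (ω : Ω) : Stack n d :=
  mix Q γ (xIter Q α γ F x0 ξ ε k ω) (fun i => ε k i ω)

/-- `‖Ψ_k‖²` for the consensus error `Ψ_k = (Δv_k, Δx_k, α Δy_k)`. -/
def psiSq (Q : Matrix (Fin n) (Fin n) ℝ) (α γ : ℝ) (F : (i : Fin n) → Vec d → S i → ℝ)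
    (x0 : Ω → Stack n d) (ξ : ℕ → (i : Fin n) → Ω → S i) (ε : ℕ → Fin n → Ω → Vec d)
    (k : ℕ) (ω : Ω) : ℝ :=
  sqNorm (dev (vIter Q α γ F x0 ξ ε k ω)) + sqNorm (dev (xIter Q α γ F x0 ξ ε k ω))
    + sqNorm (α • dev (yIter Q α γ F x0 ξ ε k ω))

/-- The squared distance `‖x̄_k - x*‖²`. -/
def errSq (Q : Matrix (Fin n) (Fin n) ℝ) (α γ : ℝ) (F : (i : Fin n) → Vec d → S i → ℝ)
    (x0 : Ω → Stack n d) (ξ : ℕ → (i : Fin n) → Ω → S i) (ε : ℕ → Fin n → Ω → Vec d)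
    (xs : Vec d) (k : ℕ) (ω : Ω) : ℝ :=
  ‖avg (xIter Q α γ F x0 ξ ε k ω) - xs‖ ^ 2

/-- The gradient noise `∇F_i(x_{i,k}, ξ_{i,k}) - ∇f_i(x_{i,k})`. -/
def gradNoise (Q : Matrix (Fin n) (Fin n) ℝ) (α γ : ℝ) (f : Fin n → Vec d → ℝ)
    (F : (i : Fin n) → Vec d → S i → ℝ)
    (x0 : Ω → Stack n d) (ξ : ℕ → (i : Fin n) → Ω → S i) (ε : ℕ → Fin n → Ω → Vec d)
    (k : ℕ) (i : Fin n) (ω : Ω) : Vec d :=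
  sampleGrad F i (xIter Q α γ F x0 ξ ε k ω i) (ξ k i ω)
    - gradient (f i) (xIter Q α γ F x0 ξ ε k ω i)

/-- The history `σ(x_0, ξ_0, ε_0, …, ξ_{k-1}, ε_{k-1})` before round `k`. -/
@[reducible] def history [∀ i, MeasurableSpace (S i)] (x0 : Ω → Stack n d)
    (ξ : ℕ → (i : Fin n) → Ω → S i) (ε : ℕ → Fin n → Ω → Vec d) (k : ℕ) : MeasurableSpace Ω :=
  MeasurableSpace.comap x0 inferInstance ⊔
    ⨆ (j : ℕ) (_ : j < k) (i : Fin n),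
      (MeasurableSpace.comap (ξ j i) inferInstance ⊔ MeasurableSpace.comap (ε j i) inferInstance)

/-- The stochastic model for a run of IC-GT with parameters `α`, `γ`. The sampling variables `ξ`,
the communication noise `ε` and the (possibly random, square-integrable) starting point `x0` are
random variables. The communication noise has mean zero given the history and second moment at
most `σc²`; the gradient samples are unbiased given the history, with noise of second moment at
most `σg²`. Within one round the noises of different nodes are uncorrelated, and the gradient
noise is uncorrelated with the communication noise; independence given the history implies this. -/
structure IsRun [MeasurableSpace Ω] (P : Measure Ω) [∀ i, MeasurableSpace (S i)]
    (Q : Matrix (Fin n) (Fin n) ℝ) (α γ : ℝ) (f : Fin n → Vec d → ℝ)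
    (F : (i : Fin n) → Vec d → S i → ℝ) (x0 : Ω → Stack n d)
    (ξ : ℕ → (i : Fin n) → Ω → S i) (ε : ℕ → Fin n → Ω → Vec d) (σg σc : ℝ) : Prop where
  meas_xi : ∀ k i, Measurable (ξ k i)
  meas_eps : ∀ k i, Measurable (ε k i)
  meas_init : Measurable x0
  sq_init : ∀ i, MemLp (fun ω => x0 ω i) 2 P
  diff_sample : ∀ i s, Differentiable ℝ (fun z => F i z s)
  meas_sample : ∀ i, Measurable (fun p : Vec d × S i => sampleGrad F i p.1 p.2)
  comm_sq : ∀ k i, MemLp (ε k i) 2 P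
  comm_mean : ∀ k i, P[ε k i | history x0 ξ ε k] =ᵐ[P] 0
  comm_var : ∀ k i, ∫ ω, ‖ε k i ω‖ ^ 2 ∂P ≤ σc ^ 2
  grad_sq : ∀ k i, MemLp (gradNoise Q α γ f F x0 ξ ε k i) 2 P
  grad_mean : ∀ k i,
    P[fun ω => sampleGrad F i (xIter Q α γ F x0 ξ ε k ω i) (ξ k i ω) | history x0 ξ ε k]
      =ᵐ[P] fun ω => gradient (f i) (xIter Q α γ F x0 ξ ε k ω i)
  grad_var : ∀ k i, ∫ ω, ‖gradNoise Q α γ f F x0 ξ ε k i ω‖ ^ 2 ∂P ≤ σg ^ 2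
  comm_uncorr : ∀ k i j, i ≠ j → ∫ ω, inner ℝ (ε k i ω) (ε k j ω) ∂P = 0
  grad_uncorr : ∀ k i j, i ≠ j →
    ∫ ω, inner ℝ (gradNoise Q α γ f F x0 ξ ε k i ω) (gradNoise Q α γ f F x0 ξ ε k j ω) ∂P = 0
  cross_uncorr : ∀ k i j,
    ∫ ω, inner ℝ (gradNoise Q α γ f F x0 ξ ε k i ω) (ε k j ω) ∂P = 0

end Random

end ICGT

end

/-! The node average makes an inexact gradient step, perturbed by the disagreement of the nodes and
by noise. Averaging the recursion of y shows that the mean tracker is the mean gradient sample plus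
γ times `commSum`, the sum of all earlier communication noise (`IsPath.avg_y`). That sum is a
martingale, so its second moment grows linearly; it causes the term with Tα in the bound. Young's
inequality against strong convexity absorbs it and still leaves the contraction factor 1 - αμ/4
(`norm_step_sq_le`).

The disagreement follows a linear system governed by A = `contrMat`, a symmetric operator with 0 ≤ A
≤ 1 - δ, where δ = γ(1 - λ₂) (`isContr_contrMat`). Its difficulty is that the tracker is fed with
differences of successive gradient samples, which mix the noise of two rounds. Summation by parts
(`tracking_decomposition`) removes these differences: a sample enters an auxiliary state c once, and
c acts on the disagreement through (1 - A)c. The inequality A² ≤ A then shows that the quadratic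
form `lyap` contracts by 1 - δ/2 (`norm_mix_sq_le`, `lyap_sysStep_le`).

Only the gradients at a consensual reference point remain differenced. If that point were the node
average, its increments would carry fresh noise. The reference is therefore the exponentially
smoothed average `runMean`, whose increment is δ times its lag behind the node average
(`IsPath.runMean_succ_sub`); this δ offsets the weight 1/δ² in `lyap`.

By linearity both the disagreement and the lag split into a noise part and a drift part. The noise
parts are driven by inputs orthogonal to the past, so energies add up without cross terms and stay
bounded (`IsNoisyRun.integral_lyap_noiseState_le`, `IsNoisyRun.integral_noiseLag_sq_le`). The drift
parts are treated pathwise: with gain η = αL/δ small, a weighted sum of squared error and drift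
energies decreases up to the noise parts (`combined_step`, `IsPath.potential_step`). Taking
expectations and iterating gives (a); the step size condition makes η small because τ ≥ 2/δ.

For (b), take t of order ln(1/ε), α = e⁻ᵗ/t⁷, γ = e⁻ᵗ/t⁵ and T close to t⁹eᵗ. Up to constants, each
noise term is then at most e⁻ᵗ/t, and the initial error is damped by e⁻⁴ᵗ, which beats the factor τ²
of order at most t¹²e²ᵗ. -/

namespace ICGT

/-! ### Quadratic upper and lower bounds for smooth, strongly convex functions. -/

section Smooth

variable {E : Type*} [NormedAddCommGroup E] [InnerProductSpace ℝ E] [CompleteSpace E]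

theorem hasDerivAt_comp_line {f : E → ℝ} (hf : Differentiable ℝ f) (x v : E) (t : ℝ) :
    HasDerivAt (fun t : ℝ => f (x + t • v)) (inner ℝ (gradient f (x + t • v)) v) t := by
  have h1 := (hf (x + t • v)).hasGradientAt.hasFDerivAt
  have h2 : HasDerivAt (fun t : ℝ => x + t • v) v t := by
    simpa using ((hasDerivAt_id t).smul_const v).const_add x
  exact h1.comp_hasDerivAt t h2

theorem le_add_inner_gradient_add {f : E → ℝ} {L : ℝ} (hf : Differentiable ℝ f)
    (hL : ∀ x y, ‖gradient f x - gradient f y‖ ≤ L * ‖x - y‖) (x y : E) :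
    f y ≤ f x + inner ℝ (gradient f x) (y - x) + L / 2 * ‖y - x‖ ^ 2 := by
  set v := y - x with hv
  -- Along the segment, the excess of f over its quadratic model has derivative at most zero by the
  -- Lipschitz bound, so it decreases from t = 0 to t = 1.
  let φ : ℝ → ℝ := fun t => f (x + t • v) - t * inner ℝ (gradient f x) v - L / 2 * t ^ 2 * ‖v‖ ^ 2
  have hd : ∀ t, HasDerivAt φ (inner ℝ (gradient f (x + t • v)) v - inner ℝ (gradient f x) v
      - L * t * ‖v‖ ^ 2) t := by
    intro t
    have h := ((hasDerivAt_comp_line hf x v t).sub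
      ((hasDerivAt_id t).mul_const (inner ℝ (gradient f x) v))).sub
      (((hasDerivAt_pow 2 t).const_mul (L / 2)).mul_const (‖v‖ ^ 2))
    exact h.congr_deriv (by push_cast; ring)
  have hanti : AntitoneOn φ (Set.Icc 0 1) := by
    apply antitoneOn_of_deriv_nonpos (convex_Icc 0 1)
    · exact fun t _ => (hd t).continuousAt.continuousWithinAt
    · exact fun t _ => (hd t).differentiableAt.differentiableWithinAt
    · intro t ht
      rw [interior_Icc] at ht
      rw [(hd t).deriv, ← inner_sub_left]
      have h1 := real_inner_le_norm (gradient f (x + t • v) - gradient f x) v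
      have h2 := hL (x + t • v) x
      rw [add_sub_cancel_left, norm_smul, Real.norm_of_nonneg ht.1.le] at h2
      nlinarith [norm_nonneg v]
  have h01 := hanti (Set.left_mem_Icc.2 zero_le_one) (Set.right_mem_Icc.2 zero_le_one) zero_le_one
  simp only [φ] at h01
  have hxy : x + (1 : ℝ) • v = y := by rw [hv]; simp
  rw [hxy, zero_smul, add_zero] at h01
  linarith

/-- Divide the strong convexity inequality on the segment by t and let t tend to 0 from the right:
the slope tends to the directional derivative. -/
theorem add_inner_gradient_add_le {f : E → ℝ} {μ : ℝ} (hf : Differentiable ℝ f)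
    (hc : StrongConvexOn Set.univ μ f) (x y : E) :
    f x + inner ℝ (gradient f x) (y - x) + μ / 2 * ‖y - x‖ ^ 2 ≤ f y := by
  have hd := hasDerivAt_comp_line hf x (y - x) 0
  rw [hasDerivAt_iff_tendsto_slope_zero] at hd
  simp only [zero_smul, add_zero, zero_add, smul_eq_mul] at hd
  have hd' := hd.mono_left (nhdsWithin_mono 0 (fun t (ht : t ∈ Set.Ioi (0 : ℝ)) => ne_of_gt ht))
  have hlim : Filter.Tendsto (fun t : ℝ => f y - f x - (1 - t) * (μ / 2 * ‖y - x‖ ^ 2))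
      (nhdsWithin 0 (Set.Ioi 0)) (nhds (f y - f x - (1 - 0) * (μ / 2 * ‖y - x‖ ^ 2))) := by
    apply Filter.Tendsto.mono_left _ nhdsWithin_le_nhds
    apply Continuous.tendsto
    fun_prop
  have := le_of_tendsto_of_tendsto hd' hlim ?_
  · linarith
  · filter_upwards [Ioo_mem_nhdsGT (zero_lt_one : (0 : ℝ) < 1)] with t ht
    have h := hc.2 (Set.mem_univ x) (Set.mem_univ y) (by linarith [ht.2] : 0 ≤ 1 - t) ht.1.le
      (by ring)
    have hx : (1 - t) • x + t • y = x + t • (y - x) := by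
      rw [smul_sub, sub_smul, one_smul]; abel
    rw [hx] at h
    simp only [smul_eq_mul, norm_sub_rev x y] at h
    rw [inv_mul_le_iff₀ ht.1]
    linarith

/-- The two quadratic models at the origin sandwich f at any nonzero vector. In dimension zero there
is no such vector. -/
theorem strong_le_lipschitz [Nontrivial E] {f : E → ℝ} {L μ : ℝ} (hf : Differentiable ℝ f)
    (hL : ∀ x y, ‖gradient f x - gradient f y‖ ≤ L * ‖x - y‖)
    (hc : StrongConvexOn Set.univ μ f) : μ ≤ L := by
  obtain ⟨x, hx⟩ := exists_ne (0 : E)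
  have h1 := le_add_inner_gradient_add hf hL 0 x
  have h2 := add_inner_gradient_add_le hf hc 0 x
  have h3 : 0 < ‖x - 0‖ ^ 2 := by rw [sub_zero]; positivity
  by_contra h
  push Not at h
  nlinarith

end Smooth

/-! ### Young-type inequalities for squared norms. -/

theorem norm_add_sq_le_young {E : Type*} [NormedAddCommGroup E] [InnerProductSpace ℝ E]
    {t : ℝ} (ht : 0 < t) (x y : E) : ‖x + y‖ ^ 2 ≤ (1 + t) * ‖x‖ ^ 2 + (1 + 1 / t) * ‖y‖ ^ 2 := by
  have h1 := norm_add_sq_real x y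
  have h2 := real_inner_le_norm x y
  have h3 : 2 * (‖x‖ * ‖y‖) ≤ t * ‖x‖ ^ 2 + 1 / t * ‖y‖ ^ 2 := by
    have : t * ‖x‖ ^ 2 + 1 / t * ‖y‖ ^ 2 - 2 * (‖x‖ * ‖y‖) = 1 / t * (t * ‖x‖ - ‖y‖) ^ 2 := by
      field_simp; ring
    have h4 : 0 ≤ 1 / t * (t * ‖x‖ - ‖y‖) ^ 2 := by positivity
    linarith
  linarith

theorem norm_add_sq_le_two {E : Type*} [NormedAddCommGroup E] [InnerProductSpace ℝ E]
    (x y : E) : ‖x + y‖ ^ 2 ≤ 2 * ‖x‖ ^ 2 + 2 * ‖y‖ ^ 2 := by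
  have := norm_add_sq_le_young (zero_lt_one) x y
  linarith

theorem norm_sub_sq_le_two {E : Type*} [NormedAddCommGroup E] [InnerProductSpace ℝ E]
    (x y : E) : ‖x - y‖ ^ 2 ≤ 2 * ‖x‖ ^ 2 + 2 * ‖y‖ ^ 2 := by
  have := norm_add_sq_le_two x (-y)
  rwa [norm_neg, ← sub_eq_add_neg] at this

theorem norm_sub_sq_le_young {E : Type*} [NormedAddCommGroup E] [InnerProductSpace ℝ E]
    {t : ℝ} (ht : 0 < t) (x y : E) : ‖x - y‖ ^ 2 ≤ (1 + t) * ‖x‖ ^ 2 + (1 + 1 / t) * ‖y‖ ^ 2 := by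
  have := norm_add_sq_le_young ht x (-y)
  rwa [norm_neg, ← sub_eq_add_neg] at this

/-- Convexity of the squared norm, in the form used for relaxed averaging. -/
theorem norm_sub_sq_le_convex {E : Type*} [NormedAddCommGroup E] [InnerProductSpace ℝ E]
    {δ : ℝ} (h0 : 0 < δ) (h1 : δ ≤ 1) (x y : E) :
    ‖(1 - δ) • x - y‖ ^ 2 ≤ (1 - δ) * ‖x‖ ^ 2 + 1 / δ * ‖y‖ ^ 2 := by
  have e1 := norm_sub_sq_real ((1 - δ) • x) y
  have e2 := norm_add_sq_real (δ • x) y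
  rw [norm_smul, Real.norm_of_nonneg (by linarith), real_inner_smul_left] at e1
  rw [norm_smul, Real.norm_of_nonneg h0.le, real_inner_smul_left] at e2
  have e3 : 0 ≤ (1 - δ) / δ * ‖δ • x + y‖ ^ 2 :=
    mul_nonneg (div_nonneg (by linarith) h0.le) (sq_nonneg _)
  have e4 : (1 - δ) / δ * ‖δ • x + y‖ ^ 2
      = (1 - δ) * δ * ‖x‖ ^ 2 + 2 * (1 - δ) * inner ℝ x y + (1 / δ - 1) * ‖y‖ ^ 2 := by
    rw [e2]; field_simp
  nlinarith

/-! ### Node average and disagreement. -/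

section Average

variable {n d : ℕ}

theorem norm_avg_sq_le (hn : 0 < n) (z : Stack n d) :
    ‖avg z‖ ^ 2 ≤ (n : ℝ)⁻¹ * sqNorm z := by
  have hn' : (0 : ℝ) < n := by exact_mod_cast hn
  have h1 : ‖∑ i, z i‖ ^ 2 ≤ n * ∑ i, ‖z i‖ ^ 2 := by
    have h2 := norm_sum_le Finset.univ z
    have h3 := sq_sum_le_card_mul_sum_sq (s := Finset.univ) (f := fun i => ‖z i‖)
    simp only [Finset.card_univ, Fintype.card_fin] at h3
    exact (pow_le_pow_left₀ (norm_nonneg _) h2 2).trans h3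
  unfold avg sqNorm
  rw [norm_smul, mul_pow, norm_inv, RCLike.norm_natCast]
  calc ((n : ℝ)⁻¹) ^ 2 * ‖∑ i, z i‖ ^ 2 ≤ ((n : ℝ)⁻¹) ^ 2 * (n * ∑ i, ‖z i‖ ^ 2) := by gcongr
    _ = _ := by field_simp

theorem sum_dev (hn : 0 < n) (z : Stack n d) : ∑ i, dev z i = 0 := by
  have hn' : (n : ℝ) ≠ 0 := by exact_mod_cast hn.ne'
  unfold dev avg
  rw [Finset.sum_sub_distrib, Finset.sum_const, Finset.card_univ, Fintype.card_fin,
    ← Nat.cast_smul_eq_nsmul ℝ, smul_smul, mul_inv_cancel₀ hn', one_smul, sub_self]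

/-- The bias-variance identity around an arbitrary centre. -/
theorem sum_norm_sub_sq (hn : 0 < n) (z : Stack n d) (w : Vec d) :
    ∑ i, ‖z i - w‖ ^ 2 = sqNorm (dev z) + n * ‖avg z - w‖ ^ 2 := by
  have h : ∀ i, ‖z i - w‖ ^ 2
      = ‖dev z i‖ ^ 2 + 2 * inner ℝ (dev z i) (avg z - w) + ‖avg z - w‖ ^ 2 := by
    intro i
    rw [← norm_add_sq_real]
    congr 2
    simp [dev]
  rw [Finset.sum_congr rfl fun i _ => h i, Finset.sum_add_distrib, Finset.sum_add_distrib,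
    ← Finset.mul_sum, ← sum_inner, sum_dev hn]
  simp [sqNorm]

theorem sqNorm_dev_le (hn : 0 < n) (z : Stack n d) : sqNorm (dev z) ≤ sqNorm z := by
  have := sum_norm_sub_sq hn z 0
  simp only [sub_zero] at this
  unfold sqNorm at *
  rw [this]
  have : 0 ≤ (n : ℝ) * ‖avg z‖ ^ 2 := by positivity
  linarith

end Average

/-! ### One step of the node average. -/

section Descent

variable {n d : ℕ} {f : Fin n → Vec d → ℝ} {L μ : ℝ} {xs : Vec d}

/-- The optimality gap of the average objective. -/
noncomputable def gap (f : Fin n → Vec d → ℝ) (xs x : Vec d) : ℝ :=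
  (n : ℝ)⁻¹ * ∑ i, (f i x - f i xs)

/-- The stacked local gradients. -/
noncomputable def grads (f : Fin n → Vec d → ℝ) (x : Stack n d) : Stack n d :=
  fun i => gradient (f i) (x i)

theorem gap_nonneg (hxs : IsOptimal f xs) (x : Vec d) : 0 ≤ gap f xs x := by
  have := hxs x
  unfold gap
  rw [Finset.sum_sub_distrib, mul_sub]
  linarith

/-- A gradient step of length 1/L from x lowers the average objective by at least ‖g‖²/(2L), and it
cannot pass below the minimum. -/
theorem norm_avg_grads_const_sq_le (hn : 0 < n) (hL : 0 < L) (hf : IsRegular f L μ)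
    (hxs : IsOptimal f xs) (x : Vec d) :
    ‖avg (grads f fun _ => x)‖ ^ 2 ≤ 2 * L * gap f xs x := by
  have hn' : (0 : ℝ) < n := by exact_mod_cast hn
  set g := avg (grads f fun _ => x) with hg
  have h1 : ∀ i, f i (x - L⁻¹ • g) ≤ f i x - L⁻¹ * inner ℝ (gradient (f i) x) g
      + L⁻¹ / 2 * ‖g‖ ^ 2 := by
    intro i
    have := le_add_inner_gradient_add (hf.diff i) (hf.smooth i) x (x - L⁻¹ • g)
    rw [sub_sub_cancel_left, inner_neg_right, real_inner_smul_right, norm_neg, norm_smul,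
      Real.norm_of_nonneg (by positivity)] at this
    have e : L / 2 * (L⁻¹ * ‖g‖) ^ 2 = L⁻¹ / 2 * ‖g‖ ^ 2 := by field_simp
    linarith
  have h2 := hxs (x - L⁻¹ • g)
  have h3 := Finset.sum_le_sum fun i (_ : i ∈ Finset.univ) => h1 i
  rw [Finset.sum_add_distrib, Finset.sum_sub_distrib, ← Finset.mul_sum, ← sum_inner] at h3
  have h4 : ∑ i, gradient (f i) x = (n : ℝ) • g := by
    rw [hg, avg, smul_smul, mul_inv_cancel₀ hn'.ne', one_smul]; rfl
  rw [h4, real_inner_smul_left, real_inner_self_eq_norm_sq] at h3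
  simp only [Finset.sum_const, Finset.card_univ, Fintype.card_fin, nsmul_eq_mul] at h3
  have h5 : (n : ℝ)⁻¹ * ∑ i, f i (x - L⁻¹ • g) ≤ (n : ℝ)⁻¹ * ∑ i, f i x - L⁻¹ / 2 * ‖g‖ ^ 2 := by
    have := mul_le_mul_of_nonneg_left h3 (inv_nonneg.2 hn'.le)
    refine this.trans (le_of_eq ?_)
    field_simp
    ring
  unfold gap
  rw [Finset.sum_sub_distrib, mul_sub]
  have h6 : L⁻¹ / 2 * ‖g‖ ^ 2 ≤ (n : ℝ)⁻¹ * ∑ i, f i x - (n : ℝ)⁻¹ * ∑ i, f i xs := by linarith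
  have h7 := mul_le_mul_of_nonneg_left h6 (by positivity : 0 ≤ 2 * L)
  have e : 2 * L * (L⁻¹ / 2 * ‖g‖ ^ 2) = ‖g‖ ^ 2 := by field_simp
  linarith

theorem sqNorm_grads_sub_le (hf : IsRegular f L μ) (x y : Stack n d) :
    sqNorm (grads f x - grads f y) ≤ L ^ 2 * ∑ i, ‖x i - y i‖ ^ 2 := by
  unfold sqNorm
  rw [Finset.mul_sum]
  refine Finset.sum_le_sum fun i _ => ?_
  rw [← mul_pow]
  exact pow_le_pow_left₀ (norm_nonneg _) (hf.smooth i _ _) 2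

theorem avg_sub (x y : Stack n d) : avg (x - y) = avg x - avg y := by
  simp [avg, smul_sub]

theorem norm_avg_grads_sq_le (hn : 0 < n) (hL : 0 < L) (hf : IsRegular f L μ)
    (hxs : IsOptimal f xs) (x : Stack n d) :
    ‖avg (grads f x)‖ ^ 2 ≤ 2 * L ^ 2 / n * sqNorm (dev x) + 4 * L * gap f xs (avg x) := by
  have h1 := norm_avg_sq_le hn (grads f x - grads f fun _ => avg x)
  have h2 := sqNorm_grads_sub_le hf x fun _ => avg x
  have h3 := norm_avg_grads_const_sq_le hn hL hf hxs (avg x)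
  have h4 := norm_add_sq_le_two (avg (grads f x - grads f fun _ => avg x))
    (avg (grads f fun _ => avg x))
  have h5 : avg (grads f x - grads f fun _ => avg x) + avg (grads f fun _ => avg x)
      = avg (grads f x) := by rw [avg_sub]; abel
  rw [h5] at h4
  have h6 : ∑ i, ‖x i - avg x‖ ^ 2 = sqNorm (dev x) := rfl
  rw [h6] at h2
  have h7 : (n : ℝ)⁻¹ * sqNorm (grads f x - grads f fun _ => avg x)
      ≤ (n : ℝ)⁻¹ * (L ^ 2 * sqNorm (dev x)) := by gcongr
  have h8 : (n : ℝ)⁻¹ * (L ^ 2 * sqNorm (dev x)) = L ^ 2 / n * sqNorm (dev x) := by ring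
  have h9 : 2 * L ^ 2 / n * sqNorm (dev x) = 2 * (L ^ 2 / n * sqNorm (dev x)) := by ring
  linarith

/-- The local gradients are taken at the points `x i`, yet the gap is wanted at the average.
Smoothness between `x i` and the average and strong convexity between `x i` and `xs` give both, at
the price of the disagreement. -/
theorem inner_avg_grads_ge (hn : 0 < n) (hf : IsRegular f L μ) (x : Stack n d) :
    gap f xs (avg x) + μ / 2 * ‖avg x - xs‖ ^ 2 + (μ - L) / (2 * n) * sqNorm (dev x)
      ≤ inner ℝ (avg x - xs) (avg (grads f x)) := by
  have hn' : (0 : ℝ) < n := by exact_mod_cast hn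
  have h : ∀ i, f i (avg x) - f i xs + μ / 2 * ‖x i - xs‖ ^ 2 - L / 2 * ‖x i - avg x‖ ^ 2
      ≤ inner ℝ (avg x - xs) (gradient (f i) (x i)) := by
    intro i
    have h1 := le_add_inner_gradient_add (hf.diff i) (hf.smooth i) (x i) (avg x)
    have h2 := add_inner_gradient_add_le (hf.diff i) (hf.strong i) (x i) xs
    have h3 : inner ℝ (avg x - xs) (gradient (f i) (x i))
        = inner ℝ (gradient (f i) (x i)) (avg x - x i)
          - inner ℝ (gradient (f i) (x i)) (xs - x i) := by
      rw [← inner_sub_right, real_inner_comm]; congr 1; abel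
    rw [norm_sub_rev] at h1 h2
    linarith
  have h1 := Finset.sum_le_sum fun i (_ : i ∈ Finset.univ) => h i
  rw [Finset.sum_sub_distrib, Finset.sum_add_distrib, ← Finset.mul_sum, ← Finset.mul_sum,
    ← inner_sum, sum_norm_sub_sq hn x xs] at h1
  have h2 : ∑ i, ‖x i - avg x‖ ^ 2 = sqNorm (dev x) := rfl
  rw [h2] at h1
  have h3 := mul_le_mul_of_nonneg_left h1 (inv_nonneg.2 hn'.le)
  have h4 : inner ℝ (avg x - xs) (avg (grads f x))
      = (n : ℝ)⁻¹ * inner ℝ (avg x - xs) (∑ i, gradient (f i) (x i)) := by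
    unfold avg grads
    rw [real_inner_smul_right]
  rw [h4]
  refine le_trans (le_of_eq ?_) h3
  unfold gap
  field_simp
  ring

/-- One inexact gradient step on the node average. -/
theorem norm_step_sq_le (hn : 0 < n) (hL : 0 < L) (hμ : 0 < μ) (hf : IsRegular f L μ)
    (hxs : IsOptimal f xs) {α γ : ℝ} (hα : 0 < α) (x : Stack n d) (S : Vec d) :
    ‖avg x - xs - α • (avg (grads f x) + γ • S)‖ ^ 2
      ≤ (1 - α * μ / 4) * ‖avg x - xs‖ ^ 2 - (2 * α - 8 * α ^ 2 * L) * gap f xs (avg x)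
        + α * L / n * (1 + 4 * α * L) * sqNorm (dev x)
        + (4 * α * γ ^ 2 / (3 * μ) + 2 * α ^ 2 * γ ^ 2) * ‖S‖ ^ 2 := by
  have hn' : (0 : ℝ) < n := by exact_mod_cast hn
  have h1 := inner_avg_grads_ge (xs := xs) hn hf x
  have h2 := norm_avg_grads_sq_le hn hL hf hxs x
  have h3 := norm_add_sq_le_two (avg (grads f x)) (γ • S)
  rw [norm_sub_sq_real, real_inner_smul_right, inner_add_right, norm_smul, mul_pow,
    Real.norm_eq_abs, sq_abs]
  rw [norm_smul, mul_pow, Real.norm_eq_abs, sq_abs] at h3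
  -- Strong convexity provides αμ‖x̄ - x*‖². Three quarters of it pay for the accumulated
  -- communication noise, one quarter remains as contraction.
  have h4 : -(2 * (α * inner ℝ (avg x - xs) (γ • S)))
      ≤ 3 / 4 * (α * μ) * ‖avg x - xs‖ ^ 2 + 4 * α * γ ^ 2 / (3 * μ) * ‖S‖ ^ 2 := by
    have h5 := neg_le_of_abs_le (abs_real_inner_le_norm (avg x - xs) (γ • S))
    rw [norm_smul, Real.norm_eq_abs] at h5
    have h6 : 3 / 4 * (α * μ) * ‖avg x - xs‖ ^ 2 + 4 * α * γ ^ 2 / (3 * μ) * ‖S‖ ^ 2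
        - 2 * α * (‖avg x - xs‖ * (|γ| * ‖S‖))
        = α / (12 * μ) * (3 * μ * ‖avg x - xs‖ - 4 * |γ| * ‖S‖) ^ 2 := by
      rw [← sq_abs γ]; field_simp; ring
    have h7 : 0 ≤ α / (12 * μ) * (3 * μ * ‖avg x - xs‖ - 4 * |γ| * ‖S‖) ^ 2 := by positivity
    nlinarith
  have h8 := mul_le_mul_of_nonneg_left h1 hα.le
  have h9 := mul_le_mul_of_nonneg_left h3 (sq_nonneg α)
  have h10 := mul_le_mul_of_nonneg_left h2 (sq_nonneg α)
  have h11 : 0 ≤ α * μ / n * sqNorm (dev x) :=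
    mul_nonneg (by positivity) (Finset.sum_nonneg fun i _ => sq_nonneg _)
  have e1 : α * (gap f xs (avg x) + μ / 2 * ‖avg x - xs‖ ^ 2 + (μ - L) / (2 * n) * sqNorm (dev x))
      = α * gap f xs (avg x) + α * μ / 2 * ‖avg x - xs‖ ^ 2 + (α * μ / n * sqNorm (dev x)
        - α * L / n * sqNorm (dev x)) / 2 := by field_simp
  have e2 : α ^ 2 * (2 * L ^ 2 / n * sqNorm (dev x) + 4 * L * gap f xs (avg x))
      = (4 * α * L * (α * L / n * sqNorm (dev x))) / 2 + 4 * α ^ 2 * L * gap f xs (avg x) := by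
    field_simp; ring
  have e3 : α * L / n * (1 + 4 * α * L) * sqNorm (dev x)
      = α * L / n * sqNorm (dev x) + 4 * α * L * (α * L / n * sqNorm (dev x)) := by ring
  rw [e1] at h8
  rw [e2] at h10
  rw [e3]
  linarith

end Descent

end ICGT

namespace ICGT

/-! ### Mixing operators on the Hilbert space of stacked vectors -/

/-- Stacked vectors with the `ℓ²` norm. -/
abbrev StackL2 (n d : ℕ) : Type := PiLp 2 (fun _ : Fin n => Vec d)

section Mixing

variable {n d : ℕ}

theorem norm_toLp_sq (z : Stack n d) : ‖(WithLp.toLp 2 z : StackL2 n d)‖ ^ 2 = sqNorm z := by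
  rw [PiLp.norm_sq_eq_of_L2]; rfl

theorem norm_stackL2_sq (z : StackL2 n d) : ‖z‖ ^ 2 = ∑ i, ‖z i‖ ^ 2 :=
  PiLp.norm_sq_eq_of_L2 _ _

/-- The action of a matrix on stacked vectors. -/
noncomputable def matL (M : Matrix (Fin n) (Fin n) ℝ) : StackL2 n d →L[ℝ] StackL2 n d :=
  { toFun := fun z => WithLp.toLp 2 fun i => ∑ j, M i j • z j
    map_add' := fun x y => by
      ext i : 1
      simp [Finset.sum_add_distrib]
    map_smul' := fun c x => by
      ext i : 1
      simp [Finset.smul_sum, smul_comm c]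
    cont := by fun_prop }

theorem matL_apply (M : Matrix (Fin n) (Fin n) ℝ) (z : StackL2 n d) (i : Fin n) :
    matL M z i = ∑ j, M i j • z j := rfl

theorem matL_mul_apply (M N : Matrix (Fin n) (Fin n) ℝ) (z : StackL2 n d) :
    matL (M * N) z = matL M (matL N z) := by
  ext i : 1
  simp only [matL_apply, Matrix.mul_apply, Finset.smul_sum, Finset.sum_smul, smul_smul]
  exact Finset.sum_comm

theorem matL_add_apply (M N : Matrix (Fin n) (Fin n) ℝ) (z : StackL2 n d) :
    matL (M + N) z = matL M z + matL N z := by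
  ext i : 1
  simp [matL_apply, add_smul, Finset.sum_add_distrib]

theorem matL_sub_apply (M N : Matrix (Fin n) (Fin n) ℝ) (z : StackL2 n d) :
    matL (M - N) z = matL M z - matL N z := by
  ext i : 1
  simp [matL_apply, sub_smul, Finset.sum_sub_distrib]

theorem matL_smul_apply (c : ℝ) (M : Matrix (Fin n) (Fin n) ℝ) (z : StackL2 n d) :
    matL (c • M) z = c • matL M z := by
  ext i : 1
  simp [matL_apply, Finset.smul_sum, smul_smul]

theorem matL_one_apply (z : StackL2 n d) : matL (1 : Matrix (Fin n) (Fin n) ℝ) z = z := by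
  ext i : 1
  simp [matL_apply, Matrix.one_apply]

theorem inner_matL (M : Matrix (Fin n) (Fin n) ℝ) (z w : StackL2 n d) :
    inner ℝ z (matL M w) = inner ℝ (matL M.transpose z) w := by
  rw [PiLp.inner_apply, PiLp.inner_apply]
  simp only [matL_apply, inner_sum, sum_inner, real_inner_smul_left, real_inner_smul_right,
    Matrix.transpose_apply]
  exact Finset.sum_comm

/-- Schur's test: Cauchy-Schwarz with the row weights, then summation over columns. -/
theorem norm_matL_le {M : Matrix (Fin n) (Fin n) ℝ} (h0 : ∀ i j, 0 ≤ M i j)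
    (hr : ∀ i, ∑ j, M i j ≤ 1) (hc : ∀ j, ∑ i, M i j ≤ 1) (z : StackL2 n d) :
    ‖matL M z‖ ^ 2 ≤ ‖z‖ ^ 2 := by
  rw [norm_stackL2_sq, norm_stackL2_sq]
  have h1 : ∀ i, ‖matL M z i‖ ^ 2 ≤ ∑ j, M i j * ‖z j‖ ^ 2 := by
    intro i
    rw [matL_apply]
    have h2 : ‖∑ j, M i j • z j‖ ≤ ∑ j, M i j * ‖z j‖ := by
      refine (norm_sum_le _ _).trans (le_of_eq (Finset.sum_congr rfl fun j _ => ?_))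
      rw [norm_smul, Real.norm_of_nonneg (h0 i j)]
    have h3 := Finset.sum_sq_le_sum_mul_sum_of_sq_le_mul Finset.univ
      (r := fun j => M i j * ‖z j‖) (f := fun j => M i j) (g := fun j => M i j * ‖z j‖ ^ 2)
      (fun j _ => h0 i j) (fun j _ => mul_nonneg (h0 i j) (sq_nonneg _)) (fun j _ => (by ring : _ = _).le)
    have h4 : 0 ≤ ∑ j, M i j * ‖z j‖ ^ 2 :=
      Finset.sum_nonneg fun j _ => mul_nonneg (h0 i j) (sq_nonneg _)
    calc ‖∑ j, M i j • z j‖ ^ 2 ≤ (∑ j, M i j * ‖z j‖) ^ 2 :=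
          pow_le_pow_left₀ (norm_nonneg _) h2 2
      _ ≤ (∑ j, M i j) * ∑ j, M i j * ‖z j‖ ^ 2 := h3
      _ ≤ 1 * ∑ j, M i j * ‖z j‖ ^ 2 := mul_le_mul_of_nonneg_right (hr i) h4
      _ = _ := one_mul _
  refine (Finset.sum_le_sum fun i _ => h1 i).trans ?_
  rw [Finset.sum_comm]
  refine Finset.sum_le_sum fun j _ => ?_
  rw [← Finset.sum_mul]
  nlinarith [hc j, sq_nonneg ‖z j‖]

/-- Spectral bound for a symmetric doubly stochastic matrix on vectors of mean zero. -/
theorem dotProduct_mulVec_le_lam2 {hn : 2 ≤ n} {Q : Matrix (Fin n) (Fin n) ℝ}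
    (hQ : IsMixing hn Q) (u : Fin n → ℝ) (hu : ∑ i, u i = 0) :
    ∑ i, u i * ∑ j, Q i j * u j ≤ lam2 hQ * ∑ i, u i ^ 2 := by
  have hT := Matrix.isSymmetric_toEuclideanLin_iff.mpr (isHermitian_of_isSymm hQ.symm)
  set T := Matrix.toEuclideanLin Q with hTdef
  let b := hT.eigenvectorBasis finrank_euclideanSpace
  let ev := hT.eigenvalues finrank_euclideanSpace
  have hb : ∀ i, T (b i) = ev i • b i :=
    fun i => hT.apply_eigenvectorBasis finrank_euclideanSpace i
  let one : EuclideanSpace ℝ (Fin n) := WithLp.toLp 2 fun _ => 1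
  let w : EuclideanSpace ℝ (Fin n) := WithLp.toLp 2 u
  have hT1 : T one = one := by
    ext i
    have := sum_row_of_mem_doublyStochastic hQ.stoch i
    simp [one, hTdef, Matrix.toEuclideanLin, Matrix.toLpLin_apply, Matrix.mulVec, dotProduct, this]
  let i0 : Fin (Fintype.card (Fin n)) := Fin.cast (Fintype.card_fin n).symm ⟨0, by omega⟩
  let i1 : Fin (Fintype.card (Fin n)) := Fin.cast (Fintype.card_fin n).symm ⟨1, by omega⟩
  have hev1 : ev i1 = lam2 hQ := rfl
  have hev : ∀ i, i ≠ i0 → ev i ≤ lam2 hQ := by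
    intro i hi
    rw [← hev1]
    apply hT.eigenvalues_antitone finrank_euclideanSpace
    rw [Fin.le_def]
    have : (i : ℕ) ≠ 0 := fun h => hi (Fin.ext h)
    simp only [i1, Fin.val_cast]
    omega
  -- Eigenvectors with eigenvalue below 1 are orthogonal to the all-ones vector, which has
  -- eigenvalue 1. Hence the all-ones vector is a multiple of `b i0`, and a vector of mean zero has
  -- no component along `b i0`.
  have horth : ∀ i, i ≠ i0 → inner ℝ (b i) one = 0 := by
    intro i hi
    have h1 : inner ℝ (T (b i)) one = inner ℝ (b i) (T one) := hT _ _
    rw [hb, hT1, real_inner_smul_left] at h1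
    have h2 : ev i < 1 := (hev i hi).trans_lt hQ.eig_second
    have h3 : (ev i - 1) * inner ℝ (b i) one = 0 := by linarith
    rcases mul_eq_zero.1 h3 with h | h
    · linarith
    · exact h
  have hone : one = inner ℝ (b i0) one • b i0 := by
    conv_lhs => rw [← b.sum_repr' one]
    exact Finset.sum_eq_single i0 (fun i _ hi => by rw [horth i hi, zero_smul])
      (fun h => absurd (Finset.mem_univ _) h)
  have hw1 : inner ℝ one w = 0 := by
    simp [one, w, PiLp.inner_apply, hu]
  have hb0w : inner ℝ (b i0) w = 0 := by
    rw [hone, real_inner_smul_left] at hw1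
    rcases mul_eq_zero.1 hw1 with h | h
    · exfalso
      rw [h, zero_smul] at hone
      have : one ⟨0, by omega⟩ = 0 := by rw [hone]; rfl
      simp [one] at this
    · exact h
  have hq : inner ℝ w (T w) = ∑ i, ev i * inner ℝ (b i) w ^ 2 := by
    rw [← b.sum_inner_mul_inner w (T w)]
    refine Finset.sum_congr rfl fun i _ => ?_
    rw [← hT (b i) w, hb, real_inner_smul_left, real_inner_comm (b i) w]
    ring
  have hnorm : ∑ i, inner ℝ (b i) w ^ 2 = ‖w‖ ^ 2 := by
    rw [← real_inner_self_eq_norm_sq, ← b.sum_inner_mul_inner w w]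
    refine Finset.sum_congr rfl fun i _ => ?_
    rw [real_inner_comm (b i) w]
    ring
  have hle : inner ℝ w (T w) ≤ lam2 hQ * ‖w‖ ^ 2 := by
    rw [hq, ← hnorm, Finset.mul_sum]
    refine Finset.sum_le_sum fun i _ => ?_
    by_cases hi : i = i0
    · rw [hi, hb0w]; simp
    · exact mul_le_mul_of_nonneg_right (hev i hi) (sq_nonneg _)
  have e1 : inner ℝ w (T w) = ∑ i, u i * ∑ j, Q i j * u j := by
    simp [w, hTdef, PiLp.inner_apply, Matrix.toEuclideanLin, Matrix.toLpLin_apply, Matrix.mulVec,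
      dotProduct, mul_comm]
  have e2 : ‖w‖ ^ 2 = ∑ i, u i ^ 2 := by
    simp [w, EuclideanSpace.norm_sq_eq]
  rwa [e1, e2] at hle

/-- The matrix acts on each of the d coordinates separately, so the scalar bound is summed over
coordinates. -/
theorem inner_matL_le_lam2 {hn : 2 ≤ n} {Q : Matrix (Fin n) (Fin n) ℝ}
    (hQ : IsMixing hn Q) (z : StackL2 n d) (hz : ∑ i, z i = 0) :
    inner ℝ z (matL Q z) ≤ lam2 hQ * ‖z‖ ^ 2 := by
  have h : ∀ c : Fin d, ∑ i, z i c * ∑ j, Q i j * z j c ≤ lam2 hQ * ∑ i, z i c ^ 2 := by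
    intro c
    apply dotProduct_mulVec_le_lam2
    have := congrArg (fun v : Vec d => v c) hz
    simpa using this
  have h1 := Finset.sum_le_sum fun c (_ : c ∈ Finset.univ) => h c
  have e1 : inner ℝ z (matL Q z) = ∑ c, ∑ i, z i c * ∑ j, Q i j * z j c := by
    rw [Finset.sum_comm]
    simp [PiLp.inner_apply, matL_apply, mul_comm]
  have e2 : ‖z‖ ^ 2 = ∑ c, ∑ i, z i c ^ 2 := by
    rw [Finset.sum_comm, norm_stackL2_sq]
    simp [EuclideanSpace.norm_sq_eq]
  rw [e1, e2, Finset.mul_sum]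
  exact h1

/-- The averaging matrix `(1/n) 1 1ᵀ`. -/
noncomputable def avgMat (n : ℕ) : Matrix (Fin n) (Fin n) ℝ := fun _ _ => (n : ℝ)⁻¹

/-- The matrix of the map `z ↦ z - z̄`. -/
noncomputable def devMat (n : ℕ) : Matrix (Fin n) (Fin n) ℝ := 1 - avgMat n

/-- The damped mixing matrix `(1 - γ) I + γ Q`. -/
noncomputable def dampMat (Q : Matrix (Fin n) (Fin n) ℝ) (γ : ℝ) : Matrix (Fin n) (Fin n) ℝ :=
  (1 - γ) • 1 + γ • Q

/-- The off-diagonal part of the mixing matrix. -/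
noncomputable def offMat (Q : Matrix (Fin n) (Fin n) ℝ) : Matrix (Fin n) (Fin n) ℝ :=
  fun i j => if j = i then 0 else Q i j

theorem matL_avgMat_apply (z : StackL2 n d) (i : Fin n) : matL (avgMat n) z i = avg z.ofLp := by
  simp [matL_apply, avgMat, avg, Finset.smul_sum]

theorem matL_devMat_toLp (z : Stack n d) :
    matL (devMat n) (WithLp.toLp 2 z) = (WithLp.toLp 2 (dev z) : StackL2 n d) := by
  rw [devMat, matL_sub_apply, matL_one_apply]
  ext i : 1
  rw [PiLp.sub_apply, matL_avgMat_apply]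
  rfl

theorem sum_matL_devMat (hn : 0 < n) (z : StackL2 n d) : ∑ i, matL (devMat n) z i = 0 := by
  rw [← WithLp.toLp_ofLp 2 z, matL_devMat_toLp]
  exact sum_dev hn z.ofLp

theorem norm_matL_devMat_le (hn : 0 < n) (z : StackL2 n d) :
    ‖matL (devMat n) z‖ ^ 2 ≤ ‖z‖ ^ 2 := by
  rw [← WithLp.toLp_ofLp 2 z, matL_devMat_toLp, norm_toLp_sq, norm_toLp_sq]
  exact sqNorm_dev_le hn _

/-- The damped mixing matrix restricted to disagreement vectors. -/
noncomputable def contrMat (Q : Matrix (Fin n) (Fin n) ℝ) (γ : ℝ) : Matrix (Fin n) (Fin n) ℝ :=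
  dampMat Q γ - avgMat n

theorem avgMat_mul_of_col {M : Matrix (Fin n) (Fin n) ℝ} (hc : ∀ j, ∑ i, M i j = 1) :
    avgMat n * M = avgMat n := by
  ext i j
  simp [Matrix.mul_apply, avgMat, ← Finset.mul_sum, hc]

theorem mul_avgMat_of_row {M : Matrix (Fin n) (Fin n) ℝ} (hr : ∀ i, ∑ j, M i j = 1) :
    M * avgMat n = avgMat n := by
  ext i j
  simp [Matrix.mul_apply, avgMat, ← Finset.sum_mul, hr]

theorem dampMat_col {Q : Matrix (Fin n) (Fin n) ℝ} (hQ : Q ∈ doublyStochastic ℝ (Fin n)) (γ : ℝ)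
    (j : Fin n) : ∑ i, dampMat Q γ i j = 1 := by
  simp [dampMat, Finset.sum_add_distrib, ← Finset.mul_sum, sum_col_of_mem_doublyStochastic hQ,
    Matrix.one_apply]

theorem dampMat_row {Q : Matrix (Fin n) (Fin n) ℝ} (hQ : Q ∈ doublyStochastic ℝ (Fin n)) (γ : ℝ)
    (i : Fin n) : ∑ j, dampMat Q γ i j = 1 := by
  simp [dampMat, Finset.sum_add_distrib, ← Finset.mul_sum, sum_row_of_mem_doublyStochastic hQ,
    Matrix.one_apply]

theorem avgMat_row (hn : 0 < n) (i : Fin n) : ∑ j, avgMat n i j = 1 := by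
  have hn' : (n : ℝ) ≠ 0 := by exact_mod_cast hn.ne'
  simp [avgMat, hn']

theorem devMat_mul_dampMat {Q : Matrix (Fin n) (Fin n) ℝ} (hQ : Q ∈ doublyStochastic ℝ (Fin n))
    (γ : ℝ) : devMat n * dampMat Q γ = contrMat Q γ := by
  rw [devMat, contrMat, Matrix.sub_mul, Matrix.one_mul, avgMat_mul_of_col (dampMat_col hQ γ)]

theorem dampMat_mul_devMat {Q : Matrix (Fin n) (Fin n) ℝ}
    (hQ : Q ∈ doublyStochastic ℝ (Fin n)) (γ : ℝ) :
    dampMat Q γ * devMat n = contrMat Q γ := by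
  rw [devMat, contrMat, Matrix.mul_sub, Matrix.mul_one, mul_avgMat_of_row (dampMat_row hQ γ)]

theorem contrMat_mul_devMat (hn : 0 < n) {Q : Matrix (Fin n) (Fin n) ℝ}
    (hQ : Q ∈ doublyStochastic ℝ (Fin n)) (γ : ℝ) :
    contrMat Q γ * devMat n = contrMat Q γ := by
  rw [devMat, Matrix.mul_sub, Matrix.mul_one, contrMat, Matrix.sub_mul,
    mul_avgMat_of_row (dampMat_row hQ γ), mul_avgMat_of_row (avgMat_row hn), sub_self, sub_zero]

theorem contrMat_transpose {Q : Matrix (Fin n) (Fin n) ℝ} (hQ : Q.IsSymm) (γ : ℝ) :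
    (contrMat Q γ).transpose = contrMat Q γ := by
  have h : (avgMat n).transpose = avgMat n := rfl
  rw [contrMat, dampMat, Matrix.transpose_sub, Matrix.transpose_add, Matrix.transpose_smul,
    Matrix.transpose_smul, Matrix.transpose_one, hQ.eq, h]

theorem inner_matL_avgMat_of_sum_eq_zero (z w : StackL2 n d) (hw : ∑ i, w i = 0) :
    inner ℝ (matL (avgMat n) z) w = 0 := by
  rw [PiLp.inner_apply]
  simp only [matL_avgMat_apply]
  rw [← inner_sum, hw, inner_zero_right]

/-- The properties of the mixing operator used by the Lyapunov analysis. -/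
structure IsContr {K : Type*} [NormedAddCommGroup K] [InnerProductSpace ℝ K]
    (A : K →L[ℝ] K) (δ : ℝ) : Prop where
  symm : ∀ z w, inner ℝ (A z) w = inner ℝ z (A w)
  le : ∀ z, inner ℝ z (A z) ≤ (1 - δ) * ‖z‖ ^ 2
  sq_le : ∀ z, ‖A z‖ ^ 2 ≤ inner ℝ z (A z)

/-- On disagreement vectors the operator is 1 - γM with M = 1 - Q. The upper bound is the spectral
gap. Since Q is a contraction, ‖Mw‖² ≤ 2⟨w, Mw⟩, and for small γ this gives A² ≤ A. -/
theorem isContr_contrMat {hn : 2 ≤ n} {Q : Matrix (Fin n) (Fin n) ℝ} (hQ : IsMixing hn Q)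
    {γ : ℝ} (h0 : 0 < γ) (h1 : γ < 1 / 4) :
    IsContr (matL (d := d) (contrMat Q γ)) (γ * (1 - lam2 hQ)) := by
  have hn0 : 0 < n := by omega
  have hl : -1 < lam2 hQ := hQ.eig_all _
  -- The operator ignores the average of its argument and returns vectors of mean zero, so z may be
  -- replaced by its disagreement w.
  have key : ∀ z : StackL2 n d, ∃ w : StackL2 n d, ∑ i, w i = 0 ∧ ‖w‖ ^ 2 ≤ ‖z‖ ^ 2 ∧
      matL (contrMat Q γ) z = w - γ • (w - matL Q w) ∧
      inner ℝ z (matL (contrMat Q γ) z) = inner ℝ w (matL (contrMat Q γ) z) := by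
    intro z
    refine ⟨matL (devMat n) z, sum_matL_devMat hn0 z, norm_matL_devMat_le hn0 z, ?_, ?_⟩
    · rw [← dampMat_mul_devMat hQ.stoch, matL_mul_apply, dampMat, matL_add_apply, matL_smul_apply,
        matL_smul_apply, matL_one_apply, smul_sub, sub_smul, one_smul]
      abel
    · rw [devMat, matL_sub_apply, matL_one_apply, inner_sub_left,
        inner_matL_avgMat_of_sum_eq_zero, sub_zero]
      rw [← devMat_mul_dampMat hQ.stoch, matL_mul_apply]
      exact sum_matL_devMat hn0 _
  refine ⟨fun z w => ?_, fun z => ?_, fun z => ?_⟩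
  · rw [inner_matL, contrMat_transpose hQ.symm]
  · obtain ⟨w, hw, hwz, e1, e2⟩ := key z
    rw [e2, e1, inner_sub_right, real_inner_smul_right, inner_sub_right,
      real_inner_self_eq_norm_sq]
    have h2 := inner_matL_le_lam2 hQ w hw
    have h3 : 0 ≤ 1 - γ * (1 - lam2 hQ) := by nlinarith
    have h4 := mul_le_mul_of_nonneg_left hwz h3
    have h5 := mul_le_mul_of_nonneg_left h2 h0.le
    linarith
  · obtain ⟨w, hw, hwz, e1, e2⟩ := key z
    rw [e2, e1]
    set m := w - matL Q w with hm
    have h2 : ‖matL Q w‖ ^ 2 ≤ ‖w‖ ^ 2 :=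
      norm_matL_le (fun i j => nonneg_of_mem_doublyStochastic hQ.stoch)
        (fun i => (sum_row_of_mem_doublyStochastic hQ.stoch i).le)
        (fun j => (sum_col_of_mem_doublyStochastic hQ.stoch j).le) w
    have h3 : matL Q w = w - m := by rw [hm]; abel
    rw [h3, norm_sub_sq_real] at h2
    rw [norm_sub_sq_real, inner_sub_right, real_inner_smul_right, real_inner_self_eq_norm_sq,
      norm_smul, Real.norm_of_nonneg h0.le]
    have h4 : 0 ≤ ‖m‖ ^ 2 := sq_nonneg _
    have h5 : ‖m‖ ^ 2 ≤ 2 * inner ℝ w m := by linarith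
    have h6 : γ * ‖m‖ ^ 2 ≤ inner ℝ w m := by nlinarith
    nlinarith

theorem norm_matL_offMat_le {Q : Matrix (Fin n) (Fin n) ℝ}
    (hQ : Q ∈ doublyStochastic ℝ (Fin n)) (z : StackL2 n d) :
    ‖matL (offMat Q) z‖ ^ 2 ≤ ‖z‖ ^ 2 := by
  have h0 : ∀ i j, 0 ≤ offMat Q i j := by
    intro i j
    unfold offMat
    split_ifs
    · exact le_rfl
    · exact nonneg_of_mem_doublyStochastic hQ
  have hle : ∀ i j, offMat Q i j ≤ Q i j := by
    intro i j
    unfold offMat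
    split_ifs
    · exact nonneg_of_mem_doublyStochastic hQ
    · exact le_rfl
  exact norm_matL_le h0
    (fun i => (Finset.sum_le_sum fun j _ => hle i j).trans
      (sum_row_of_mem_doublyStochastic hQ i).le)
    (fun j => (Finset.sum_le_sum fun i _ => hle i j).trans
      (sum_col_of_mem_doublyStochastic hQ j).le) z

theorem toLp_mix {Q : Matrix (Fin n) (Fin n) ℝ} (hQ : Q ∈ doublyStochastic ℝ (Fin n)) (γ : ℝ)
    (z e : Stack n d) : (WithLp.toLp 2 (mix Q γ z e) : StackL2 n d)
      = matL (dampMat Q γ) (WithLp.toLp 2 z) + γ • matL (offMat Q) (WithLp.toLp 2 e) := by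
  ext i : 1
  -- Non-neighbours other than i have weight zero, since the weights are nonnegative; the sum may
  -- thus run over all nodes with the diagonal removed.
  have h1 : ∑ j ∈ neighbors Q i, Q i j • (z j + e j)
      = ∑ j, offMat Q i j • (z j + e j) := by
    unfold neighbors offMat
    rw [Finset.sum_filter]
    refine Finset.sum_congr rfl fun j _ => ?_
    by_cases hj : j = i
    · simp [hj]
    · have h2 : 0 ≤ Q i j := nonneg_of_mem_doublyStochastic hQ
      by_cases h3 : 0 < Q i j
      · simp [hj, h3]
      · have : Q i j = 0 := le_antisymm (not_lt.1 h3) h2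
        simp [this]
  have h2 : ∑ j, Q i j • z j = Q i i • z i + ∑ j, offMat Q i j • z j := by
    unfold offMat
    rw [← Finset.add_sum_erase _ _ (Finset.mem_univ i),
      ← Finset.add_sum_erase (f := fun j => (if j = i then 0 else Q i j) • z j) _
        (Finset.mem_univ i)]
    simp only [if_true, zero_smul, zero_add]
    congr 1
    refine Finset.sum_congr rfl fun j hj => ?_
    rw [if_neg (Finset.ne_of_mem_erase hj)]
  rw [dampMat, matL_add_apply, matL_smul_apply, matL_smul_apply, matL_one_apply]
  simp only [PiLp.add_apply, PiLp.smul_apply, matL_apply, mix]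
  rw [h1, h2]
  simp only [smul_add, Finset.sum_add_distrib, smul_smul]
  abel

theorem toLp_dev_mix (hn : 0 < n) {Q : Matrix (Fin n) (Fin n) ℝ}
    (hQ : Q ∈ doublyStochastic ℝ (Fin n)) (γ : ℝ) (z e : Stack n d) :
    (WithLp.toLp 2 (dev (mix Q γ z e)) : StackL2 n d)
      = matL (contrMat Q γ) (WithLp.toLp 2 (dev z))
        + γ • matL (devMat n * offMat Q) (WithLp.toLp 2 e) := by
  rw [← matL_devMat_toLp, ← matL_devMat_toLp, toLp_mix hQ, map_add, map_smul, ← matL_mul_apply,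
    ← matL_mul_apply, ← matL_mul_apply, devMat_mul_dampMat hQ, contrMat_mul_devMat hn hQ]

/-- The node average as a continuous linear map. -/
noncomputable def avgL (n d : ℕ) : StackL2 n d →L[ℝ] Vec d :=
  { toFun := fun z => avg z.ofLp
    map_add' := fun x y => by simp [avg, Finset.sum_add_distrib]
    map_smul' := fun c x => by simp [avg, Finset.smul_sum, smul_comm c]
    cont := by unfold avg; fun_prop }

theorem avgL_apply (z : StackL2 n d) : avgL n d z = avg z.ofLp := rfl

theorem avg_mix {Q : Matrix (Fin n) (Fin n) ℝ}
    (hQ : Q ∈ doublyStochastic ℝ (Fin n)) (γ : ℝ) (z e : Stack n d) :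
    avg (mix Q γ z e) = avg z + γ • avgL n d (matL (offMat Q) (WithLp.toLp 2 e)) := by
  have h : ∀ w : StackL2 n d, avgL n d (matL (dampMat Q γ) w) = avgL n d w := by
    intro w
    simp only [avgL_apply, avg]
    congr 1
    simp only [matL_apply]
    rw [Finset.sum_comm]
    simp only [← Finset.sum_smul, dampMat_col hQ, one_smul]
  have h1 := congrArg (avgL n d) (toLp_mix hQ γ z e)
  rw [map_add, map_smul, h] at h1
  exact h1

/-- Noise sent by node j reaches everyone except j itself, hence the total weight 1 - q_jj; it lies
in [0, 1], so averaging keeps the gain 1/n for uncorrelated noise. -/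
theorem avgL_offMat {Q : Matrix (Fin n) (Fin n) ℝ}
    (hQ : Q ∈ doublyStochastic ℝ (Fin n)) (e : StackL2 n d) :
    avgL n d (matL (offMat Q) e) = (n : ℝ)⁻¹ • ∑ j, (1 - Q j j) • e j := by
  simp only [avgL_apply, avg]
  congr 1
  simp only [matL_apply]
  rw [Finset.sum_comm]
  refine Finset.sum_congr rfl fun j _ => ?_
  rw [← Finset.sum_smul]
  congr 1
  have h1 : ∑ i, (offMat Q i j + if j = i then Q i j else 0) = 1 := by
    rw [← sum_col_of_mem_doublyStochastic hQ j]
    refine Finset.sum_congr rfl fun i _ => ?_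
    unfold offMat
    split_ifs <;> simp
  rw [Finset.sum_add_distrib] at h1
  simp at h1
  linarith

end Mixing

end ICGT

namespace ICGT

/-! ### A linear system driven by the mixing operator and its Lyapunov function -/

section Lyapunov

variable {K : Type*} [NormedAddCommGroup K] [InnerProductSpace ℝ K] {A : K →L[ℝ] K} {δ : ℝ}

/-- One step of the homogeneous system `(a, c, β) ↦ (A a + (1 - A) c - β, A c, A β)`. -/
def sysStep (A : K →L[ℝ] K) (z : K × K × K) : K × K × K :=
  (A z.1 + (z.2.1 - A z.2.1) - z.2.2, A z.2.1, A z.2.2)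

/-- The trajectory of the system with inputs `u` started at `z0`. -/
def sysState (A : K →L[ℝ] K) (u : ℕ → K × K × K) (z0 : K × K × K) : ℕ → K × K × K
  | 0 => z0
  | k + 1 => sysStep A (sysState A u z0 k) + u k

/-- The quadratic Lyapunov function of the system. -/
noncomputable def lyap (δ : ℝ) (z : K × K × K) : ℝ :=
  ‖z.1‖ ^ 2 + 4 * ‖z.2.1‖ ^ 2 + 10 / δ ^ 2 * ‖z.2.2‖ ^ 2

theorem lyap_nonneg (δ : ℝ) (z : K × K × K) : 0 ≤ lyap δ z := by
  unfold lyap; positivity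

theorem norm_fst_sq_le_lyap (δ : ℝ) (z : K × K × K) : ‖z.1‖ ^ 2 ≤ lyap δ z := by
  have h1 : 0 ≤ 4 * ‖z.2.1‖ ^ 2 := by positivity
  have h2 : 0 ≤ 10 / δ ^ 2 * ‖z.2.2‖ ^ 2 := by positivity
  unfold lyap
  linarith

/-- An operator form of convexity with weights A and 1 - A: write the vector as c + A(a - c),
expand, and use A² ≤ A on a - c. The part ‖c‖² - ⟨c, Ac⟩ is small exactly where c decays slowly. -/
theorem norm_mix_sq_le (hA : IsContr A δ) (a c : K) :
    ‖A a + (c - A c)‖ ^ 2 ≤ inner ℝ a (A a) + ‖c‖ ^ 2 - inner ℝ c (A c) := by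
  have h1 := hA.sq_le (a - c)
  have h2 : A a + (c - A c) = A (a - c) + c := by rw [map_sub]; abel
  have h3 := hA.symm a c
  rw [h2, norm_add_sq_real]
  rw [map_sub, inner_sub_left, inner_sub_right, inner_sub_right] at h1
  rw [map_sub, inner_sub_left]
  rw [real_inner_comm c (A a), real_inner_comm c (A c)]
  rw [real_inner_comm c (A a)] at h3
  linarith

/-- The weight 4 lets the decrease of ‖c‖² under A pay for what c feeds into a. The weight 10/δ²
lets the decay of β pay for the factor 1 + 4/δ that Young's inequality with parameter δ/4 puts on
‖β‖². -/
theorem lyap_sysStep_le (hA : IsContr A δ) (h0 : 0 < δ) (h1 : δ ≤ 1) (z : K × K × K) :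
    lyap δ (sysStep A z) ≤ (1 - δ / 2) * lyap δ z := by
  obtain ⟨a, c, b⟩ := z
  simp only [lyap, sysStep]
  have e1 := norm_sub_sq_le_young (t := δ / 4) (by positivity) (A a + (c - A c)) b
  have e2 := norm_mix_sq_le hA a c
  have e3 := hA.le a
  have e4 := hA.le c
  have e5 := hA.sq_le c
  have e6 := (hA.sq_le b).trans (hA.le b)
  have e7 : (1 + δ / 4) * ‖A a + (c - A c)‖ ^ 2
      ≤ (1 + δ / 4) * (inner ℝ a (A a) + ‖c‖ ^ 2 - inner ℝ c (A c)) :=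
    mul_le_mul_of_nonneg_left e2 (by linarith)
  have e8 : (1 + δ / 4) * inner ℝ a (A a) ≤ (1 + δ / 4) * ((1 - δ) * ‖a‖ ^ 2) :=
    mul_le_mul_of_nonneg_left e3 (by linarith)
  have e9 : (1 + δ / 4) * ((1 - δ) * ‖a‖ ^ 2) ≤ (1 - δ / 2) * ‖a‖ ^ 2 := by
    nlinarith [sq_nonneg ‖a‖, mul_nonneg (sq_nonneg δ) (sq_nonneg ‖a‖),
      mul_nonneg h0.le (sq_nonneg ‖a‖)]
  have e10 : (3 - δ / 4) * inner ℝ c (A c) ≤ (3 - δ / 4) * ((1 - δ) * ‖c‖ ^ 2) :=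
    mul_le_mul_of_nonneg_left e4 (by linarith)
  have e11 : (1 + δ / 4) * ‖c‖ ^ 2 + (3 - δ / 4) * ((1 - δ) * ‖c‖ ^ 2)
      ≤ (1 - δ / 2) * (4 * ‖c‖ ^ 2) := by
    have : 0 ≤ (δ - δ ^ 2 / 4) * ‖c‖ ^ 2 := mul_nonneg (by nlinarith) (sq_nonneg _)
    nlinarith
  have e12 : 10 / δ ^ 2 * ‖A b‖ ^ 2 ≤ 10 / δ ^ 2 * ((1 - δ) * ‖b‖ ^ 2) :=
    mul_le_mul_of_nonneg_left e6 (by positivity)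
  have e13 : (1 + 1 / (δ / 4)) * ‖b‖ ^ 2 + 10 / δ ^ 2 * ((1 - δ) * ‖b‖ ^ 2)
      ≤ (1 - δ / 2) * (10 / δ ^ 2 * ‖b‖ ^ 2) := by
    have : (1 - δ / 2) * (10 / δ ^ 2 * ‖b‖ ^ 2)
        - ((1 + 1 / (δ / 4)) * ‖b‖ ^ 2 + 10 / δ ^ 2 * ((1 - δ) * ‖b‖ ^ 2))
        = (1 - δ) / δ * ‖b‖ ^ 2 := by
      field_simp; ring
    have h2 : 0 ≤ (1 - δ) / δ * ‖b‖ ^ 2 :=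
      mul_nonneg (div_nonneg (by linarith) h0.le) (sq_nonneg _)
    linarith
  linarith

theorem lyap_add_le (δ : ℝ) {t : ℝ} (ht : 0 < t) (z w : K × K × K) :
    lyap δ (z + w) ≤ (1 + t) * lyap δ z + (1 + 1 / t) * lyap δ w := by
  have h1 := norm_add_sq_le_young ht z.1 w.1
  have h2 := norm_add_sq_le_young ht z.2.1 w.2.1
  have h3 := mul_le_mul_of_nonneg_left (norm_add_sq_le_young ht z.2.2 w.2.2)
    (by positivity : 0 ≤ 10 / δ ^ 2)
  simp only [lyap, Prod.fst_add, Prod.snd_add]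
  linarith

/-- For inputs with no orthogonality to the state: half of the contraction is given up, and the
input costs a factor 5/δ. -/
theorem lyap_sysStep_add_le (hA : IsContr A δ) (h0 : 0 < δ) (h1 : δ ≤ 1) (z w : K × K × K) :
    lyap δ (sysStep A z + w) ≤ (1 - δ / 4) * lyap δ z + 5 / δ * lyap δ w := by
  have e1 := lyap_add_le δ (t := δ / 4) (by positivity) (sysStep A z) w
  have e2 := mul_le_mul_of_nonneg_left (lyap_sysStep_le hA h0 h1 z)
    (by positivity : 0 ≤ 1 + δ / 4)
  have e3 : (1 + δ / 4) * ((1 - δ / 2) * lyap δ z) ≤ (1 - δ / 4) * lyap δ z := by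
    nlinarith [mul_nonneg (sq_nonneg δ) (lyap_nonneg δ z)]
  have e4 : (1 + 1 / (δ / 4)) * lyap δ w ≤ 5 / δ * lyap δ w := by
    apply mul_le_mul_of_nonneg_right _ (lyap_nonneg δ w)
    rw [← sub_nonneg]
    have : 5 / δ - (1 + 1 / (δ / 4)) = (1 - δ) / δ := by field_simp; ring
    rw [this]
    exact div_nonneg (by linarith) h0.le
  linarith

/-- Decomposition of the consensus error of a gradient-tracking recursion into the response to the
noise `(g, E)` and the response to the gradient differences `(h, m)`. -/
theorem tracking_decomposition {α γ : ℝ} {a b g h m E : ℕ → K}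
    (ha : ∀ k, a (k + 1) = A (a k) - b k + γ • E k)
    (hb : ∀ k, b (k + 1) = A (b k) + (α * γ) • E k
      + α • (g (k + 1) + h (k + 1) + m (k + 1) - (g k + h k + m k))) (k : ℕ) :
    let N := sysState A (fun k => (-(α • g k) + γ • E k, α • g k, (α * γ) • E k)) 0
    let D := sysState A (fun k => (-(α • h k), α • h k, α • (m (k + 1) - m k)))
      (a 0, 0, b 0 - α • (g 0 + h 0))
    a k = (N k).1 + (D k).1 ∧
    b k = α • (g k + h k) + ((N k).2.2 + (D k).2.2)
      - ((N k).2.1 + (D k).2.1 - A ((N k).2.1 + (D k).2.1)) := by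
  intro N D
  -- Summation by parts: the tracker's response to the increments of g + h is α(g + h) minus (1 - A)
  -- applied to the geometric sum c of past values. The increments of m are left in the third state.
  induction k with
  | zero => simp [N, D, sysState]
  | succ k ih =>
    obtain ⟨h1, h2⟩ := ih
    have hN : N (k + 1) = sysStep A (N k) + (-(α • g k) + γ • E k, α • g k, (α * γ) • E k) := rfl
    have hD : D (k + 1) = sysStep A (D k) + (-(α • h k), α • h k, α • (m (k + 1) - m k)) := rfl
    rw [ha, hb, hN, hD, h1, h2]
    constructor
    · simp only [sysStep, Prod.fst_add, map_add, smul_add]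
      abel
    · simp only [sysStep, Prod.fst_add, Prod.snd_add, map_add, map_sub, map_smul, smul_add,
        smul_sub]
      abel

end Lyapunov

/-! ### Combination of the descent and the consensus inequalities -/

-- A small-gain argument. The weight 16η/n turns the decay δ/4 of V into 4ηδ/n, which exceeds the
-- 2.2ηδ/n needed for the disagreement in the other inequalities. The weight 4800η³ is twice the
-- 2400η³ that the lag contributes through V. Everything else carries extra powers of η and
-- disappears in the slack; negative multiples of the gap G absorb its feedback.
set_option maxHeartbeats 800000 in
theorem combined_step {α L δ η μ γ n e G a2 V Nn ρ2 ρd ρn S2 e' V' ρd' : ℝ}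
    (hα : 0 < α) (hL : 0 < L) (hδ : 0 < δ) (hδ1 : δ ≤ 1) (hμ : 0 < μ) (hμL : μ ≤ L) (hn : 1 ≤ n)
    (hη : α * L = η * δ) (hη1 : η ≤ 1 / 300000)
    (hG : 0 ≤ G) (hV : 0 ≤ V) (hNn : 0 ≤ Nn) (hρd : 0 ≤ ρd) (hρn : 0 ≤ ρn)
    (hS2 : 0 ≤ S2)
    (ha : a2 ≤ 2 * V + 2 * Nn) (hρ : ρ2 ≤ 2 * ρd + 2 * ρn)
    (h1 : e' ≤ (1 - α * μ / 4) * e - (2 * α - 8 * α ^ 2 * L) * G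
      + α * L / n * (1 + 4 * α * L) * a2 + (4 * α * γ ^ 2 / (3 * μ) + 2 * α ^ 2 * γ ^ 2) * S2)
    (h2 : V' ≤ (1 - δ / 4) * V + δ * η ^ 2 * (25 * a2 + 75 * (n * ρ2)))
    (h3 : ρd' ≤ (1 - δ) * ρd + 2 * α ^ 2 / δ * (2 * L ^ 2 / n * a2 + 4 * L * G + γ ^ 2 * S2)) :
    e' + 16 * η / n * V' + 4800 * η ^ 3 * ρd'
      ≤ (1 - α * μ / 4) * (e + 16 * η / n * V + 4800 * η ^ 3 * ρd)
        + 3 * (α * L) / n * Nn + α * L * ρn + 2 * α * γ ^ 2 / μ * S2 := by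
  have hn0 : 0 < n := by linarith
  have hη0 : 0 < η := by
    by_contra hc
    push Not at hc
    nlinarith [mul_pos hα hL]
  have hαμ : α * μ ≤ η * δ := by rw [← hη]; gcongr
  have hη2 : η ^ 2 ≤ 1 / 300000 * η := by nlinarith
  have hη3 : η ^ 3 ≤ 1 / 300000 * η ^ 2 := by nlinarith [sq_nonneg η]
  have hη4 : η ^ 4 ≤ 1 / 300000 * η ^ 3 := by nlinarith [pow_pos hη0 3]
  have hηδ : η * δ ≤ η := by nlinarith
  have s1 : η * δ ≤ 1 / 300000 := hηδ.trans hη1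
  have s2 : η ^ 2 ≤ 1 / 300000 := by linarith
  have s3 : η ^ 3 ≤ 1 / 300000 := by linarith
  have s4 : η ^ 4 ≤ 1 / 300000 := by linarith
  have k2 := mul_le_mul_of_nonneg_left h2 (by positivity : 0 ≤ 16 * η / n)
  have k3 := mul_le_mul_of_nonneg_left h3 (by positivity : 0 ≤ 4800 * η ^ 3)
  -- Eliminating L expresses all coefficients in η, δ and α, so that they can be compared term by
  -- term.
  have hLe : L = η * δ / α := by field_simp; linarith
  have e2 : 16 * η / n * ((1 - δ / 4) * V + δ * η ^ 2 * (25 * a2 + 75 * (n * ρ2)))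
      = 16 * η / n * V - 4 * (η * δ / n) * V + 400 * η ^ 2 * (η * δ / n) * a2
        + 1200 * δ * η ^ 3 * ρ2 := by field_simp; ring
  have e3 : 4800 * η ^ 3 * ((1 - δ) * ρd
        + 2 * α ^ 2 / δ * (2 * L ^ 2 / n * a2 + 4 * L * G + γ ^ 2 * S2))
      = 4800 * η ^ 3 * ρd - 4800 * η ^ 3 * δ * ρd + 19200 * η ^ 4 * (η * δ / n) * a2
        + 38400 * η ^ 4 * α * G + 9600 * η ^ 3 * α ^ 2 * γ ^ 2 / δ * S2 := by
    rw [hLe]; field_simp; ring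
  have e1 : α * L / n * (1 + 4 * α * L) * a2 = (1 + 4 * (η * δ)) * (η * δ / n) * a2 := by
    rw [hLe]; field_simp
  rw [e2] at k2
  rw [e3] at k3
  rw [e1] at h1
  have hu : 0 < η * δ / n := by positivity
  have ca : (1 + 4 * (η * δ)) * (η * δ / n) * a2 + 400 * η ^ 2 * (η * δ / n) * a2
      + 19200 * η ^ 4 * (η * δ / n) * a2 ≤ 11 / 10 * (η * δ / n) * (2 * V + 2 * Nn) := by
    have c1 : 1 + 4 * (η * δ) + 400 * η ^ 2 + 19200 * η ^ 4 ≤ 11 / 10 := by linarith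
    have c2 : 0 ≤ 1 + 4 * (η * δ) + 400 * η ^ 2 + 19200 * η ^ 4 := by positivity
    calc _ = (η * δ / n) * ((1 + 4 * (η * δ) + 400 * η ^ 2 + 19200 * η ^ 4) * a2) := by ring
      _ ≤ (η * δ / n) * ((1 + 4 * (η * δ) + 400 * η ^ 2 + 19200 * η ^ 4) * (2 * V + 2 * Nn)) := by
        gcongr
      _ ≤ (η * δ / n) * (11 / 10 * (2 * V + 2 * Nn)) := by gcongr
      _ = _ := by ring
  have cG : (38400 * η ^ 4 * α - (2 * α - 8 * α ^ 2 * L)) * G ≤ 0 := by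
    have : 38400 * η ^ 4 * α - (2 * α - 8 * α ^ 2 * L)
        = α * (38400 * η ^ 4 - 2 + 8 * (η * δ)) := by rw [hLe]; field_simp; ring
    rw [this]
    have c : 38400 * η ^ 4 - 2 + 8 * (η * δ) ≤ 0 := by linarith
    exact mul_nonpos_of_nonpos_of_nonneg (mul_nonpos_of_nonneg_of_nonpos hα.le c) hG
  have cS : (4 * α * γ ^ 2 / (3 * μ) + 2 * α ^ 2 * γ ^ 2 + 9600 * η ^ 3 * α ^ 2 * γ ^ 2 / δ) * S2
      ≤ 2 * α * γ ^ 2 / μ * S2 := by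
    apply mul_le_mul_of_nonneg_right _ hS2
    have c1 : 4 * α * γ ^ 2 / (3 * μ) + 2 * α ^ 2 * γ ^ 2 + 9600 * η ^ 3 * α ^ 2 * γ ^ 2 / δ
        = α * γ ^ 2 / μ * (4 / 3 + 2 * (α * μ) + 9600 * η ^ 3 * ((α * μ) / δ)) := by
      field_simp
    have c2 : 2 * α * γ ^ 2 / μ = α * γ ^ 2 / μ * 2 := by ring
    rw [c1, c2]
    apply mul_le_mul_of_nonneg_left _ (by positivity)
    have c3 : α * μ / δ ≤ η := by rw [div_le_iff₀ hδ]; exact hαμ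
    have c4 : 9600 * η ^ 3 * ((α * μ) / δ) ≤ 9600 * η ^ 3 * η := by gcongr
    have c5 : 9600 * η ^ 3 * η = 9600 * η ^ 4 := by ring
    linarith
  have cV : (η * δ / n) * (22 / 10) * V + α * μ / 4 * (16 * η / n * V) ≤ 4 * (η * δ / n) * V := by
    have : α * μ / 4 * (16 * η / n * V) = α * μ * (4 * η / n * V) := by ring
    rw [this]
    have c1 : α * μ * (4 * η / n * V) ≤ η * δ * (4 * η / n * V) := by gcongr
    have c2 : η * δ * (4 * η / n * V) = (η * δ / n) * V * (4 * η) := by ring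
    have c3 : 0 ≤ (η * δ / n) * V := by positivity
    have c4 : (η * δ / n) * V * (4 * η) ≤ (η * δ / n) * V * 1 := by
      gcongr; linarith
    linarith
  have cρ : 1200 * δ * η ^ 3 * ρ2 ≤ 2400 * δ * η ^ 3 * ρd + η * δ * ρn := by
    have c1 : 1200 * δ * η ^ 3 * ρ2 ≤ 1200 * δ * η ^ 3 * (2 * ρd + 2 * ρn) := by gcongr
    have c2 : 2400 * η ^ 3 * (δ * ρn) ≤ η * (δ * ρn) := by
      apply mul_le_mul_of_nonneg_right _ (by positivity)
      linarith
    linarith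
  have cρd : α * μ / 4 * (4800 * η ^ 3 * ρd) ≤ 2400 * δ * η ^ 3 * ρd := by
    have c1 : α * μ * (1200 * η ^ 3 * ρd) ≤ η * δ * (1200 * η ^ 3 * ρd) := by gcongr
    have c2 : η * δ * (1200 * η ^ 3 * ρd) ≤ 1 * δ * (1200 * η ^ 3 * ρd) := by
      gcongr; linarith
    have c3 : 0 ≤ δ * η ^ 3 * ρd := by positivity
    linarith
  have cN : 11 / 10 * (η * δ / n) * (2 * Nn) ≤ 3 * (η * δ) / n * Nn := by
    have : 0 ≤ (η * δ / n) * Nn := by positivity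
    have e : 3 * (η * δ) / n * Nn = 3 * ((η * δ / n) * Nn) := by ring
    rw [e]; linarith
  rw [hη]
  linarith

end ICGT

namespace ICGT

/-! ### The algorithm along one realisation -/

section Path

variable {n d : ℕ}

/-- `x`, `y` follow the recursion of IC-GT with gradient noise `g` and communication noise `e`. -/
structure IsPath (Q : Matrix (Fin n) (Fin n) ℝ) (α γ : ℝ) (f : Fin n → Vec d → ℝ)
    (x y g e : ℕ → Stack n d) : Prop where
  x_succ : ∀ k, x (k + 1) = mix Q γ (x k) (e k) - α • y k
  y_zero : y 0 = grads f (x 0) + g 0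
  y_succ : ∀ k, y (k + 1) = mix Q γ (y k) (e k) + (grads f (x (k + 1)) + g (k + 1))
    - (grads f (x k) + g k)

/-- The node average of the communication noise that enters one mixing step. -/
noncomputable def commMean (Q : Matrix (Fin n) (Fin n) ℝ) (e : StackL2 n d) : Vec d :=
  avgL n d (matL (offMat Q) e)

/-- The solution of `ρ_{k+1} = (1 - δ) ρ_k + v_k` with `ρ_0 = 0`. -/
noncomputable def relaxSum (δ : ℝ) (v : ℕ → Vec d) : ℕ → Vec d
  | 0 => 0
  | k + 1 => (1 - δ) • relaxSum δ v k + v k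

/-- The input of the noise to the consensus error system. -/
noncomputable def noiseInput (Q : Matrix (Fin n) (Fin n) ℝ) (α γ : ℝ) (g e : StackL2 n d) :
    StackL2 n d × StackL2 n d × StackL2 n d :=
  (-(α • matL (devMat n) g) + γ • matL (devMat n * offMat Q) e, α • matL (devMat n) g,
    (α * γ) • matL (devMat n * offMat Q) e)

/-- The response of the consensus error system to the noise. -/
noncomputable def noiseState (Q : Matrix (Fin n) (Fin n) ℝ) (α γ : ℝ) (g e : ℕ → Stack n d) :
    ℕ → StackL2 n d × StackL2 n d × StackL2 n d :=
  sysState (matL (contrMat Q γ))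
    (fun k => noiseInput Q α γ (WithLp.toLp 2 (g k)) (WithLp.toLp 2 (e k))) 0

/-- The noise entering one step of the node average. -/
noncomputable def meanNoise (Q : Matrix (Fin n) (Fin n) ℝ) (α γ : ℝ) (g e : StackL2 n d) : Vec d :=
  γ • commMean Q e - α • avgL n d g

/-- The noise part of the distance of the node average to its running mean. -/
noncomputable def noiseLag (Q : Matrix (Fin n) (Fin n) ℝ) (α γ δ : ℝ) (g e : ℕ → Stack n d) :
    ℕ → Vec d :=
  relaxSum δ fun k => meanNoise Q α γ (WithLp.toLp 2 (g k)) (WithLp.toLp 2 (e k))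

/-- The accumulated communication noise in the mean gradient tracker. -/
noncomputable def commSum (Q : Matrix (Fin n) (Fin n) ℝ) (e : ℕ → Stack n d) (k : ℕ) : Vec d :=
  ∑ j ∈ Finset.range k, commMean Q (WithLp.toLp 2 (e j))

/-- The drift part of the distance of the node average to its running mean. -/
noncomputable def driftLag (Q : Matrix (Fin n) (Fin n) ℝ) (α γ δ : ℝ) (f : Fin n → Vec d → ℝ)
    (x e : ℕ → Stack n d) : ℕ → Vec d :=
  relaxSum δ fun k => -(α • (avg (grads f (x k)) + γ • commSum Q e k))

/-- The running mean of the node averages. -/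
noncomputable def runMean (Q : Matrix (Fin n) (Fin n) ℝ) (α γ δ : ℝ) (f : Fin n → Vec d → ℝ)
    (x g e : ℕ → Stack n d) (k : ℕ) : Vec d :=
  avg (x k) - (noiseLag Q α γ δ g e k + driftLag Q α γ δ f x e k)

/-- The stacked local gradients at a consensual point. -/
noncomputable def meanGrads (f : Fin n → Vec d → ℝ) (r : Vec d) : StackL2 n d :=
  matL (devMat n) (WithLp.toLp 2 (grads f fun _ => r))

/-- The disagreement of the gradient differences with respect to a consensual point. -/
noncomputable def diffGrads (f : Fin n → Vec d → ℝ) (x : Stack n d) (r : Vec d) : StackL2 n d :=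
  matL (devMat n) (WithLp.toLp 2 (grads f x - grads f fun _ => r))

/-- The response of the consensus error system to the gradient differences. -/
noncomputable def driftState (Q : Matrix (Fin n) (Fin n) ℝ) (α γ δ : ℝ) (f : Fin n → Vec d → ℝ)
    (x y g e : ℕ → Stack n d) : ℕ → StackL2 n d × StackL2 n d × StackL2 n d :=
  sysState (matL (contrMat Q γ))
    (fun k => (-(α • diffGrads f (x k) (runMean Q α γ δ f x g e k)),
      α • diffGrads f (x k) (runMean Q α γ δ f x g e k),
      α • (meanGrads f (runMean Q α γ δ f x g e (k + 1))
        - meanGrads f (runMean Q α γ δ f x g e k))))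
    (WithLp.toLp 2 (dev (x 0)), 0, α • WithLp.toLp 2 (dev (y 0))
      - α • (matL (devMat n) (WithLp.toLp 2 (g 0))
        + diffGrads f (x 0) (runMean Q α γ δ f x g e 0)))

variable {hn : 2 ≤ n} {Q : Matrix (Fin n) (Fin n) ℝ} {α γ δ L μ : ℝ} {f : Fin n → Vec d → ℝ}
  {x y g e : ℕ → Stack n d} {xs : Vec d}

theorem avg_add (z w : Stack n d) : avg (z + w) = avg z + avg w := by
  simp [avg, Finset.sum_add_distrib]

theorem avg_smul (c : ℝ) (z : Stack n d) : avg (c • z) = c • avg z := by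
  simp [avg, ← Finset.smul_sum, smul_comm c]

theorem commSum_succ (k : ℕ) :
    commSum Q e (k + 1) = commSum Q e k + commMean Q (WithLp.toLp 2 (e k)) :=
  Finset.sum_range_succ _ _

/-- The gradient samples telescope as in exact tracking, but the communication noise entering y
never leaves the average. -/
theorem IsPath.avg_y (h : IsPath Q α γ f x y g e) (hQ : Q ∈ doublyStochastic ℝ (Fin n)) (k : ℕ) :
    avg (y k) = avg (grads f (x k)) + avg (g k) + γ • commSum Q e k := by
  induction k with
  | zero => rw [h.y_zero, avg_add]; simp [commSum]
  | succ k ih =>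
    rw [h.y_succ, avg_sub, avg_add, avg_add, avg_add, avg_mix hQ, ih, commSum_succ, smul_add]
    change _ + γ • commMean Q (WithLp.toLp 2 (e k)) + _ - _ = _
    abel

/-- This separates what is known before round k from the fresh noise `meanNoise`. -/
theorem IsPath.avg_x_succ (h : IsPath Q α γ f x y g e) (hQ : Q ∈ doublyStochastic ℝ (Fin n))
    (k : ℕ) : avg (x (k + 1)) = avg (x k) - α • (avg (grads f (x k)) + γ • commSum Q e k)
      + meanNoise Q α γ (WithLp.toLp 2 (g k)) (WithLp.toLp 2 (e k)) := by
  rw [h.x_succ, avg_sub, avg_smul, avg_mix hQ, h.avg_y hQ, meanNoise]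
  have h1 : avgL n d (WithLp.toLp 2 (g k)) = avg (g k) := rfl
  rw [h1]
  change _ + γ • commMean Q (WithLp.toLp 2 (e k)) - _ = _
  simp only [smul_add]
  abel

/-- Both lags relax with factor 1 - δ and their inputs add up to the increment of the node average,
so fresh noise cancels from the increment of the running mean. -/
theorem IsPath.runMean_succ_sub (h : IsPath Q α γ f x y g e)
    (hQ : Q ∈ doublyStochastic ℝ (Fin n)) (k : ℕ) :
    runMean Q α γ δ f x g e (k + 1) - runMean Q α γ δ f x g e k
      = δ • (noiseLag Q α γ δ g e k + driftLag Q α γ δ f x e k) := by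
  have h1 : noiseLag Q α γ δ g e (k + 1) = (1 - δ) • noiseLag Q α γ δ g e k
      + meanNoise Q α γ (WithLp.toLp 2 (g k)) (WithLp.toLp 2 (e k)) := rfl
  have h2 : driftLag Q α γ δ f x e (k + 1) = (1 - δ) • driftLag Q α γ δ f x e k
      + -(α • (avg (grads f (x k)) + γ • commSum Q e k)) := rfl
  rw [runMean, runMean, h.avg_x_succ hQ, h1, h2, sub_smul, sub_smul, one_smul, one_smul]
  simp only [smul_add]
  abel

theorem IsPath.dev_decomposition (h : IsPath Q α γ f x y g e) (hn0 : 0 < n)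
    (hQ : Q ∈ doublyStochastic ℝ (Fin n)) (δ : ℝ) (k : ℕ) :
    (WithLp.toLp 2 (dev (x k)) : StackL2 n d)
      = (noiseState Q α γ g e k).1 + (driftState Q α γ δ f x y g e k).1 := by
  refine (tracking_decomposition (A := matL (contrMat Q γ)) (α := α) (γ := γ)
    (a := fun k => WithLp.toLp 2 (dev (x k))) (b := fun k => α • WithLp.toLp 2 (dev (y k)))
    (g := fun k => matL (devMat n) (WithLp.toLp 2 (g k)))
    (h := fun k => diffGrads f (x k) (runMean Q α γ δ f x g e k))
    (m := fun k => meanGrads f (runMean Q α γ δ f x g e k))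
    (E := fun k => matL (devMat n * offMat Q) (WithLp.toLp 2 (e k))) ?_ ?_ k).1
  · intro k
    have h1 : (WithLp.toLp 2 (dev (x (k + 1))) : StackL2 n d)
        = WithLp.toLp 2 (dev (mix Q γ (x k) (e k))) - α • WithLp.toLp 2 (dev (y k)) := by
      rw [← matL_devMat_toLp, ← matL_devMat_toLp, ← matL_devMat_toLp, h.x_succ, WithLp.toLp_sub,
        WithLp.toLp_smul, map_sub, map_smul]
    rw [h1, toLp_dev_mix hn0 hQ]
    abel
  · intro k
    have h1 : (WithLp.toLp 2 (dev (y (k + 1))) : StackL2 n d)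
        = WithLp.toLp 2 (dev (mix Q γ (y k) (e k)))
          + matL (devMat n) (WithLp.toLp 2 (grads f (x (k + 1)) + g (k + 1)))
          - matL (devMat n) (WithLp.toLp 2 (grads f (x k) + g k)) := by
      rw [← matL_devMat_toLp, ← matL_devMat_toLp, h.y_succ, WithLp.toLp_sub,
        WithLp.toLp_add, map_sub, map_add]
    -- The gradient sample splits into noise, difference to the gradients at the running mean, and
    -- the gradients at the running mean.
    have h2 : ∀ k, matL (devMat n) (WithLp.toLp 2 (grads f (x k) + g k))
        = matL (devMat n) (WithLp.toLp 2 (g k)) + diffGrads f (x k) (runMean Q α γ δ f x g e k)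
          + meanGrads f (runMean Q α γ δ f x g e k) := by
      intro k
      rw [diffGrads, meanGrads, WithLp.toLp_sub, map_sub, WithLp.toLp_add, map_add]
      abel
    rw [h1, toLp_dev_mix hn0 hQ, h2, h2, map_smul]
    simp only [smul_add, smul_sub, smul_smul]
    abel

theorem norm_diffGrads_sq_le (hn0 : 0 < n) (hf : IsRegular f L μ) (x : Stack n d) (r : Vec d) :
    ‖diffGrads f x r‖ ^ 2 ≤ L ^ 2 * (sqNorm (dev x) + n * ‖avg x - r‖ ^ 2) := by
  refine (norm_matL_devMat_le hn0 _).trans ?_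
  rw [norm_toLp_sq, ← sum_norm_sub_sq hn0]
  exact sqNorm_grads_sub_le hf _ _

theorem norm_meanGrads_sub_sq_le (hn0 : 0 < n) (hf : IsRegular f L μ) (r r' : Vec d) :
    ‖meanGrads f r' - meanGrads f r‖ ^ 2 ≤ L ^ 2 * (n * ‖r' - r‖ ^ 2) := by
  rw [meanGrads, meanGrads, ← map_sub, ← WithLp.toLp_sub]
  refine (norm_matL_devMat_le hn0 _).trans ?_
  rw [norm_toLp_sq]
  refine (sqNorm_grads_sub_le hf _ _).trans (le_of_eq ?_)
  simp

/-- The potential: squared distance to the optimum plus weighted drift energies. -/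
noncomputable def potential (Q : Matrix (Fin n) (Fin n) ℝ) (α γ δ η : ℝ) (f : Fin n → Vec d → ℝ)
    (x y g e : ℕ → Stack n d) (k : ℕ) : ℝ :=
  16 * η / n * lyap δ (driftState Q α γ δ f x y g e k)
    + 4800 * η ^ 3 * ‖driftLag Q α γ δ f x e k‖ ^ 2

theorem IsPath.potential_step (h : IsPath Q α γ f x y g e) (hQ : IsMixing hn Q)
    (hf : IsRegular f L μ) (hxs : IsOptimal f xs) (hL : 0 < L) (hμ : 0 < μ) (hμL : μ ≤ L)
    (hα : 0 < α) (hγ : 0 < γ) (hγ1 : γ < 1 / 4) (hδ : δ = γ * (1 - lam2 hQ)) {η : ℝ}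
    (hη : α * L = η * δ) (hη1 : η ≤ 1 / 300000) (k : ℕ) :
    ‖avg (x k) - xs - α • (avg (grads f (x k)) + γ • commSum Q e k)‖ ^ 2
        + potential Q α γ δ η f x y g e (k + 1)
      ≤ (1 - α * μ / 4) * (‖avg (x k) - xs‖ ^ 2 + potential Q α γ δ η f x y g e k)
        + 3 * (α * L) / n * lyap δ (noiseState Q α γ g e k)
        + α * L * ‖noiseLag Q α γ δ g e k‖ ^ 2
        + 2 * α * γ ^ 2 / μ * ‖commSum Q e k‖ ^ 2 := by
  have hn0 : 0 < n := by omega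
  have hn1 : (1 : ℝ) ≤ n := by exact_mod_cast hn0
  have hl1 : lam2 hQ < 1 := hQ.eig_second
  have hl2 : -1 < lam2 hQ := hQ.eig_all _
  have hδ0 : 0 < δ := by rw [hδ]; exact mul_pos hγ (by linarith)
  have hδ1 : δ ≤ 1 := by rw [hδ]; nlinarith
  have hA : IsContr (matL (d := d) (contrMat Q γ)) δ := hδ ▸ isContr_contrMat hQ hγ hγ1
  set r := runMean Q α γ δ f x g e with hr
  set ρn := noiseLag Q α γ δ g e k with hρn
  set ρd := driftLag Q α γ δ f x e k with hρd
  set N := noiseState Q α γ g e k with hN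
  set D := driftState Q α γ δ f x y g e with hD
  set S := commSum Q e k with hS
  have hlag : avg (x k) - r k = ρn + ρd := by rw [hr, runMean]; abel
  have ha : sqNorm (dev (x k)) ≤ 2 * lyap δ (D k) + 2 * lyap δ N := by
    rw [← norm_toLp_sq, h.dev_decomposition hn0 hQ.stoch δ k]
    have h1 := norm_add_sq_le_two N.1 (D k).1
    have h2 := norm_fst_sq_le_lyap δ N
    have h3 := norm_fst_sq_le_lyap δ (D k)
    linarith
  have hρ : ‖ρn + ρd‖ ^ 2 ≤ 2 * ‖ρd‖ ^ 2 + 2 * ‖ρn‖ ^ 2 := by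
    have := norm_add_sq_le_two ρn ρd
    linarith
  have h1 := norm_step_sq_le (γ := γ) hn0 hL hμ hf hxs hα (x k) S
  have h2 : lyap δ (D (k + 1)) ≤ (1 - δ / 4) * lyap δ (D k)
      + δ * η ^ 2 * (25 * sqNorm (dev (x k)) + 75 * (n * ‖ρn + ρd‖ ^ 2)) := by
    have e1 : D (k + 1) = sysStep (matL (contrMat Q γ)) (D k)
      + (-(α • diffGrads f (x k) (r k)), α • diffGrads f (x k) (r k),
        α • (meanGrads f (r (k + 1)) - meanGrads f (r k))) := rfl
    rw [e1]
    refine (lyap_sysStep_add_le hA hδ0 hδ1 _ _).trans ?_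
    refine add_le_add le_rfl ?_
    have e2 := norm_diffGrads_sq_le hn0 hf (x k) (r k)
    have e3 := norm_meanGrads_sub_sq_le hn0 hf (r k) (r (k + 1))
    rw [h.runMean_succ_sub hQ.stoch, norm_smul, mul_pow, Real.norm_eq_abs, sq_abs] at e3
    rw [hlag] at e2
    simp only [lyap, norm_neg, norm_smul, mul_pow, Real.norm_eq_abs, sq_abs]
    calc 5 / δ * (α ^ 2 * ‖diffGrads f (x k) (r k)‖ ^ 2
          + 4 * (α ^ 2 * ‖diffGrads f (x k) (r k)‖ ^ 2)
          + 10 / δ ^ 2 * (α ^ 2 * ‖meanGrads f (r (k + 1)) - meanGrads f (r k)‖ ^ 2))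
        ≤ 5 / δ * (α ^ 2 * (L ^ 2 * (sqNorm (dev (x k)) + n * ‖ρn + ρd‖ ^ 2))
          + 4 * (α ^ 2 * (L ^ 2 * (sqNorm (dev (x k)) + n * ‖ρn + ρd‖ ^ 2)))
          + 10 / δ ^ 2 * (α ^ 2 * (L ^ 2 * (n * (δ ^ 2 * ‖ρn + ρd‖ ^ 2))))) := by gcongr
      -- The δ² from the increment of the running mean cancels the weight 10/δ², leaving 25 + 50 =
      -- 75 in front of the lag.
      _ = (α * L) ^ 2 / δ * (25 * sqNorm (dev (x k)) + 75 * (n * ‖ρn + ρd‖ ^ 2)) := by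
        field_simp; ring
      _ = _ := by rw [hη]; field_simp
  have h3 : ‖driftLag Q α γ δ f x e (k + 1)‖ ^ 2 ≤ (1 - δ) * ‖ρd‖ ^ 2
      + 2 * α ^ 2 / δ * (2 * L ^ 2 / n * sqNorm (dev (x k)) + 4 * L * gap f xs (avg (x k))
        + γ ^ 2 * ‖S‖ ^ 2) := by
    have e1 : driftLag Q α γ δ f x e (k + 1)
        = (1 - δ) • ρd - α • (avg (grads f (x k)) + γ • S) := by
      rw [sub_eq_add_neg]; rfl
    rw [e1]
    refine (norm_sub_sq_le_convex hδ0 hδ1 _ _).trans ?_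
    refine add_le_add le_rfl ?_
    have e2 := norm_add_sq_le_two (avg (grads f (x k))) (γ • S)
    have e3 := norm_avg_grads_sq_le hn0 hL hf hxs (x k)
    rw [norm_smul γ, mul_pow, Real.norm_eq_abs, sq_abs] at e2
    rw [norm_smul, mul_pow, Real.norm_eq_abs, sq_abs]
    calc 1 / δ * (α ^ 2 * ‖avg (grads f (x k)) + γ • S‖ ^ 2)
        ≤ 1 / δ * (α ^ 2 * (2 * (2 * L ^ 2 / n * sqNorm (dev (x k))
          + 4 * L * gap f xs (avg (x k))) + 2 * (γ ^ 2 * ‖S‖ ^ 2))) := by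
          gcongr; linarith
      _ = _ := by ring
  have := combined_step hα hL hδ0 hδ1 hμ hμL hn1 hη hη1 (gap_nonneg hxs (avg (x k)))
    (lyap_nonneg δ (D k)) (lyap_nonneg δ N) (sq_nonneg ‖ρd‖) (sq_nonneg ‖ρn‖) (sq_nonneg ‖S‖)
    ha hρ h1 h2 h3
  simp only [potential]
  linarith

end Path

end ICGT

namespace ICGT

/-! ### Square-integrable martingale differences -/

section Orthogonality

variable {Ω : Type u} {mΩ : MeasurableSpace Ω} {P : Measure Ω}
  {K K' : Type*} [NormedAddCommGroup K] [InnerProductSpace ℝ K]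
  [NormedAddCommGroup K'] [InnerProductSpace ℝ K']

theorem integrable_inner_of_memLp {p q : Ω → K} (hp : MemLp p 2 P) (hq : MemLp q 2 P) :
    Integrable (fun ω => inner ℝ (p ω) (q ω)) P := by
  have h1 : Integrable (fun ω => ‖p ω‖ ^ 2 + ‖q ω‖ ^ 2) P :=
    (hp.integrable_norm_pow two_ne_zero).add (hq.integrable_norm_pow two_ne_zero)
  refine h1.mono' (hp.1.inner hq.1) (Filter.Eventually.of_forall fun ω => ?_)
  have := abs_real_inner_le_norm (p ω) (q ω)
  rw [Real.norm_eq_abs]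
  nlinarith [sq_nonneg (‖p ω‖ - ‖q ω‖), sq_nonneg (‖p ω‖), sq_nonneg (‖q ω‖)]

/-- Square-integrable and measurable with respect to `m`. -/
structure IsAdapted (P : Measure Ω) (m : MeasurableSpace Ω) (p : Ω → K) : Prop where
  meas : StronglyMeasurable[m] p
  memLp : MemLp p 2 P

/-- Square-integrable and orthogonal to the square-integrable `m`-measurable variables. -/
structure IsOrtho (P : Measure Ω) (m : MeasurableSpace Ω) (ζ : Ω → K) : Prop where
  memLp : MemLp ζ 2 P
  ortho : ∀ p : Ω → K, IsAdapted P m p → ∫ ω, inner ℝ (p ω) (ζ ω) ∂P = 0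

variable {m : MeasurableSpace Ω}

theorem IsAdapted.clm {p : Ω → K} (h : IsAdapted P m p) (T : K →L[ℝ] K') :
    IsAdapted P m fun ω => T (p ω) :=
  ⟨T.continuous.comp_stronglyMeasurable h.meas, T.comp_memLp' h.memLp⟩

theorem IsAdapted.add {p q : Ω → K} (hp : IsAdapted P m p) (hq : IsAdapted P m q) :
    IsAdapted P m fun ω => p ω + q ω :=
  ⟨hp.meas.add hq.meas, hp.memLp.add hq.memLp⟩

theorem IsAdapted.sub {p q : Ω → K} (hp : IsAdapted P m p) (hq : IsAdapted P m q) :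
    IsAdapted P m fun ω => p ω - q ω :=
  ⟨hp.meas.sub hq.meas, hp.memLp.sub hq.memLp⟩

theorem IsAdapted.const_smul {p : Ω → K} (hp : IsAdapted P m p) (c : ℝ) :
    IsAdapted P m fun ω => c • p ω :=
  ⟨hp.meas.const_smul c, hp.memLp.const_smul c⟩

theorem IsAdapted.zero : IsAdapted P m fun _ => (0 : K) :=
  ⟨stronglyMeasurable_const, MemLp.zero⟩

theorem IsAdapted.mono {m' : MeasurableSpace Ω} {p : Ω → K} (hp : IsAdapted P m p) (h : m ≤ m') :
    IsAdapted P m' p :=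
  ⟨hp.meas.mono h, hp.memLp⟩

/-- The adjoint moves the operator to the adapted test variable. -/
theorem IsOrtho.clm [CompleteSpace K] [CompleteSpace K'] {ζ : Ω → K} (h : IsOrtho P m ζ)
    (T : K →L[ℝ] K') : IsOrtho P m fun ω => T (ζ ω) := by
  refine ⟨T.comp_memLp' h.memLp, fun p hp => ?_⟩
  rw [← h.ortho _ (hp.clm (ContinuousLinearMap.adjoint T))]
  congr 1
  ext ω
  rw [ContinuousLinearMap.adjoint_inner_left]

theorem IsOrtho.const_smul {ζ : Ω → K} (h : IsOrtho P m ζ) (c : ℝ) :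
    IsOrtho P m fun ω => c • ζ ω := by
  refine ⟨h.memLp.const_smul c, fun p hp => ?_⟩
  simp only [real_inner_smul_right]
  rw [integral_const_mul, h.ortho p hp, mul_zero]

theorem IsOrtho.add {ζ ζ' : Ω → K} (h : IsOrtho P m ζ) (h' : IsOrtho P m ζ') :
    IsOrtho P m fun ω => ζ ω + ζ' ω := by
  refine ⟨h.memLp.add h'.memLp, fun p hp => ?_⟩
  simp only [inner_add_right]
  rw [integral_add (integrable_inner_of_memLp hp.memLp h.memLp)
    (integrable_inner_of_memLp hp.memLp h'.memLp), h.ortho p hp, h'.ortho p hp, add_zero]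

theorem IsOrtho.neg {ζ : Ω → K} (h : IsOrtho P m ζ) : IsOrtho P m fun ω => -ζ ω := by
  simpa using h.const_smul (-1)

theorem IsOrtho.sub {ζ ζ' : Ω → K} (h : IsOrtho P m ζ) (h' : IsOrtho P m ζ') :
    IsOrtho P m fun ω => ζ ω - ζ' ω := by
  simpa [sub_eq_add_neg] using h.add h'.neg

theorem IsOrtho.integral_norm_add_sq {p ζ : Ω → K} (h : IsOrtho P m ζ) (hp : IsAdapted P m p) :
    ∫ ω, ‖p ω + ζ ω‖ ^ 2 ∂P = ∫ ω, ‖p ω‖ ^ 2 ∂P + ∫ ω, ‖ζ ω‖ ^ 2 ∂P := by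
  have h1 := hp.memLp.integrable_norm_pow two_ne_zero
  have h2 := h.memLp.integrable_norm_pow two_ne_zero
  have h3 := (integrable_inner_of_memLp hp.memLp h.memLp).const_mul 2
  have h4 : Integrable (fun ω => ‖p ω‖ ^ 2 + 2 * inner ℝ (p ω) (ζ ω)) P := h1.add h3
  simp only [norm_add_sq_real]
  rw [integral_add h4 h2, integral_add h1 h3, integral_const_mul, h.ortho p hp]
  simp

/-- An adapted factor can be pulled out of the conditional expectation, inside the inner product. -/
theorem IsOrtho.of_condExp [CompleteSpace K] [IsProbabilityMeasure P] {ζ : Ω → K} (hm : m ≤ mΩ)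
    (hζ : MemLp ζ 2 P) (h : P[ζ | m] =ᵐ[P] 0) : IsOrtho P m ζ := by
  refine ⟨hζ, fun p hp => ?_⟩
  have h1 := condExp_bilin_of_stronglyMeasurable_left (innerSL ℝ) hp.meas
    (integrable_inner_of_memLp hp.memLp hζ) (hζ.integrable one_le_two)
  have h2 : P[fun ω => innerSL ℝ (p ω) (ζ ω) | m] =ᵐ[P] fun _ => (0 : ℝ) := by
    filter_upwards [h1, h] with ω h1 h2
    rw [h1, h2]
    simp
  have h3 := integral_condExp (μ := P) (f := fun ω => innerSL ℝ (p ω) (ζ ω)) hm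
  rw [integral_congr_ae h2, integral_zero] at h3
  exact h3.symm

theorem IsOrtho.toLp {n d : ℕ} {ζ : Ω → Stack n d} (h : ∀ i, IsOrtho P m fun ω => ζ ω i) :
    IsOrtho P m fun ω => (WithLp.toLp 2 (ζ ω) : StackL2 n d) := by
  refine ⟨memLp_piLp_iff.2 fun i => (h i).memLp, fun p hp => ?_⟩
  have hpi : ∀ i, IsAdapted P m fun ω => p ω i := fun i => by
    have := hp.clm (PiLp.proj 2 (𝕜 := ℝ) (fun _ : Fin n => Vec d) i)
    exact this
  have e : ∀ ω, inner ℝ (p ω) (WithLp.toLp 2 (ζ ω) : StackL2 n d)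
      = ∑ i, inner ℝ (p ω i) (ζ ω i) := fun ω => PiLp.inner_apply _ _
  simp only [e]
  rw [integral_finsetSum]
  · exact Finset.sum_eq_zero fun i _ => (h i).ortho _ (hpi i)
  · exact fun i _ => integrable_inner_of_memLp (hpi i).memLp (h i).memLp

theorem integral_inner_sum_smul {n : ℕ} (w w' : Fin n → ℝ) {u v : Fin n → Ω → K}
    (hu : ∀ i, MemLp (u i) 2 P) (hv : ∀ i, MemLp (v i) 2 P) :
    ∫ ω, inner ℝ (∑ i, w i • u i ω) (∑ j, w' j • v j ω) ∂P
      = ∑ i, ∑ j, w i * w' j * ∫ ω, inner ℝ (u i ω) (v j ω) ∂P := by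
  have hi : ∀ i j, Integrable (fun ω => w i * w' j * inner ℝ (u i ω) (v j ω)) P := fun i j =>
    (integrable_inner_of_memLp (hu i) (hv j)).const_mul _
  have e : ∀ ω, inner ℝ (∑ i, w i • u i ω) (∑ j, w' j • v j ω)
      = ∑ i, ∑ j, w i * w' j * inner ℝ (u i ω) (v j ω) := by
    intro ω
    rw [sum_inner]
    refine Finset.sum_congr rfl fun i _ => ?_
    rw [inner_sum]
    refine Finset.sum_congr rfl fun j _ => ?_
    rw [real_inner_smul_left, real_inner_smul_right]
    ring
  simp only [e]
  rw [integral_finsetSum _ fun i _ => integrable_finsetSum _ fun j _ => hi i j]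
  refine Finset.sum_congr rfl fun i _ => ?_
  rw [integral_finsetSum _ fun j _ => hi i j]
  refine Finset.sum_congr rfl fun j _ => ?_
  rw [integral_const_mul]

theorem integral_norm_sum_smul_sq_le {n : ℕ} {w : Fin n → ℝ} (hw0 : ∀ i, 0 ≤ w i)
    (hw : ∀ i, w i ≤ 1) {u : Fin n → Ω → K} (hu : ∀ i, MemLp (u i) 2 P) {s : ℝ}
    (hs : ∀ i, ∫ ω, ‖u i ω‖ ^ 2 ∂P ≤ s)
    (hc : ∀ i j, i ≠ j → ∫ ω, inner ℝ (u i ω) (u j ω) ∂P = 0) :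
    ∫ ω, ‖∑ i, w i • u i ω‖ ^ 2 ∂P ≤ n * s := by
  simp only [← real_inner_self_eq_norm_sq]
  rw [integral_inner_sum_smul w w hu hu]
  have : ∀ i, ∑ j, w i * w j * ∫ ω, inner ℝ (u i ω) (u j ω) ∂P ≤ s := by
    intro i
    rw [Finset.sum_eq_single i (fun j _ hj => by rw [hc i j hj.symm, mul_zero])
      (fun h => absurd (Finset.mem_univ _) h)]
    simp only [real_inner_self_eq_norm_sq]
    have h0 : 0 ≤ ∫ ω, ‖u i ω‖ ^ 2 ∂P := integral_nonneg fun ω => sq_nonneg _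
    have h1 : w i * w i ≤ 1 := mul_le_one₀ (hw i) (hw0 i) (hw i)
    nlinarith [hs i]
  calc _ ≤ ∑ _i : Fin n, s := Finset.sum_le_sum fun i _ => this i
    _ = n * s := by simp

end Orthogonality

end ICGT

namespace ICGT

/-! ### Second moments along a run -/

section Run

variable {n d : ℕ} {Ω : Type u} {mΩ : MeasurableSpace Ω} {P : Measure Ω}

/-- The measurability and orthogonality properties of a run, with respect to an increasing family
of `σ`-algebras. -/
structure IsNoisyRun (P : Measure Ω) (Q : Matrix (Fin n) (Fin n) ℝ) (α γ : ℝ)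
    (f : Fin n → Vec d → ℝ) (ℋ : ℕ → MeasurableSpace Ω) (X Y G E : ℕ → Ω → Stack n d)
    (σg σc : ℝ) : Prop where
  le : ∀ k, ℋ k ≤ mΩ
  mono : Monotone ℋ
  path : ∀ ω, IsPath Q α γ f (X · ω) (Y · ω) (G · ω) (E · ω)
  adapted_x : ∀ k i, IsAdapted P (ℋ k) fun ω => X k ω i
  adapted_g : ∀ k i, IsAdapted P (ℋ (k + 1)) fun ω => G k ω i
  adapted_e : ∀ k i, IsAdapted P (ℋ (k + 1)) fun ω => E k ω i
  ortho_g : ∀ k i, IsOrtho P (ℋ k) fun ω => G k ω i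
  ortho_e : ∀ k i, IsOrtho P (ℋ k) fun ω => E k ω i
  var_g : ∀ k i, ∫ ω, ‖G k ω i‖ ^ 2 ∂P ≤ σg ^ 2
  var_e : ∀ k i, ∫ ω, ‖E k ω i‖ ^ 2 ∂P ≤ σc ^ 2
  uncorr_g : ∀ k i j, i ≠ j → ∫ ω, inner ℝ (G k ω i) (G k ω j) ∂P = 0
  uncorr_e : ∀ k i j, i ≠ j → ∫ ω, inner ℝ (E k ω i) (E k ω j) ∂P = 0
  uncorr_ge : ∀ k i j, ∫ ω, inner ℝ (G k ω i) (E k ω j) ∂P = 0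

theorem IsAdapted.toLp {m : MeasurableSpace Ω} {z : Ω → Stack n d}
    (h : ∀ i, IsAdapted P m fun ω => z ω i) :
    IsAdapted P m fun ω => (WithLp.toLp 2 (z ω) : StackL2 n d) := by
  refine ⟨?_, memLp_piLp_iff.2 fun i => (h i).memLp⟩
  have h1 : Measurable[m] z := measurable_pi_iff.2 fun i => (h i).meas.measurable
  exact (PiLp.continuous_toLp 2 _).comp_stronglyMeasurable h1.stronglyMeasurable

theorem integral_le_of_recursion {v : ℕ → ℝ} {δ w : ℝ} (hδ : 0 < δ) (hδ1 : δ ≤ 1) (h0 : v 0 ≤ 0)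
    (hw : 0 ≤ w) (h : ∀ k, v (k + 1) ≤ (1 - δ) * v k + w) (k : ℕ) : v k ≤ w / δ := by
  induction k with
  | zero => exact h0.trans (by positivity)
  | succ k ih =>
    have h1 := mul_le_mul_of_nonneg_left ih (by linarith : 0 ≤ 1 - δ)
    have h2 : (1 - δ) * (w / δ) + w = w / δ := by field_simp; ring
    linarith [h k]

variable {hn : 2 ≤ n} {Q : Matrix (Fin n) (Fin n) ℝ} {α γ δ L μ σg σc : ℝ}
  {f : Fin n → Vec d → ℝ} {ℋ : ℕ → MeasurableSpace Ω} {X Y G E : ℕ → Ω → Stack n d} {xs : Vec d}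

namespace IsNoisyRun

theorem ortho_gL (h : IsNoisyRun P Q α γ f ℋ X Y G E σg σc) (k : ℕ) :
    IsOrtho P (ℋ k) fun ω => (WithLp.toLp 2 (G k ω) : StackL2 n d) :=
  IsOrtho.toLp (h.ortho_g k)

theorem ortho_eL (h : IsNoisyRun P Q α γ f ℋ X Y G E σg σc) (k : ℕ) :
    IsOrtho P (ℋ k) fun ω => (WithLp.toLp 2 (E k ω) : StackL2 n d) :=
  IsOrtho.toLp (h.ortho_e k)

theorem adapted_gL (h : IsNoisyRun P Q α γ f ℋ X Y G E σg σc) (k : ℕ) :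
    IsAdapted P (ℋ (k + 1)) fun ω => (WithLp.toLp 2 (G k ω) : StackL2 n d) :=
  IsAdapted.toLp (h.adapted_g k)

theorem adapted_eL (h : IsNoisyRun P Q α γ f ℋ X Y G E σg σc) (k : ℕ) :
    IsAdapted P (ℋ (k + 1)) fun ω => (WithLp.toLp 2 (E k ω) : StackL2 n d) :=
  IsAdapted.toLp (h.adapted_e k)

theorem integral_norm_toLp_sq_le {z : Ω → Stack n d} (hz : ∀ i, MemLp (fun ω => z ω i) 2 P) {s : ℝ}
    (hs : ∀ i, ∫ ω, ‖z ω i‖ ^ 2 ∂P ≤ s) :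
    ∫ ω, ‖(WithLp.toLp 2 (z ω) : StackL2 n d)‖ ^ 2 ∂P ≤ n * s := by
  simp only [norm_toLp_sq, sqNorm]
  rw [integral_finsetSum _ fun i _ => (hz i).integrable_norm_pow two_ne_zero]
  calc _ ≤ ∑ _i : Fin n, s := Finset.sum_le_sum fun i _ => hs i
    _ = n * s := by simp

theorem commMean_eq (hQ : Q ∈ doublyStochastic ℝ (Fin n)) (e : Stack n d) :
    commMean Q (WithLp.toLp 2 e) = (n : ℝ)⁻¹ • ∑ j, (1 - Q j j) • e j :=
  avgL_offMat hQ _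

theorem integral_commMean_sq_le (h : IsNoisyRun P Q α γ f ℋ X Y G E σg σc) (hn0 : 0 < n)
    (hQ : Q ∈ doublyStochastic ℝ (Fin n)) (k : ℕ) :
    ∫ ω, ‖commMean Q (WithLp.toLp 2 (E k ω))‖ ^ 2 ∂P ≤ σc ^ 2 / n := by
  have hn' : (0 : ℝ) < n := by exact_mod_cast hn0
  simp only [commMean_eq hQ, norm_smul, mul_pow]
  rw [integral_const_mul]
  have h1 := integral_norm_sum_smul_sq_le (w := fun j => 1 - Q j j)
    (fun j => sub_nonneg.2 (le_one_of_mem_doublyStochastic hQ))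
    (fun j => by linarith [nonneg_of_mem_doublyStochastic hQ (i := j) (j := j)])
    (fun j => (h.ortho_e k j).memLp) (h.var_e k) (h.uncorr_e k)
  refine (mul_le_mul_of_nonneg_left h1 (sq_nonneg _)).trans (le_of_eq ?_)
  rw [norm_inv, RCLike.norm_natCast]
  field_simp

/-- Uncorrelated nodes give the factor 1/n, and the uncorrelatedness of gradient and communication
noise removes the cross term. -/
theorem integral_meanNoise_sq_le (h : IsNoisyRun P Q α γ f ℋ X Y G E σg σc) (hn0 : 0 < n)
    (hQ : Q ∈ doublyStochastic ℝ (Fin n)) (k : ℕ) :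
    ∫ ω, ‖meanNoise Q α γ (WithLp.toLp 2 (G k ω)) (WithLp.toLp 2 (E k ω))‖ ^ 2 ∂P
      ≤ (γ ^ 2 * σc ^ 2 + α ^ 2 * σg ^ 2) / n := by
  have hn' : (0 : ℝ) < n := by exact_mod_cast hn0
  have hg : ∀ ω, avgL n d (WithLp.toLp 2 (G k ω)) = (n : ℝ)⁻¹ • ∑ j, (1 : ℝ) • G k ω j := by
    intro ω; simp [avgL_apply, avg]
  have h1 := h.integral_commMean_sq_le hn0 hQ k
  have h2 : ∫ ω, ‖avgL n d (WithLp.toLp 2 (G k ω))‖ ^ 2 ∂P ≤ σg ^ 2 / n := by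
    simp only [hg, norm_smul (n : ℝ)⁻¹, mul_pow]
    rw [integral_const_mul]
    have h1 := integral_norm_sum_smul_sq_le (w := fun _ => 1) (fun _ => zero_le_one)
      (fun _ => le_rfl) (fun j => (h.ortho_g k j).memLp) (h.var_g k) (h.uncorr_g k)
    refine (mul_le_mul_of_nonneg_left h1 (sq_nonneg _)).trans (le_of_eq ?_)
    rw [norm_inv, RCLike.norm_natCast]
    field_simp
  have h3 : ∫ ω, inner ℝ (avgL n d (WithLp.toLp 2 (G k ω)))
      (commMean Q (WithLp.toLp 2 (E k ω))) ∂P = 0 := by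
    simp only [commMean_eq hQ, hg, real_inner_smul_left, real_inner_smul_right]
    rw [integral_const_mul, integral_const_mul,
      integral_inner_sum_smul (fun _ => (1 : ℝ)) (fun j => 1 - Q j j)
        (fun j => (h.ortho_g k j).memLp) (fun j => (h.ortho_e k j).memLp)]
    simp [h.uncorr_ge k]
  have e : ∀ ω, ‖meanNoise Q α γ (WithLp.toLp 2 (G k ω)) (WithLp.toLp 2 (E k ω))‖ ^ 2
      = γ ^ 2 * ‖commMean Q (WithLp.toLp 2 (E k ω))‖ ^ 2
        + α ^ 2 * ‖avgL n d (WithLp.toLp 2 (G k ω))‖ ^ 2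
        - 2 * γ * α * inner ℝ (avgL n d (WithLp.toLp 2 (G k ω)))
          (commMean Q (WithLp.toLp 2 (E k ω))) := by
    intro ω
    rw [meanNoise, norm_sub_sq_real, norm_smul, norm_smul, mul_pow, mul_pow, Real.norm_eq_abs,
      Real.norm_eq_abs, sq_abs, sq_abs, real_inner_smul_left, real_inner_smul_right,
      real_inner_comm]
    ring
  have mE : MemLp (fun ω => commMean Q (WithLp.toLp 2 (E k ω))) 2 P :=
    (((h.ortho_eL k).clm (matL (offMat Q))).clm (avgL n d)).memLp
  have mG : MemLp (fun ω => avgL n d (WithLp.toLp 2 (G k ω))) 2 P :=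
    ((h.ortho_gL k).clm (avgL n d)).memLp
  have i1 := (mE.integrable_norm_pow two_ne_zero).const_mul (γ ^ 2)
  have i2 := (mG.integrable_norm_pow two_ne_zero).const_mul (α ^ 2)
  have i3 := (integrable_inner_of_memLp mG mE).const_mul (2 * γ * α)
  have i4 : Integrable (fun ω => γ ^ 2 * ‖commMean Q (WithLp.toLp 2 (E k ω))‖ ^ 2
        + α ^ 2 * ‖avgL n d (WithLp.toLp 2 (G k ω))‖ ^ 2) P := i1.add i2
  simp only [e]
  rw [integral_sub i4 i3, integral_add i1 i2, integral_const_mul, integral_const_mul,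
    integral_const_mul, h3]
  have h4 := mul_le_mul_of_nonneg_left h1 (sq_nonneg γ)
  have h5 := mul_le_mul_of_nonneg_left h2 (sq_nonneg α)
  have e2 : (γ ^ 2 * σc ^ 2 + α ^ 2 * σg ^ 2) / n = γ ^ 2 * (σc ^ 2 / n) + α ^ 2 * (σg ^ 2 / n) := by
    ring
  rw [e2]
  linarith

theorem ortho_meanNoise (h : IsNoisyRun P Q α γ f ℋ X Y G E σg σc) (k : ℕ) :
    IsOrtho P (ℋ k)
      fun ω => meanNoise Q α γ (WithLp.toLp 2 (G k ω)) (WithLp.toLp 2 (E k ω)) :=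
  ((((h.ortho_eL k).clm (matL (offMat Q))).clm (avgL n d)).const_smul γ).sub
    (((h.ortho_gL k).clm (avgL n d)).const_smul α)

theorem adapted_meanNoise (h : IsNoisyRun P Q α γ f ℋ X Y G E σg σc) (k : ℕ) :
    IsAdapted P (ℋ (k + 1))
      fun ω => meanNoise Q α γ (WithLp.toLp 2 (G k ω)) (WithLp.toLp 2 (E k ω)) :=
  ((((h.adapted_eL k).clm (matL (offMat Q))).clm (avgL n d)).const_smul γ).sub
    (((h.adapted_gL k).clm (avgL n d)).const_smul α)

theorem adapted_noiseLag (h : IsNoisyRun P Q α γ f ℋ X Y G E σg σc) (k : ℕ) :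
    IsAdapted P (ℋ k) fun ω => noiseLag Q α γ δ (G · ω) (E · ω) k := by
  induction k with
  | zero => exact IsAdapted.zero
  | succ k ih =>
    exact ((ih.mono (h.mono k.le_succ)).const_smul (1 - δ)).add (h.adapted_meanNoise k)

/-- Fresh noise is orthogonal to the present lag, so second moments satisfy a relaxation with factor
(1 - δ)² ≤ 1 - δ. -/
theorem integral_noiseLag_sq_le (h : IsNoisyRun P Q α γ f ℋ X Y G E σg σc) (hn0 : 0 < n)
    (hQ : Q ∈ doublyStochastic ℝ (Fin n)) (hδ : 0 < δ) (hδ1 : δ ≤ 1) (k : ℕ) :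
    ∫ ω, ‖noiseLag Q α γ δ (G · ω) (E · ω) k‖ ^ 2 ∂P
      ≤ (γ ^ 2 * σc ^ 2 + α ^ 2 * σg ^ 2) / n / δ := by
  refine integral_le_of_recursion (v := fun k => ∫ ω, ‖noiseLag Q α γ δ (G · ω) (E · ω) k‖ ^ 2 ∂P)
    hδ hδ1 (by simp [noiseLag, relaxSum]) (by positivity) (fun k => ?_) k
  have h1 := (h.ortho_meanNoise k).integral_norm_add_sq
    ((h.adapted_noiseLag (δ := δ) k).const_smul (1 - δ))
  have h2 := h.integral_meanNoise_sq_le hn0 hQ k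
  change ∫ ω, ‖(1 - δ) • noiseLag Q α γ δ (G · ω) (E · ω) k
    + meanNoise Q α γ (WithLp.toLp 2 (G k ω)) (WithLp.toLp 2 (E k ω))‖ ^ 2 ∂P ≤ _
  rw [h1]
  simp only [norm_smul (1 - δ), mul_pow]
  rw [integral_const_mul, Real.norm_of_nonneg (by linarith)]
  have h3 : 0 ≤ ∫ ω, ‖noiseLag Q α γ δ (G · ω) (E · ω) k‖ ^ 2 ∂P :=
    integral_nonneg fun ω => sq_nonneg _
  have h4 : (1 - δ) ^ 2 ≤ 1 - δ := by nlinarith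
  have h5 := mul_le_mul_of_nonneg_right h4 h3
  linarith

theorem adapted_commSum (h : IsNoisyRun P Q α γ f ℋ X Y G E σg σc) (k : ℕ) :
    IsAdapted P (ℋ k) fun ω => commSum Q (E · ω) k := by
  induction k with
  | zero =>
    simp only [commSum, Finset.range_zero, Finset.sum_empty]
    exact IsAdapted.zero
  | succ k ih =>
    simp only [commSum_succ]
    exact (ih.mono (h.mono k.le_succ)).add
      (((h.adapted_eL k).clm (matL (offMat Q))).clm (avgL n d))

/-- Orthogonal increments: each round adds at most σc²/n. -/
theorem integral_commSum_sq_le (h : IsNoisyRun P Q α γ f ℋ X Y G E σg σc) (hn0 : 0 < n)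
    (hQ : Q ∈ doublyStochastic ℝ (Fin n)) (k : ℕ) :
    ∫ ω, ‖commSum Q (E · ω) k‖ ^ 2 ∂P ≤ k * (σc ^ 2 / n) := by
  induction k with
  | zero => simp [commSum]
  | succ k ih =>
    simp only [commSum_succ]
    have h1 := IsOrtho.integral_norm_add_sq (ζ := fun ω => commMean Q (WithLp.toLp 2 (E k ω)))
      (((h.ortho_eL k).clm (matL (offMat Q))).clm (avgL n d)) (h.adapted_commSum k)
    rw [h1]
    have h2 := h.integral_commMean_sq_le hn0 hQ k
    push_cast
    linarith

/-! #### The consensus error caused by the noise -/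

theorem adapted_noiseState (h : IsNoisyRun P Q α γ f ℋ X Y G E σg σc) (k : ℕ) :
    IsAdapted P (ℋ k) (fun ω => (noiseState Q α γ (G · ω) (E · ω) k).1) ∧
    IsAdapted P (ℋ k) (fun ω => (noiseState Q α γ (G · ω) (E · ω) k).2.1) ∧
    IsAdapted P (ℋ k) (fun ω => (noiseState Q α γ (G · ω) (E · ω) k).2.2) := by
  induction k with
  | zero => exact ⟨IsAdapted.zero, IsAdapted.zero, IsAdapted.zero⟩
  | succ k ih =>
    obtain ⟨h1, h2, h3⟩ := ih
    have m := h.mono k.le_succ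
    have g := (h.adapted_gL k).clm (matL (devMat n))
    have e := (h.adapted_eL k).clm (matL (devMat n * offMat Q))
    refine ⟨?_, ?_, ?_⟩
    · exact ((((h1.mono m).clm (matL (contrMat Q γ))).add
        ((h2.mono m).sub ((h2.mono m).clm (matL (contrMat Q γ))))).sub (h3.mono m)).add
        ((by simpa using (g.const_smul α).const_smul (-1) :
          IsAdapted P (ℋ (k + 1)) fun ω => -(α • matL (devMat n) (WithLp.toLp 2 (G k ω)))).add
          (e.const_smul γ))
    · exact ((h2.mono m).clm (matL (contrMat Q γ))).add (g.const_smul α)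
    · exact ((h3.mono m).clm (matL (contrMat Q γ))).add (e.const_smul (α * γ))

theorem integrable_lyap {z : Ω → StackL2 n d × StackL2 n d × StackL2 n d}
    (h1 : MemLp (fun ω => (z ω).1) 2 P) (h2 : MemLp (fun ω => (z ω).2.1) 2 P)
    (h3 : MemLp (fun ω => (z ω).2.2) 2 P) : Integrable (fun ω => lyap δ (z ω)) P :=
  ((h1.integrable_norm_pow two_ne_zero).add
    ((h2.integrable_norm_pow two_ne_zero).const_mul 4)).add
    ((h3.integrable_norm_pow two_ne_zero).const_mul (10 / δ ^ 2))

theorem integral_lyap {z : Ω → StackL2 n d × StackL2 n d × StackL2 n d}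
    (h1 : MemLp (fun ω => (z ω).1) 2 P) (h2 : MemLp (fun ω => (z ω).2.1) 2 P)
    (h3 : MemLp (fun ω => (z ω).2.2) 2 P) :
    ∫ ω, lyap δ (z ω) ∂P = ∫ ω, ‖(z ω).1‖ ^ 2 ∂P + 4 * ∫ ω, ‖(z ω).2.1‖ ^ 2 ∂P
      + 10 / δ ^ 2 * ∫ ω, ‖(z ω).2.2‖ ^ 2 ∂P := by
  have i1 := h1.integrable_norm_pow two_ne_zero
  have i2 := (h2.integrable_norm_pow two_ne_zero).const_mul 4
  have i3 := (h3.integrable_norm_pow two_ne_zero).const_mul (10 / δ ^ 2)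
  have i4 : Integrable (fun ω => ‖(z ω).1‖ ^ 2 + 4 * ‖(z ω).2.1‖ ^ 2) P := i1.add i2
  simp only [lyap]
  rw [integral_add i4 i3, integral_add i1 i2, integral_const_mul, integral_const_mul]

theorem integral_lyap_noiseInput_le (h : IsNoisyRun P Q α γ f ℋ X Y G E σg σc) (hn0 : 0 < n)
    (hQ : Q ∈ doublyStochastic ℝ (Fin n)) (k : ℕ) :
    ∫ ω, lyap δ (noiseInput Q α γ (WithLp.toLp 2 (G k ω)) (WithLp.toLp 2 (E k ω))) ∂P
      ≤ n * (6 * α ^ 2 * σg ^ 2 + (2 + 10 * α ^ 2 / δ ^ 2) * γ ^ 2 * σc ^ 2) := by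
  have hg := (h.ortho_gL k).memLp.integrable_norm_pow two_ne_zero
  have he := (h.ortho_eL k).memLp.integrable_norm_pow two_ne_zero
  have h1 := integral_norm_toLp_sq_le (fun i => (h.ortho_g k i).memLp) (h.var_g k)
  have h2 := integral_norm_toLp_sq_le (fun i => (h.ortho_e k i).memLp) (h.var_e k)
  have hle : ∀ ω, lyap δ (noiseInput Q α γ (WithLp.toLp 2 (G k ω)) (WithLp.toLp 2 (E k ω)))
      ≤ 6 * α ^ 2 * ‖(WithLp.toLp 2 (G k ω) : StackL2 n d)‖ ^ 2
        + (2 + 10 * α ^ 2 / δ ^ 2) * γ ^ 2 * ‖(WithLp.toLp 2 (E k ω) : StackL2 n d)‖ ^ 2 := by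
    intro ω
    have e1 := norm_matL_devMat_le hn0 (WithLp.toLp 2 (G k ω) : StackL2 n d)
    have e2 := (norm_matL_devMat_le hn0 (matL (offMat Q) (WithLp.toLp 2 (E k ω)))).trans
      (norm_matL_offMat_le hQ (WithLp.toLp 2 (E k ω) : StackL2 n d))
    rw [← matL_mul_apply] at e2
    have e3 := norm_add_sq_le_two (-(α • matL (devMat n) (WithLp.toLp 2 (G k ω) : StackL2 n d)))
      (γ • matL (devMat n * offMat Q) (WithLp.toLp 2 (E k ω) : StackL2 n d))
    simp only [lyap, noiseInput]
    rw [norm_neg, norm_smul, norm_smul, mul_pow, mul_pow, Real.norm_eq_abs, sq_abs,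
      Real.norm_eq_abs, sq_abs] at e3
    rw [norm_smul α, norm_smul (α * γ), mul_pow, mul_pow, Real.norm_eq_abs, sq_abs,
      Real.norm_eq_abs, sq_abs]
    have e4 := mul_le_mul_of_nonneg_left e1 (sq_nonneg α)
    have e5 := mul_le_mul_of_nonneg_left e2 (sq_nonneg γ)
    have e6 := mul_le_mul_of_nonneg_left e5 (by positivity : 0 ≤ 10 * α ^ 2 / δ ^ 2)
    have e7 : 10 / δ ^ 2 * ((α * γ) ^ 2
        * ‖matL (devMat n * offMat Q) (WithLp.toLp 2 (E k ω) : StackL2 n d)‖ ^ 2)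
      = 10 * α ^ 2 / δ ^ 2 * (γ ^ 2
        * ‖matL (devMat n * offMat Q) (WithLp.toLp 2 (E k ω) : StackL2 n d)‖ ^ 2) := by ring
    rw [e7]
    linarith
  have i1 := hg.const_mul (6 * α ^ 2)
  have i2 := he.const_mul ((2 + 10 * α ^ 2 / δ ^ 2) * γ ^ 2)
  refine (integral_mono_of_nonneg (Filter.Eventually.of_forall fun ω => lyap_nonneg _ _)
    (i1.add i2) (Filter.Eventually.of_forall hle)).trans ?_
  simp only [Pi.add_apply]
  rw [integral_add i1 i2, integral_const_mul, integral_const_mul]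
  have e1 := mul_le_mul_of_nonneg_left h1 (by positivity : 0 ≤ 6 * α ^ 2)
  have e2 := mul_le_mul_of_nonneg_left h2
    (by positivity : 0 ≤ (2 + 10 * α ^ 2 / δ ^ 2) * γ ^ 2)
  linarith

/-- The inputs of round k are orthogonal to the state in each of the three components. Their energy
is simply added to the contracted energy, so only one factor 1/δ is lost. Correlation between the
components is harmless because `lyap` has no cross terms. -/
theorem integral_lyap_noiseState_le (h : IsNoisyRun P Q α γ f ℋ X Y G E σg σc) (hQ : IsMixing hn Q)
    (hγ : 0 < γ) (hγ1 : γ < 1 / 4) (hδ : δ = γ * (1 - lam2 hQ)) (hδ0 : 0 < δ) (hδ1 : δ ≤ 1)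
    (k : ℕ) :
    ∫ ω, lyap δ (noiseState Q α γ (G · ω) (E · ω) k) ∂P
      ≤ n * (6 * α ^ 2 * σg ^ 2 + (2 + 10 * α ^ 2 / δ ^ 2) * γ ^ 2 * σc ^ 2) / (δ / 2) := by
  have hn0 : 0 < n := by omega
  have hA : IsContr (matL (d := d) (contrMat Q γ)) δ := hδ ▸ isContr_contrMat hQ hγ hγ1
  refine integral_le_of_recursion
    (v := fun k => ∫ ω, lyap δ (noiseState Q α γ (G · ω) (E · ω) k) ∂P) (by positivity)
    (by linarith) (by simp [noiseState, sysState, lyap]) (by positivity) (fun k => ?_) k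
  obtain ⟨a1, a2, a3⟩ := h.adapted_noiseState k
  have gO := ((h.ortho_gL k).clm (matL (devMat n))).const_smul α
  have eO := (h.ortho_eL k).clm (matL (devMat n * offMat Q))
  have s1 := (((a1.clm (matL (contrMat Q γ))).add
    (a2.sub (a2.clm (matL (contrMat Q γ))))).sub a3)
  have s2 := a2.clm (matL (contrMat Q γ))
  have s3 := a3.clm (matL (contrMat Q γ))
  have p1 := (gO.neg.add (eO.const_smul γ)).integral_norm_add_sq s1
  have p2 := gO.integral_norm_add_sq s2
  have p3 := (eO.const_smul (α * γ)).integral_norm_add_sq s3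
  have k1 := (h.adapted_noiseState (k + 1)).1.memLp
  have k2 := (h.adapted_noiseState (k + 1)).2.1.memLp
  have k3 := (h.adapted_noiseState (k + 1)).2.2.memLp
  have e1 := integral_lyap (δ := δ) k1 k2 k3
  have e2 := integral_lyap (δ := δ)
    (z := fun ω => sysStep (matL (contrMat Q γ)) (noiseState Q α γ (G · ω) (E · ω) k))
    s1.memLp s2.memLp s3.memLp
  have e3 := integral_lyap (δ := δ)
    (z := fun ω => noiseInput Q α γ (WithLp.toLp 2 (G k ω)) (WithLp.toLp 2 (E k ω)))
    (gO.neg.add (eO.const_smul γ)).memLp gO.memLp (eO.const_smul (α * γ)).memLp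
  have e4 := h.integral_lyap_noiseInput_le (δ := δ) hn0 hQ.stoch k
  have e5 : ∫ ω, lyap δ (sysStep (matL (contrMat Q γ)) (noiseState Q α γ (G · ω) (E · ω) k)) ∂P
      ≤ (1 - δ / 2) * ∫ ω, lyap δ (noiseState Q α γ (G · ω) (E · ω) k) ∂P := by
    rw [← integral_const_mul]
    exact integral_mono (integrable_lyap s1.memLp s2.memLp s3.memLp)
      ((integrable_lyap a1.memLp a2.memLp a3.memLp).const_mul _)
      fun ω => lyap_sysStep_le hA hδ0 hδ1 _
  have e6 : ∫ ω, lyap δ (noiseState Q α γ (G · ω) (E · ω) (k + 1)) ∂P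
      = ∫ ω, lyap δ (sysStep (matL (contrMat Q γ)) (noiseState Q α γ (G · ω) (E · ω) k)) ∂P
        + ∫ ω, lyap δ (noiseInput Q α γ (WithLp.toLp 2 (G k ω)) (WithLp.toLp 2 (E k ω))) ∂P := by
    refine e1.trans ?_
    rw [e2, e3]
    refine (congrArg₂ _ (congrArg₂ _ p1 (congrArg _ p2)) (congrArg _ p3)).trans ?_
    simp only [sysStep, noiseInput]
    ring
  rw [e6]
  linarith

end IsNoisyRun

end Run

end ICGT

namespace ICGT

/-! ### Adaptedness of the drift quantities and the expected one-step inequality. -/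

section Expectation

variable {n d : ℕ} {Ω : Type u} {mΩ : MeasurableSpace Ω} {P : Measure Ω}
  {hn : 2 ≤ n} {Q : Matrix (Fin n) (Fin n) ℝ} {α γ δ η L μ σg σc : ℝ}
  {f : Fin n → Vec d → ℝ} {ℋ : ℕ → MeasurableSpace Ω} {X Y G E : ℕ → Ω → Stack n d} {xs : Vec d}

theorem IsRegular.continuous_gradient (hf : IsRegular f L μ) (i : Fin n) :
    Continuous (gradient (f i)) := by
  have h : LipschitzWith (Real.toNNReal L) (gradient (f i)) := by
    refine LipschitzWith.of_dist_le_mul fun x y => ?_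
    rw [dist_eq_norm, dist_eq_norm]
    exact (hf.smooth i x y).trans
      (mul_le_mul_of_nonneg_right (Real.le_coe_toNNReal L) (norm_nonneg _))
  exact h.continuous

/-- A Lipschitz gradient is continuous and grows at most linearly, so it preserves measurability and
square integrability. -/
theorem IsAdapted.gradient_comp [IsProbabilityMeasure P] {m : MeasurableSpace Ω}
    (hm : m ≤ mΩ) (hf : IsRegular f L μ) {p : Ω → Vec d} (hp : IsAdapted P m p) (i : Fin n) :
    IsAdapted P m fun ω => gradient (f i) (p ω) := by
  have h1 : StronglyMeasurable[m] fun ω => gradient (f i) (p ω) :=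
    (hf.continuous_gradient i).comp_stronglyMeasurable hp.meas
  have h2 : MemLp (fun ω => L * ‖p ω‖ + ‖gradient (f i) 0‖) 2 P :=
    (hp.memLp.norm.const_mul L).add (memLp_const _)
  refine ⟨h1, h2.mono' (h1.mono hm).aestronglyMeasurable (Filter.Eventually.of_forall fun ω => ?_)⟩
  have h3 := hf.smooth i (p ω) 0
  have h4 := norm_le_norm_sub_add (gradient (f i) (p ω)) (gradient (f i) 0)
  rw [sub_zero] at h3
  linarith

namespace IsNoisyRun

theorem adapted_xL (h : IsNoisyRun P Q α γ f ℋ X Y G E σg σc) (k : ℕ) :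
    IsAdapted P (ℋ k) fun ω => (WithLp.toLp 2 (X k ω) : StackL2 n d) :=
  IsAdapted.toLp (h.adapted_x k)

theorem adapted_avg_x (h : IsNoisyRun P Q α γ f ℋ X Y G E σg σc) (k : ℕ) :
    IsAdapted P (ℋ k) fun ω => avg (X k ω) :=
  (h.adapted_xL k).clm (avgL n d)

theorem dev_y_zero (h : IsNoisyRun P Q α γ f ℋ X Y G E σg σc) (ω : Ω) :
    (WithLp.toLp 2 (dev (Y 0 ω)) : StackL2 n d)
      = matL (devMat n) (WithLp.toLp 2 (grads f (X 0 ω)))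
        + matL (devMat n) (WithLp.toLp 2 (G 0 ω)) := by
  rw [← matL_devMat_toLp, ← map_add, ← WithLp.toLp_add, ← (h.path ω).y_zero]

/-- The gradient noise in the initial tracker cancels, so the third component starts free of noise.
-/
theorem driftState_zero (h : IsNoisyRun P Q α γ f ℋ X Y G E σg σc) (ω : Ω) :
    driftState Q α γ δ f (X · ω) (Y · ω) (G · ω) (E · ω) 0
      = (WithLp.toLp 2 (dev (X 0 ω)), 0,
        α • (matL (devMat n) (WithLp.toLp 2 (grads f (X 0 ω)))
          - diffGrads f (X 0 ω) (runMean Q α γ δ f (X · ω) (G · ω) (E · ω) 0))) := by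
  have h1 := h.dev_y_zero ω
  simp only [driftState, sysState, h1, Prod.mk.injEq, true_and]
  rw [← smul_sub]
  congr 1
  abel

variable [IsProbabilityMeasure P]

theorem adapted_gradsL (h : IsNoisyRun P Q α γ f ℋ X Y G E σg σc) (hf : IsRegular f L μ) (k : ℕ) :
    IsAdapted P (ℋ k) fun ω => (WithLp.toLp 2 (grads f (X k ω)) : StackL2 n d) :=
  IsAdapted.toLp fun i => (h.adapted_x k i).gradient_comp (h.le k) hf i

theorem adapted_avg_grads (h : IsNoisyRun P Q α γ f ℋ X Y G E σg σc) (hf : IsRegular f L μ)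
    (k : ℕ) : IsAdapted P (ℋ k) fun ω => avg (grads f (X k ω)) :=
  (h.adapted_gradsL hf k).clm (avgL n d)

theorem adapted_drift (h : IsNoisyRun P Q α γ f ℋ X Y G E σg σc) (hf : IsRegular f L μ) (k : ℕ) :
    IsAdapted P (ℋ k) fun ω => α • (avg (grads f (X k ω)) + γ • commSum Q (E · ω) k) :=
  ((h.adapted_avg_grads hf k).add ((h.adapted_commSum k).const_smul γ)).const_smul α

theorem adapted_driftLag (h : IsNoisyRun P Q α γ f ℋ X Y G E σg σc) (hf : IsRegular f L μ)
    (k : ℕ) : IsAdapted P (ℋ k) fun ω => driftLag Q α γ δ f (X · ω) (E · ω) k := by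
  induction k with
  | zero => exact IsAdapted.zero
  | succ k ih =>
    have h1 := ((ih.const_smul (1 - δ)).sub (h.adapted_drift hf k)).mono (h.mono k.le_succ)
    simp only [sub_eq_add_neg (_ • driftLag Q α γ δ f _ _ k)] at h1
    exact h1

theorem adapted_runMean (h : IsNoisyRun P Q α γ f ℋ X Y G E σg σc) (hf : IsRegular f L μ)
    (k : ℕ) : IsAdapted P (ℋ k) fun ω => runMean Q α γ δ f (X · ω) (G · ω) (E · ω) k :=
  (h.adapted_avg_x k).sub ((h.adapted_noiseLag k).add (h.adapted_driftLag hf k))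

theorem adapted_meanGrads (h : IsNoisyRun P Q α γ f ℋ X Y G E σg σc) (hf : IsRegular f L μ)
    (k : ℕ) :
    IsAdapted P (ℋ k)
      fun ω => meanGrads f (runMean Q α γ δ f (X · ω) (G · ω) (E · ω) k) :=
  (IsAdapted.toLp fun i => (h.adapted_runMean hf k).gradient_comp (h.le k) hf i).clm (matL (devMat n))

theorem adapted_diffGrads (h : IsNoisyRun P Q α γ f ℋ X Y G E σg σc) (hf : IsRegular f L μ)
    (k : ℕ) :
    IsAdapted P (ℋ k)
      fun ω => diffGrads f (X k ω) (runMean Q α γ δ f (X · ω) (G · ω) (E · ω) k) :=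
  (IsAdapted.toLp fun i => ((h.adapted_x k i).gradient_comp (h.le k) hf i).sub
    ((h.adapted_runMean hf k).gradient_comp (h.le k) hf i)).clm (matL (devMat n))

theorem adapted_driftState (h : IsNoisyRun P Q α γ f ℋ X Y G E σg σc) (hf : IsRegular f L μ)
    (k : ℕ) :
    IsAdapted P (ℋ k)
      (fun ω => (driftState Q α γ δ f (X · ω) (Y · ω) (G · ω) (E · ω) k).1) ∧
    IsAdapted P (ℋ k)
      (fun ω => (driftState Q α γ δ f (X · ω) (Y · ω) (G · ω) (E · ω) k).2.1) ∧
    IsAdapted P (ℋ k)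
      (fun ω => (driftState Q α γ δ f (X · ω) (Y · ω) (G · ω) (E · ω) k).2.2) := by
  induction k with
  | zero =>
    simp only [h.driftState_zero]
    refine ⟨?_, IsAdapted.zero, ?_⟩
    · simp only [← matL_devMat_toLp]
      exact (h.adapted_xL 0).clm (matL (devMat n))
    · exact (((h.adapted_gradsL hf 0).clm (matL (devMat n))).sub
        (h.adapted_diffGrads hf 0)).const_smul α
  | succ k ih =>
    obtain ⟨h1, h2, h3⟩ := ih
    have m := h.mono k.le_succ
    have hd := (h.adapted_diffGrads (δ := δ) hf k).mono m
    refine ⟨?_, ?_, ?_⟩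
    · exact ((((h1.mono m).clm (matL (contrMat Q γ))).add
        ((h2.mono m).sub ((h2.mono m).clm (matL (contrMat Q γ))))).sub (h3.mono m)).add
        (by simpa using (hd.const_smul α).const_smul (-1) :
          IsAdapted P (ℋ (k + 1))
            fun ω => -(α • diffGrads f (X k ω) (runMean Q α γ δ f (X · ω) (G · ω) (E · ω) k)))
    · exact ((h2.mono m).clm (matL (contrMat Q γ))).add (hd.const_smul α)
    · exact ((h3.mono m).clm (matL (contrMat Q γ))).add
        (((h.adapted_meanGrads hf (k + 1)).sub ((h.adapted_meanGrads hf k).mono m)).const_smul α)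

theorem integrable_potential (h : IsNoisyRun P Q α γ f ℋ X Y G E σg σc) (hf : IsRegular f L μ)
    (k : ℕ) :
    Integrable (fun ω => potential Q α γ δ η f (X · ω) (Y · ω) (G · ω) (E · ω) k) P := by
  obtain ⟨h1, h2, h3⟩ := h.adapted_driftState (δ := δ) hf k
  exact ((integrable_lyap h1.memLp h2.memLp h3.memLp).const_mul _).add
    (((h.adapted_driftLag hf k).memLp.integrable_norm_pow two_ne_zero).const_mul _)

theorem adapted_err (h : IsNoisyRun P Q α γ f ℋ X Y G E σg σc) (xs : Vec d) (k : ℕ) :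
    IsAdapted P (ℋ k) fun ω => avg (X k ω) - xs :=
  (h.adapted_avg_x k).sub ⟨stronglyMeasurable_const, memLp_const xs⟩

theorem expected_potential_step (h : IsNoisyRun P Q α γ f ℋ X Y G E σg σc) (hQ : IsMixing hn Q)
    (hf : IsRegular f L μ) (hxs : IsOptimal f xs) (hL : 0 < L) (hμ : 0 < μ) (hμL : μ ≤ L)
    (hα : 0 < α) (hγ : 0 < γ) (hγ1 : γ < 1 / 4) (hδ : δ = γ * (1 - lam2 hQ)) (hδ0 : 0 < δ)
    (hδ1 : δ ≤ 1) (hη : α * L = η * δ) (hη1 : η ≤ 1 / 300000) (k : ℕ) :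
    ∫ ω, ‖avg (X (k + 1) ω) - xs‖ ^ 2 ∂P
        + ∫ ω, potential Q α γ δ η f (X · ω) (Y · ω) (G · ω) (E · ω) (k + 1) ∂P
      ≤ (1 - α * μ / 4) * (∫ ω, ‖avg (X k ω) - xs‖ ^ 2 ∂P
          + ∫ ω, potential Q α γ δ η f (X · ω) (Y · ω) (G · ω) (E · ω) k ∂P)
        + (3 * (α * L) / n
            * (n * (6 * α ^ 2 * σg ^ 2 + (2 + 10 * α ^ 2 / δ ^ 2) * γ ^ 2 * σc ^ 2) / (δ / 2))
          + α * L * ((γ ^ 2 * σc ^ 2 + α ^ 2 * σg ^ 2) / n / δ)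
          + (γ ^ 2 * σc ^ 2 + α ^ 2 * σg ^ 2) / n)
        + 2 * α * γ ^ 2 / μ * (σc ^ 2 / n) * k := by
  have hn0 : 0 < n := by omega
  have hp := (h.adapted_err xs k).sub (h.adapted_drift hf k)
  have e1 := (h.ortho_meanNoise k).integral_norm_add_sq hp
  have e2 : ∫ ω, ‖avg (X (k + 1) ω) - xs‖ ^ 2 ∂P
      = ∫ ω, ‖avg (X k ω) - xs - α • (avg (grads f (X k ω)) + γ • commSum Q (E · ω) k)
        + meanNoise Q α γ (WithLp.toLp 2 (G k ω)) (WithLp.toLp 2 (E k ω))‖ ^ 2 ∂P := by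
    congr 1
    ext ω
    rw [(h.path ω).avg_x_succ hQ.stoch]
    congr 2
    abel
  obtain ⟨a1, a2, a3⟩ := h.adapted_noiseState k
  have i0 := hp.memLp.integrable_norm_pow two_ne_zero
  have i1 := h.integrable_potential (δ := δ) (η := η) hf (k + 1)
  have i2 := (h.adapted_err xs k).memLp.integrable_norm_pow two_ne_zero
  have i3 := h.integrable_potential (δ := δ) (η := η) hf k
  have i4 := (integrable_lyap (δ := δ) a1.memLp a2.memLp a3.memLp).const_mul (3 * (α * L) / n)
  have i5 := ((h.adapted_noiseLag (δ := δ) k).memLp.integrable_norm_pow two_ne_zero).const_mul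
    (α * L)
  have i6 := ((h.adapted_commSum k).memLp.integrable_norm_pow two_ne_zero).const_mul
    (2 * α * γ ^ 2 / μ)
  have i23 := (i2.add i3).const_mul (1 - α * μ / 4)
  -- The potential is bounded pathwise; orthogonality is needed only for the squared error, where
  -- the variance of the fresh noise is added.
  have e3 := integral_mono (i0.add i1) (((i23.add i4).add i5).add i6) fun ω =>
    (h.path ω).potential_step hQ hf hxs hL hμ hμL hα hγ hγ1 hδ hη hη1 k
  rw [integral_add' i0 i1, integral_add' ((i23.add i4).add i5) i6, integral_add' (i23.add i4) i5,
    integral_add' i23 i4, integral_const_mul, integral_const_mul, integral_const_mul,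
    integral_const_mul, integral_add' i2 i3] at e3
  have b1 := mul_le_mul_of_nonneg_left
    (h.integral_lyap_noiseState_le hQ hγ hγ1 hδ hδ0 hδ1 k) (by positivity : 0 ≤ 3 * (α * L) / n)
  have b2 := mul_le_mul_of_nonneg_left
    (h.integral_noiseLag_sq_le hn0 hQ.stoch hδ0 hδ1 k) (by positivity : 0 ≤ α * L)
  have b3 := mul_le_mul_of_nonneg_left
    (h.integral_commSum_sq_le hn0 hQ.stoch k) (by positivity : 0 ≤ 2 * α * γ ^ 2 / μ)
  have b4 := h.integral_meanNoise_sq_le hn0 hQ.stoch k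
  have e4 : 2 * α * γ ^ 2 / μ * (k * (σc ^ 2 / n)) = 2 * α * γ ^ 2 / μ * (σc ^ 2 / n) * k := by
    ring
  rw [e4] at b3
  rw [e2, e1]
  linarith

/-- Initially the gradient disagreement and the gradient noise are orthogonal, so the former has at
most the second moment of their sum, the tracker's disagreement. -/
theorem integral_lyap_driftState_zero_le (h : IsNoisyRun P Q α γ f ℋ X Y G E σg σc)
    (hn0 : 0 < n) (hf : IsRegular f L μ) (hδ0 : 0 < δ) :
    ∫ ω, lyap δ (driftState Q α γ δ f (X · ω) (Y · ω) (G · ω) (E · ω) 0) ∂P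
      ≤ (1 + 20 * (α * L / δ) ^ 2) * ∫ ω, sqNorm (dev (X 0 ω)) ∂P
        + 20 / δ ^ 2 * ∫ ω, sqNorm (α • dev (Y 0 ω)) ∂P := by
  have gO := (h.ortho_gL 0).clm (matL (devMat n))
  have gA := (h.adapted_gradsL hf 0).clm (matL (devMat n))
  have e1 := (gO.const_smul α).integral_norm_add_sq (gA.const_smul α)
  have e2 : ∀ ω, sqNorm (α • dev (Y 0 ω))
      = ‖α • matL (devMat n) (WithLp.toLp 2 (grads f (X 0 ω)))
        + α • matL (devMat n) (WithLp.toLp 2 (G 0 ω))‖ ^ 2 := by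
    intro ω
    rw [← norm_toLp_sq, WithLp.toLp_smul, h.dev_y_zero ω, smul_add]
  have hxA : IsAdapted P (ℋ 0) fun ω => (WithLp.toLp 2 (dev (X 0 ω)) : StackL2 n d) := by
    simp only [← matL_devMat_toLp]
    exact (h.adapted_xL 0).clm (matL (devMat n))
  have ix : Integrable (fun ω => sqNorm (dev (X 0 ω))) P := by
    simp only [← norm_toLp_sq]
    exact hxA.memLp.integrable_norm_pow two_ne_zero
  have ig := (gA.const_smul α).memLp.integrable_norm_pow two_ne_zero
  have hle : ∀ ω, lyap δ (driftState Q α γ δ f (X · ω) (Y · ω) (G · ω) (E · ω) 0)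
      ≤ (1 + 20 * (α * L / δ) ^ 2) * sqNorm (dev (X 0 ω))
        + 20 / δ ^ 2 * ‖α • matL (devMat n) (WithLp.toLp 2 (grads f (X 0 ω)))‖ ^ 2 := by
    intro ω
    rw [h.driftState_zero]
    simp only [lyap, norm_toLp_sq, norm_zero]
    have h1 := norm_diffGrads_sq_le hn0 hf (X 0 ω)
      (runMean Q α γ δ f (X · ω) (G · ω) (E · ω) 0)
    have h2 : runMean Q α γ δ f (X · ω) (G · ω) (E · ω) 0 = avg (X 0 ω) := by
      simp [runMean, noiseLag, driftLag, relaxSum]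
    rw [h2, sub_self, norm_zero] at h1
    rw [h2, smul_sub]
    have h3 := norm_sub_sq_le_two
      (α • matL (devMat n) (WithLp.toLp 2 (grads f (X 0 ω)) : StackL2 n d))
      (α • diffGrads f (X 0 ω) (avg (X 0 ω)))
    rw [norm_smul α (diffGrads f (X 0 ω) (avg (X 0 ω))), mul_pow, Real.norm_eq_abs, sq_abs] at h3
    have h4 := mul_le_mul_of_nonneg_left h1 (sq_nonneg α)
    have h5 : ‖α • matL (devMat n) (WithLp.toLp 2 (grads f (X 0 ω)) : StackL2 n d)
        - α • diffGrads f (X 0 ω) (avg (X 0 ω))‖ ^ 2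
        ≤ 2 * ‖α • matL (devMat n) (WithLp.toLp 2 (grads f (X 0 ω)) : StackL2 n d)‖ ^ 2
          + 2 * (α ^ 2 * (L ^ 2 * sqNorm (dev (X 0 ω)))) := by
      simp at h4
      linarith
    have h6 := mul_le_mul_of_nonneg_left h5 (by positivity : 0 ≤ 10 / δ ^ 2)
    refine (add_le_add le_rfl h6).trans (le_of_eq ?_)
    field_simp
    ring
  refine (integral_mono_of_nonneg (Filter.Eventually.of_forall fun ω => lyap_nonneg _ _)
    ((ix.const_mul _).add (ig.const_mul _)) (Filter.Eventually.of_forall hle)).trans ?_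
  rw [integral_add' (ix.const_mul _) (ig.const_mul _), integral_const_mul, integral_const_mul]
  have h0 : 0 ≤ ∫ ω, ‖α • matL (devMat n) (WithLp.toLp 2 (G 0 ω) : StackL2 n d)‖ ^ 2 ∂P :=
    integral_nonneg fun ω => sq_nonneg _
  simp only [e2]
  rw [e1]
  gcongr
  linarith

end IsNoisyRun

end Expectation

end ICGT

namespace ICGT

/-! ### The error bound -/

/-- A geometric sum with the growing input frozen at its last value; this costs nothing in order
since the inputs increase. -/
theorem le_of_linear_recursion {φ : ℕ → ℝ} {q C D : ℝ} (hq : 0 < q) (hq1 : q ≤ 1)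
    (hC : 0 ≤ C) (hD : 0 ≤ D) (h : ∀ k : ℕ, φ (k + 1) ≤ (1 - q) * φ k + C + D * k) (T : ℕ) :
    φ T ≤ (1 - q) ^ T * φ 0 + (C + D * T) / q := by
  induction T with
  | zero =>
    have : 0 ≤ (C + D * (0 : ℕ)) / q := by positivity
    simp only [pow_zero, one_mul]
    linarith
  | succ k ih =>
    have h1 := mul_le_mul_of_nonneg_left ih (by linarith : 0 ≤ 1 - q)
    have h2 : (1 - q) * ((1 - q) ^ k * φ 0 + (C + D * k) / q) + C + D * k
        = (1 - q) ^ (k + 1) * φ 0 + (C + D * k) / q := by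
      rw [pow_succ]; field_simp; ring
    have h3 : (C + D * k) / q ≤ (C + D * ((k + 1 : ℕ) : ℝ)) / q := by
      push_cast
      gcongr
      linarith
    linarith [h k]

theorem one_le_log_sixteen : 1 ≤ Real.log 16 := by
  rw [Real.le_log_iff_exp_le (by norm_num)]
  have := Real.exp_one_lt_d9
  linarith

theorem two_div_le_tau {γ l2 : ℝ} (hδ : 0 < γ * (1 - l2)) :
    2 / (γ * (1 - l2)) ≤ (tau γ l2 : ℝ) := by
  have h1 : 2 / (γ * (1 - l2)) * 1 ≤ 2 / (γ * (1 - l2)) *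
      max (4 * Real.log (2 / (γ * (1 - l2)))) (γ * (1 - l2) + Real.log 16) := by
    gcongr
    refine le_trans ?_ (le_max_right _ _)
    linarith [one_le_log_sixteen]
  rw [mul_one] at h1
  exact h1.trans (Nat.le_ceil _)

theorem steady_state_le {α L μ δ n τ γ σg σc T : ℝ} (hα : 0 < α) (hL : 0 < L) (hμ : 0 < μ)
    (hδ : 0 < δ) (hn : 1 ≤ n) (hT : 0 ≤ T) (hτ : 2 / δ ≤ τ) :
    ((3 * (α * L) / n
            * (n * (6 * α ^ 2 * σg ^ 2 + (2 + 10 * α ^ 2 / δ ^ 2) * γ ^ 2 * σc ^ 2) / (δ / 2))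
          + α * L * ((γ ^ 2 * σc ^ 2 + α ^ 2 * σg ^ 2) / n / δ)
          + (γ ^ 2 * σc ^ 2 + α ^ 2 * σg ^ 2) / n)
        + 2 * α * γ ^ 2 / μ * (σc ^ 2 / n) * T) / (α * μ / 4)
      ≤ (4 * α / μ + 101920 * L * (τ + 1) * n * α ^ 2 / μ) * (σg ^ 2 / n)
        + (4 * (1 + 2 * μ⁻¹ * T * α) / μ * (γ ^ 2 / α)
            + 33280 * (2 + α ^ 2 * (τ ^ 2 + 1 / 2) + α ^ 2 * T) * L / μ
              * n * τ * γ ^ 2) * (σc ^ 2 / n) := by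
  have hn0 : 0 < n := by linarith
  have hτ0 : 0 < τ := lt_of_lt_of_le (by positivity) hτ
  set w := 6 * α ^ 2 * σg ^ 2 + (2 + 10 * α ^ 2 / δ ^ 2) * γ ^ 2 * σc ^ 2 with hw
  set n0 := γ ^ 2 * σc ^ 2 + α ^ 2 * σg ^ 2 with hn0'
  have hw0 : 0 ≤ w := by positivity
  have hn00 : 0 ≤ n0 := by positivity
  have e1 : ((3 * (α * L) / n * (n * w / (δ / 2)) + α * L * (n0 / n / δ) + n0 / n)
        + 2 * α * γ ^ 2 / μ * (σc ^ 2 / n) * T) / (α * μ / 4)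
      -- The first two terms are exactly the leading terms claimed. The constants 101920 and 33280
      -- only have to dominate the third one, after 2/δ is replaced by τ.
      = 4 * α / μ * (σg ^ 2 / n) + 4 * (1 + 2 * μ⁻¹ * T * α) / μ * (γ ^ 2 / α) * (σc ^ 2 / n)
        + 2 * (L / μ) * (2 / δ) * (6 * w + n0 / n) := by
    rw [hn0']; field_simp; ring
  have e2 : 10 * α ^ 2 / δ ^ 2 = 5 / 2 * α ^ 2 * (2 / δ) ^ 2 := by field_simp; ring
  have h1 : w ≤ 6 * α ^ 2 * σg ^ 2 + (2 + 5 / 2 * α ^ 2 * τ ^ 2) * γ ^ 2 * σc ^ 2 := by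
    rw [hw, e2]; gcongr
  have h2 : n0 / n ≤ n0 := div_le_self hn00 hn
  have h3 : 2 * (L / μ) * (2 / δ) * (6 * w + n0 / n) ≤ 2 * (L / μ) * τ
      * (6 * (6 * α ^ 2 * σg ^ 2 + (2 + 5 / 2 * α ^ 2 * τ ^ 2) * γ ^ 2 * σc ^ 2) + n0) := by
    gcongr
  have e4 : 2 * (L / μ) * τ
      * (6 * (6 * α ^ 2 * σg ^ 2 + (2 + 5 / 2 * α ^ 2 * τ ^ 2) * γ ^ 2 * σc ^ 2) + n0)
      = 74 * (L / μ * α ^ 2 * σg ^ 2) * τ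
        + (26 + 30 * (α ^ 2 * τ ^ 2)) * (L / μ * τ * γ ^ 2 * σc ^ 2) := by rw [hn0']; ring
  have h5 : 74 * (L / μ * α ^ 2 * σg ^ 2) * τ
      ≤ 101920 * L * (τ + 1) * n * α ^ 2 / μ * (σg ^ 2 / n) := by
    have e : 101920 * L * (τ + 1) * n * α ^ 2 / μ * (σg ^ 2 / n)
        = 101920 * (L / μ * α ^ 2 * σg ^ 2) * (τ + 1) := by field_simp
    rw [e]
    have : 0 ≤ L / μ * α ^ 2 * σg ^ 2 := by positivity
    gcongr
    · norm_num
    · linarith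
  have h6 : (26 + 30 * (α ^ 2 * τ ^ 2)) * (L / μ * τ * γ ^ 2 * σc ^ 2)
      ≤ 33280 * (2 + α ^ 2 * (τ ^ 2 + 1 / 2) + α ^ 2 * T) * L / μ * n * τ * γ ^ 2
        * (σc ^ 2 / n) := by
    have e : 33280 * (2 + α ^ 2 * (τ ^ 2 + 1 / 2) + α ^ 2 * T) * L / μ * n * τ * γ ^ 2
        * (σc ^ 2 / n) = 33280 * (2 + α ^ 2 * (τ ^ 2 + 1 / 2) + α ^ 2 * T)
          * (L / μ * τ * γ ^ 2 * σc ^ 2) := by field_simp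
    rw [e]
    have h7 : 0 ≤ α ^ 2 * T := by positivity
    have h8 : 0 ≤ α ^ 2 * τ ^ 2 := by positivity
    have h9 : 0 ≤ α ^ 2 := sq_nonneg _
    gcongr
    linarith
  rw [e1]
  linarith

section Bound

variable {n d : ℕ} {Ω : Type u} {mΩ : MeasurableSpace Ω} {P : Measure Ω}
  {hn : 2 ≤ n} {Q : Matrix (Fin n) (Fin n) ℝ} {α γ L μ σg σc : ℝ}
  {f : Fin n → Vec d → ℝ} {ℋ : ℕ → MeasurableSpace Ω} {X Y G E : ℕ → Ω → Stack n d} {xs : Vec d}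

theorem IsNoisyRun.error_bound [IsProbabilityMeasure P]
    (h : IsNoisyRun P Q α γ f ℋ X Y G E σg σc) (hQ : IsMixing hn Q)
    (hf : IsRegular f L μ) (hxs : IsOptimal f xs) (hL : 0 < L) (hμ : 0 < μ) (hμL : μ ≤ L)
    (hα : 0 < α) (hγ : 0 < γ) (hγ1 : γ < 1 / 4) {τ : ℕ} (hτ : τ = tau γ (lam2 hQ))
    (hατ : α ≤ 1 / (161280 * τ * L)) {ψ : ℝ}
    (hψ : ∫ ω, sqNorm (dev (X 0 ω)) ∂P + ∫ ω, sqNorm (α • dev (Y 0 ω)) ∂P ≤ ψ) (T : ℕ) :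
    ∫ ω, ‖avg (X T ω) - xs‖ ^ 2 ∂P ≤
      (1 - α * μ / 4) ^ T * (∫ ω, ‖avg (X 0 ω) - xs‖ ^ 2 ∂P +
        800 * (1 + (τ : ℝ) ^ 2) * L / (n * (1 - α * μ / 4) * μ) * ψ)
      + (4 * α / μ + 101920 * L * (τ + 1) * n * α ^ 2 / μ) * (σg ^ 2 / n)
      + (4 * (1 + 2 * μ⁻¹ * T * α) / μ * (γ ^ 2 / α)
          + 33280 * (2 + α ^ 2 * ((τ : ℝ) ^ 2 + 1 / 2) + α ^ 2 * T) * L / μ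
            * n * τ * γ ^ 2) * (σc ^ 2 / n) := by
  have hn0 : 0 < n := by omega
  have hn1 : (1 : ℝ) ≤ n := by exact_mod_cast hn0
  have hn' : (0 : ℝ) < n := by linarith
  have hl1 : lam2 hQ < 1 := hQ.eig_second
  have hl2 : -1 < lam2 hQ := hQ.eig_all _
  set δ := γ * (1 - lam2 hQ) with hδ
  have hδ0 : 0 < δ := mul_pos hγ (by linarith)
  have hδ1 : δ ≤ 1 := by rw [hδ]; nlinarith
  have h2τ : 2 / δ ≤ (τ : ℝ) := by rw [hτ]; exact two_div_le_tau hδ0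
  have hτ0 : (0 : ℝ) < τ := lt_of_lt_of_le (by positivity) h2τ
  set η := α * L / δ with hηdef
  have hη : α * L = η * δ := by rw [hηdef]; field_simp
  have hη0 : 0 < η := by positivity
  have hαLτ : α * L * τ ≤ 1 / 161280 := by
    rw [le_div_iff₀ (by positivity)] at hατ ⊢
    linarith
  -- Here τ ≥ 2/δ gives η ≤ αLτ/2 ≤ 1/322560.
  have hη1 : η ≤ 1 / 300000 := by
    have h1 : η = α * L * (2 / δ) / 2 := by rw [hηdef]; field_simp
    have h2 : α * L * (2 / δ) ≤ α * L * τ := by gcongr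
    rw [h1]
    linarith
  have hαμ : α * μ ≤ 1 / 300000 := by
    have h1 : α * μ ≤ α * L := by gcongr
    rw [hη] at h1
    exact h1.trans ((mul_le_of_le_one_right hη0.le hδ1).trans hη1)
  have hq : 0 < α * μ / 4 := by positivity
  have hq1 : 0 < 1 - α * μ / 4 := by linarith
  have hrec := le_of_linear_recursion (φ := fun k => ∫ ω, ‖avg (X k ω) - xs‖ ^ 2 ∂P
      + ∫ ω, potential Q α γ δ η f (X · ω) (Y · ω) (G · ω) (E · ω) k ∂P) hq (by linarith)
    (by positivity) (by positivity)
    (h.expected_potential_step hQ hf hxs hL hμ hμL hα hγ hγ1 hδ hδ0 hδ1 hη hη1) T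
  have hpot : 0 ≤ ∫ ω, potential Q α γ δ η f (X · ω) (Y · ω) (G · ω) (E · ω) T ∂P :=
    integral_nonneg fun ω => add_nonneg (mul_nonneg (by positivity) (lyap_nonneg _ _))
      (by positivity)
  have hsteady := steady_state_le (σg := σg) (σc := σc) (γ := γ) hα hL hμ hδ0 hn1
    (Nat.cast_nonneg T) h2τ
  have ha0 : 0 ≤ ∫ ω, sqNorm (dev (X 0 ω)) ∂P :=
    integral_nonneg fun ω => Finset.sum_nonneg fun i _ => sq_nonneg _
  have hb0 : 0 ≤ ∫ ω, sqNorm (α • dev (Y 0 ω)) ∂P :=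
    integral_nonneg fun ω => Finset.sum_nonneg fun i _ => sq_nonneg _
  have hinit : ∫ ω, potential Q α γ δ η f (X · ω) (Y · ω) (G · ω) (E · ω) 0 ∂P
      ≤ 800 * (1 + (τ : ℝ) ^ 2) * L / (n * (1 - α * μ / 4) * μ) * ψ := by
    have h1 := h.integral_lyap_driftState_zero_le hn0 hf hδ0
    have h2 : ∫ ω, potential Q α γ δ η f (X · ω) (Y · ω) (G · ω) (E · ω) 0 ∂P
        = 16 * η / n * ∫ ω, lyap δ (driftState Q α γ δ f (X · ω) (Y · ω) (G · ω) (E · ω) 0) ∂P := by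
      rw [← integral_const_mul]
      congr 1
      ext ω
      simp [potential, driftLag, relaxSum]
    rw [h2]
    have h3 : 1 + 20 * (α * L / δ) ^ 2 ≤ 20 * (1 + (τ : ℝ) ^ 2) := by
      rw [← hηdef]
      have h4 : η ^ 2 ≤ (1 / 300000) ^ 2 := by gcongr
      linarith [sq_nonneg (τ : ℝ)]
    have h4 : 20 / δ ^ 2 ≤ 20 * (1 + (τ : ℝ) ^ 2) := by
      have e : 20 / δ ^ 2 = 5 * (2 / δ) ^ 2 := by field_simp; norm_num
      have h5 : (2 / δ) ^ 2 ≤ (τ : ℝ) ^ 2 := by gcongr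
      rw [e]
      linarith [sq_nonneg (τ : ℝ)]
    have h5 : ∫ ω, lyap δ (driftState Q α γ δ f (X · ω) (Y · ω) (G · ω) (E · ω) 0) ∂P
        ≤ 20 * (1 + (τ : ℝ) ^ 2) * ψ := by
      refine h1.trans ?_
      have h6 := mul_le_mul_of_nonneg_right h3 ha0
      have h7 := mul_le_mul_of_nonneg_right h4 hb0
      have h8 := mul_le_mul_of_nonneg_left hψ
        (by positivity : 0 ≤ 20 * (1 + (τ : ℝ) ^ 2))
      linarith
    have hψ0 : 0 ≤ ψ := by linarith
    -- The stated initial term is larger than what is proved: a factor at least 1 is inserted to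
    -- reach its form.
    have h6 : 1 ≤ L / ((1 - α * μ / 4) * μ) := by
      rw [one_le_div (by positivity)]
      refine le_trans ?_ hμL
      exact mul_le_of_le_one_left hμ.le (by linarith)
    calc 16 * η / n * ∫ ω, lyap δ (driftState Q α γ δ f (X · ω) (Y · ω) (G · ω) (E · ω) 0) ∂P
        ≤ 16 * η / n * (20 * (1 + (τ : ℝ) ^ 2) * ψ) := by gcongr
      _ = 320 * η * ((1 + (τ : ℝ) ^ 2) / n * ψ) := by ring
      _ ≤ 800 * ((1 + (τ : ℝ) ^ 2) / n * ψ) := by gcongr; linarith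
      _ ≤ 800 * ((1 + (τ : ℝ) ^ 2) / n * ψ) * (L / ((1 - α * μ / 4) * μ)) :=
        le_mul_of_one_le_right (by positivity) h6
      _ = _ := by field_simp
  have hmul := mul_le_mul_of_nonneg_left hinit (by positivity : 0 ≤ (1 - α * μ / 4) ^ T)
  linarith

end Bound

end ICGT

namespace ICGT

/-! ### Runs of IC-GT -/

section Random

variable {n d : ℕ} {Ω : Type u} {S : Fin n → Type v} [mΩ : MeasurableSpace Ω] {P : Measure Ω}
  [mS : ∀ i, MeasurableSpace (S i)] {Q : Matrix (Fin n) (Fin n) ℝ} {α γ L μ σg σc : ℝ}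
  {f : Fin n → Vec d → ℝ} {F : (i : Fin n) → Vec d → S i → ℝ} {x0 : Ω → Stack n d}
  {ξ : ℕ → (i : Fin n) → Ω → S i} {ε : ℕ → Fin n → Ω → Vec d}

theorem history_mono : Monotone (history x0 ξ ε) := by
  intro k l hkl
  refine sup_le_sup le_rfl ?_
  exact iSup_mono fun j => iSup_mono' fun hj => ⟨hj.trans_le hkl, le_rfl⟩

theorem comap_init_le_history (k : ℕ) :
    MeasurableSpace.comap x0 inferInstance ≤ history x0 ξ ε k := le_sup_left

theorem comap_noise_le_history (k : ℕ) (i : Fin n) :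
    MeasurableSpace.comap (ξ k i) inferInstance ⊔ MeasurableSpace.comap (ε k i) inferInstance
      ≤ history x0 ξ ε (k + 1) := by
  refine le_trans ?_ le_sup_right
  refine le_trans ?_ (le_iSup _ k)
  refine le_trans ?_ (le_iSup _ k.lt_succ_self)
  exact le_iSup (fun i => MeasurableSpace.comap (ξ k i) inferInstance
    ⊔ MeasurableSpace.comap (ε k i) inferInstance) i

theorem measurable_stack_iff {m : MeasurableSpace Ω} {z : Ω → Stack n d} :
    Measurable z ↔ ∀ i, Measurable fun ω => z ω i :=
  measurable_pi_iff

theorem measurable_mix {m : MeasurableSpace Ω} {z e : Ω → Stack n d} (hz : Measurable z)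
    (he : Measurable e) : Measurable fun ω => mix Q γ (z ω) (e ω) := by
  unfold mix
  fun_prop

theorem xIter_succ (k : ℕ) (ω : Ω) : xIter Q α γ F x0 ξ ε (k + 1) ω
    = mix Q γ (xIter Q α γ F x0 ξ ε k ω) (fun i => ε k i ω) - α • yIter Q α γ F x0 ξ ε k ω :=
  rfl

theorem yIter_succ (k : ℕ) (ω : Ω) : yIter Q α γ F x0 ξ ε (k + 1) ω
    = mix Q γ (yIter Q α γ F x0 ξ ε k ω) (fun i => ε k i ω)
      + (fun i => sampleGrad F i (xIter Q α γ F x0 ξ ε (k + 1) ω i) (ξ (k + 1) i ω))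
      - fun i => sampleGrad F i (xIter Q α γ F x0 ξ ε k ω i) (ξ k i ω) :=
  rfl

namespace IsRun

theorem history_le (h : IsRun P Q α γ f F x0 ξ ε σg σc) (k : ℕ) : history x0 ξ ε k ≤ mΩ := by
  refine sup_le h.meas_init.comap_le ?_
  exact iSup_le fun j => iSup_le fun _ => iSup_le fun i =>
    sup_le (h.meas_xi j i).comap_le (h.meas_eps j i).comap_le

theorem measurable_eps (k : ℕ) (i : Fin n) : Measurable[history x0 ξ ε (k + 1)] (ε k i) :=
  Measurable.of_comap_le (le_sup_right.trans (comap_noise_le_history k i))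

theorem measurable_xi (k : ℕ) (i : Fin n) : Measurable[history x0 ξ ε (k + 1)] (ξ k i) :=
  Measurable.of_comap_le (le_sup_left.trans (comap_noise_le_history k i))

theorem measurable_sample (h : IsRun P Q α γ f F x0 ξ ε σg σc) {k : ℕ} (i : Fin n)
    (hx : Measurable[history x0 ξ ε k] (xIter Q α γ F x0 ξ ε k)) :
    Measurable[history x0 ξ ε (k + 1)]
      fun ω => sampleGrad F i (xIter Q α γ F x0 ξ ε k ω i) (ξ k i ω) := by
  have h1 : Measurable[history x0 ξ ε (k + 1)] fun ω => xIter Q α γ F x0 ξ ε k ω i :=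
    (measurable_stack_iff.1 hx i).mono (history_mono k.le_succ) le_rfl
  exact (h.meas_sample i).comp (h1.prodMk (measurable_xi k i))

/-- The tracker lags by one round, since it already uses the sample drawn in round k. -/
theorem measurable_iter (h : IsRun P Q α γ f F x0 ξ ε σg σc) (k : ℕ) :
    Measurable[history x0 ξ ε k] (xIter Q α γ F x0 ξ ε k) ∧
    Measurable[history x0 ξ ε (k + 1)] (yIter Q α γ F x0 ξ ε k) := by
  induction k with
  | zero =>
    have h0 : Measurable[history x0 ξ ε 0] (xIter Q α γ F x0 ξ ε 0) :=
      Measurable.of_comap_le (comap_init_le_history 0)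
    exact ⟨h0, measurable_stack_iff.2 fun i => h.measurable_sample i h0⟩
  | succ k ih =>
    obtain ⟨hx, hy⟩ := ih
    have he : Measurable[history x0 ξ ε (k + 1)] fun ω i => ε k i ω :=
      measurable_stack_iff.2 fun i => measurable_eps k i
    have hx' := hx.mono (history_mono k.le_succ) le_rfl
    have hxs : Measurable[history x0 ξ ε (k + 1)] (xIter Q α γ F x0 ξ ε (k + 1)) :=
      (measurable_mix hx' he).sub (hy.const_smul α)
    refine ⟨hxs, ?_⟩
    have hm : history x0 ξ ε (k + 1) ≤ history x0 ξ ε (k + 2) := history_mono (Nat.le_succ _)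
    have hs1 : Measurable[history x0 ξ ε (k + 2)]
        fun ω i => sampleGrad F i (xIter Q α γ F x0 ξ ε (k + 1) ω i) (ξ (k + 1) i ω) :=
      measurable_stack_iff.2 fun i => h.measurable_sample i hxs
    have hs0 : Measurable[history x0 ξ ε (k + 1)]
        fun ω i => sampleGrad F i (xIter Q α γ F x0 ξ ε k ω i) (ξ k i ω) :=
      measurable_stack_iff.2 fun i => h.measurable_sample i hx
    exact (((measurable_mix hy he).mono hm le_rfl).add hs1).sub (hs0.mono hm le_rfl)

variable [IsProbabilityMeasure P]

theorem adapted_sample (h : IsRun P Q α γ f F x0 ξ ε σg σc) (hf : IsRegular f L μ) {k : ℕ}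
    (hx : ∀ i, IsAdapted P (history x0 ξ ε k) fun ω => xIter Q α γ F x0 ξ ε k ω i) (i : Fin n) :
    IsAdapted P (history x0 ξ ε (k + 1))
      fun ω => sampleGrad F i (xIter Q α γ F x0 ξ ε k ω i) (ξ k i ω) := by
  have h1 := (hx i).gradient_comp (h.history_le k) hf i
  have h2 : (fun ω => sampleGrad F i (xIter Q α γ F x0 ξ ε k ω i) (ξ k i ω))
      = fun ω => gradNoise Q α γ f F x0 ξ ε k i ω
        + gradient (f i) (xIter Q α γ F x0 ξ ε k ω i) := by
    ext1 ω; simp [gradNoise]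
  refine ⟨(h.measurable_sample i (h.measurable_iter k).1).stronglyMeasurable, ?_⟩
  rw [h2]
  exact (h.grad_sq k i).add h1.memLp

theorem memLp_mix {z e : Ω → Stack n d} (hz : ∀ i, MemLp (fun ω => z ω i) 2 P)
    (he : ∀ i, MemLp (fun ω => e ω i) 2 P) (i : Fin n) :
    MemLp (fun ω => mix Q γ (z ω) (e ω) i) 2 P := by
  have h1 : MemLp (fun ω => (1 - γ) • z ω i) 2 P := (hz i).const_smul (1 - γ)
  have h2 : MemLp (fun ω => (γ * Q i i) • z ω i) 2 P := (hz i).const_smul (γ * Q i i)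
  have h3 : MemLp (fun ω => ∑ j ∈ neighbors Q i, Q i j • (z ω j + e ω j)) 2 P :=
    memLp_finsetSum _ fun j _ => ((hz j).add (he j)).const_smul (Q i j)
  have h4 : MemLp (fun ω => γ • ∑ j ∈ neighbors Q i, Q i j • (z ω j + e ω j)) 2 P :=
    h3.const_smul γ
  exact (h1.add h2).add h4
theorem adapted_iter (h : IsRun P Q α γ f F x0 ξ ε σg σc) (hf : IsRegular f L μ) (k : ℕ) :
    (∀ i, IsAdapted P (history x0 ξ ε k) fun ω => xIter Q α γ F x0 ξ ε k ω i) ∧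
    (∀ i, MemLp (fun ω => yIter Q α γ F x0 ξ ε k ω i) 2 P) := by
  induction k with
  | zero =>
    have h0 : ∀ i, IsAdapted P (history x0 ξ ε 0) fun ω => xIter Q α γ F x0 ξ ε 0 ω i :=
      fun i => ⟨(measurable_stack_iff.1 (h.measurable_iter 0).1 i).stronglyMeasurable, h.sq_init i⟩
    exact ⟨h0, fun i => (h.adapted_sample hf h0 i).memLp⟩
  | succ k ih =>
    obtain ⟨hx, hy⟩ := ih
    have hxs : ∀ i, IsAdapted P (history x0 ξ ε (k + 1))
        fun ω => xIter Q α γ F x0 ξ ε (k + 1) ω i := fun i =>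
      ⟨(measurable_stack_iff.1 (h.measurable_iter (k + 1)).1 i).stronglyMeasurable,
        (memLp_mix (fun i => (hx i).memLp) (h.comm_sq k) i).sub ((hy i).const_smul α)⟩
    exact ⟨hxs, fun i => ((memLp_mix hy (h.comm_sq k) i).add
      (h.adapted_sample hf hxs i).memLp).sub (h.adapted_sample hf hx i).memLp⟩

theorem isNoisyRun (h : IsRun P Q α γ f F x0 ξ ε σg σc) (hf : IsRegular f L μ) :
    IsNoisyRun P Q α γ f (history x0 ξ ε) (xIter Q α γ F x0 ξ ε) (yIter Q α γ F x0 ξ ε)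
      (fun k ω i => gradNoise Q α γ f F x0 ξ ε k i ω) (fun k ω i => ε k i ω) σg σc where
  le := h.history_le
  mono := history_mono
  path ω :=
    { x_succ := fun k => xIter_succ k ω
      y_zero := by
        ext1 i
        simp only [gradNoise, grads, Pi.add_apply, add_sub_cancel]
        rfl
      y_succ := fun k => by
        rw [yIter_succ]
        congr 1
        · congr 1
          ext1 i
          simp [gradNoise, grads]
        · ext1 i
          simp [gradNoise, grads] }
  adapted_x k := (h.adapted_iter hf k).1
  adapted_g k i := (h.adapted_sample hf (h.adapted_iter hf k).1 i).sub
    ((((h.adapted_iter hf k).1 i).gradient_comp (h.history_le k) hf i).mono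
      (history_mono k.le_succ))
  adapted_e k i := ⟨(measurable_eps k i).stronglyMeasurable, h.comm_sq k i⟩
  ortho_g k i := by
    refine IsOrtho.of_condExp (h.history_le k) (h.grad_sq k i) ?_
    have h1 := (h.adapted_sample hf (h.adapted_iter hf k).1 i).memLp.integrable one_le_two
    have h2 := ((h.adapted_iter hf k).1 i).gradient_comp (h.history_le k) hf i
    have h3 := condExp_sub h1 (h2.memLp.integrable one_le_two) (history x0 ξ ε k)
    have h4 := condExp_of_stronglyMeasurable (h.history_le k) h2.meas
      (h2.memLp.integrable one_le_two)
    refine h3.trans ?_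
    rw [h4]
    filter_upwards [h.grad_mean k i] with ω hω
    rw [Pi.sub_apply, hω, sub_self]
    rfl
  ortho_e k i := IsOrtho.of_condExp (h.history_le k) (h.comm_sq k i) (h.comm_mean k i)
  var_g := h.grad_var
  var_e := h.comm_var
  uncorr_g := h.grad_uncorr
  uncorr_e := h.comm_uncorr
  uncorr_ge := h.cross_uncorr

theorem integrable_errSq (h : IsRun P Q α γ f F x0 ξ ε σg σc) (hf : IsRegular f L μ) (xs : Vec d)
    (T : ℕ) : Integrable (errSq Q α γ F x0 ξ ε xs T) P :=
  ((h.isNoisyRun hf).adapted_err xs T).memLp.integrable_norm_pow two_ne_zero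

theorem integrable_sqNorm_dev {z : Ω → Stack n d} (hz : ∀ i, MemLp (fun ω => z ω i) 2 P) :
    Integrable (fun ω => sqNorm (dev (z ω))) P := by
  simp only [← norm_toLp_sq, ← matL_devMat_toLp]
  have h1 : MemLp (fun ω => (WithLp.toLp 2 (z ω) : StackL2 n d)) 2 P := memLp_piLp_iff.2 hz
  exact ((matL (devMat n)).comp_memLp' h1).integrable_norm_pow two_ne_zero

theorem sqNorm_smul (c : ℝ) (z : Stack n d) : sqNorm (c • z) = c ^ 2 * sqNorm z := by
  simp [sqNorm, norm_smul, mul_pow, Finset.mul_sum]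

theorem integrable_psiSq (h : IsRun P Q α γ f F x0 ξ ε σg σc) (hf : IsRegular f L μ) :
    Integrable (psiSq Q α γ F x0 ξ ε 0) P := by
  obtain ⟨hx, hy⟩ := h.adapted_iter hf 0
  have h1 := integrable_sqNorm_dev fun i => (hx i).memLp
  have h2 := integrable_sqNorm_dev hy
  have h3 := integrable_sqNorm_dev (z := vIter Q α γ F x0 ξ ε 0)
    (memLp_mix (fun i => (hx i).memLp) (h.comm_sq 0))
  have h4 := (h3.add h1).add (h2.const_mul (α ^ 2))
  simp only [← sqNorm_smul] at h4
  exact h4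

theorem integral_le_psiSq (h : IsRun P Q α γ f F x0 ξ ε σg σc) (hf : IsRegular f L μ) :
    ∫ ω, sqNorm (dev (xIter Q α γ F x0 ξ ε 0 ω)) ∂P
      + ∫ ω, sqNorm (α • dev (yIter Q α γ F x0 ξ ε 0 ω)) ∂P
      ≤ ∫ ω, psiSq Q α γ F x0 ξ ε 0 ω ∂P := by
  obtain ⟨hx, hy⟩ := h.adapted_iter hf 0
  have h1 := integrable_sqNorm_dev fun i => (hx i).memLp
  have h2 := (integrable_sqNorm_dev hy).const_mul (α ^ 2)
  simp only [← sqNorm_smul] at h2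
  rw [← integral_add h1 h2]
  refine integral_mono (h1.add h2) (h.integrable_psiSq hf) fun ω => ?_
  have h3 : 0 ≤ sqNorm (dev (vIter Q α γ F x0 ξ ε 0 ω)) :=
    Finset.sum_nonneg fun i _ => sq_nonneg _
  simp only [psiSq]
  linarith

/-- The error bound of IC-GT. -/
theorem error_bound {hn : 2 ≤ n} {xs : Vec d} (h : IsRun P Q α γ f F x0 ξ ε σg σc)
    (hQ : IsMixing hn Q) (hf : IsRegular f L μ) (hxs : IsOptimal f xs) (hL : 0 < L) (hμ : 0 < μ)
    (hα : 0 < α) (hγ : 0 < γ) (hγ1 : γ < 1 / 4) {τ : ℕ} (hτ : τ = tau γ (lam2 hQ))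
    (hατ : α ≤ 1 / (161280 * τ * L)) (T : ℕ) :
    ∫ ω, errSq Q α γ F x0 ξ ε xs T ω ∂P ≤
      (1 - α * μ / 4) ^ T *
        (∫ ω, errSq Q α γ F x0 ξ ε xs 0 ω ∂P +
          800 * (1 + (τ : ℝ) ^ 2) * L / (n * (1 - α * μ / 4) * μ) *
            ∫ ω, psiSq Q α γ F x0 ξ ε 0 ω ∂P)
      + (4 * α / μ + 101920 * L * (τ + 1) * n * α ^ 2 / μ) * (σg ^ 2 / n)
      + (4 * (1 + 2 * μ⁻¹ * T * α) / μ * (γ ^ 2 / α)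
          + 33280 * (2 + α ^ 2 * ((τ : ℝ) ^ 2 + 1 / 2) + α ^ 2 * T) * L / μ
            * n * τ * γ ^ 2) * (σc ^ 2 / n) := by
  rcases subsingleton_or_nontrivial (Vec d) with hs | hs
  -- In dimension zero μ ≤ L may fail, but all errors vanish and the right side is nonnegative.
  · have h0 : ∀ v : Vec d, v = 0 := fun v => Subsingleton.elim v 0
    have h1 : ∀ k ω, errSq Q α γ F x0 ξ ε xs k ω = 0 := fun k ω => by
      simp [errSq, h0 (avg _ - xs)]
    have h2 : ∀ ω, psiSq Q α γ F x0 ξ ε 0 ω = 0 := fun ω => by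
      have h3 : ∀ z : Stack n d, sqNorm z = 0 := fun z => by simp [sqNorm, h0]
      simp [psiSq, h3]
    simp only [h1, h2, integral_zero, mul_zero, add_zero, zero_add]
    positivity
  · have hμL : μ ≤ L :=
      strong_le_lipschitz (hf.diff ⟨0, by omega⟩) (hf.smooth ⟨0, by omega⟩)
        (hf.strong ⟨0, by omega⟩)
    exact (h.isNoisyRun hf).error_bound hQ hf hxs hL hμ hμL hα hγ hγ1 hτ hατ
      (h.integral_le_psiSq hf) T

end IsRun

end Random

end ICGT

namespace ICGT

/-! ### Iteration complexity -/

/-- With γ = e⁻ᵗ/t⁵ the factor 2/δ is of order t⁵eᵗ and its logarithm is at most linear in t, which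
gives the sixth power. -/
theorem tau_le_of_le_one {l2 : ℝ} (h1 : l2 < 1) (h2 : -1 < l2) :
    ∃ K : ℝ, 0 < K ∧ ∀ t : ℝ, 1 ≤ t →
      (tau (Real.exp (-t) / t ^ 5) l2 : ℝ) ≤ K * t ^ 6 / Real.exp (-t) := by
  have hl : 0 < 1 - l2 := by linarith
  set c := |Real.log (2 / (1 - l2))| with hc
  have hc0 : 0 ≤ c := abs_nonneg _
  refine ⟨2 / (1 - l2) * (4 * c + 41) + 1, by positivity, fun t ht => ?_⟩
  have ht0 : 0 < t := by linarith
  set a := Real.exp (-t) with ha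
  have ha0 : 0 < a := Real.exp_pos _
  have ha1 : a ≤ 1 := Real.exp_le_one_iff.2 (by linarith)
  have hpow : ∀ k : ℕ, 1 ≤ t ^ k := fun k => one_le_pow₀ ht
  have hδ0 : 0 < a / t ^ 5 * (1 - l2) := by positivity
  have hδ1 : a / t ^ 5 * (1 - l2) ≤ 2 := by
    have : a / t ^ 5 ≤ 1 := (div_le_self ha0.le (hpow 5)).trans ha1
    calc a / t ^ 5 * (1 - l2) ≤ 1 * (1 - l2) := by gcongr
      _ ≤ 2 := by linarith
  have hlog : Real.log (2 / (a / t ^ 5 * (1 - l2))) ≤ (c + 6) * t := by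
    have e : 2 / (a / t ^ 5 * (1 - l2)) = 2 / (1 - l2) * t ^ 5 / a := by field_simp
    rw [e, Real.log_div (by positivity) ha0.ne', Real.log_mul (by positivity) (by positivity),
      Real.log_pow, ha, Real.log_exp]
    have h3 : Real.log (2 / (1 - l2)) ≤ c := le_abs_self _
    have h4 : Real.log t ≤ t := (Real.log_le_sub_one_of_pos ht0).trans (by linarith)
    have h5 : c ≤ c * t := le_mul_of_one_le_right hc0 ht
    push_cast
    linarith
  have hmax : max (4 * Real.log (2 / (a / t ^ 5 * (1 - l2))))
      (a / t ^ 5 * (1 - l2) + Real.log 16) ≤ (4 * c + 41) * t := by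
    have h3 : 0 ≤ c * t := by positivity
    have h4 : Real.log 16 ≤ 15 :=
      (Real.log_le_sub_one_of_pos (by norm_num)).trans (by norm_num)
    exact max_le (by linarith) (by linarith)
  have h6 : (tau (a / t ^ 5) l2 : ℝ) ≤ 2 / (a / t ^ 5 * (1 - l2)) * ((4 * c + 41) * t) + 1 := by
    have h7 : 2 / (a / t ^ 5 * (1 - l2)) * max (4 * Real.log (2 / (a / t ^ 5 * (1 - l2))))
        (a / t ^ 5 * (1 - l2) + Real.log 16) ≤ 2 / (a / t ^ 5 * (1 - l2)) * ((4 * c + 41) * t) := by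
      gcongr
    have h8 : 0 ≤ 2 / (a / t ^ 5 * (1 - l2)) * max (4 * Real.log (2 / (a / t ^ 5 * (1 - l2))))
        (a / t ^ 5 * (1 - l2) + Real.log 16) := by
      refine mul_nonneg (by positivity) (le_trans ?_ (le_max_right _ _))
      linarith [one_le_log_sixteen]
    have h9 := (Nat.ceil_lt_add_one h8).le
    exact h9.trans (by linarith)
  refine h6.trans ?_
  have e : 2 / (a / t ^ 5 * (1 - l2)) * ((4 * c + 41) * t)
      = 2 / (1 - l2) * (4 * c + 41) * t ^ 6 / a := by field_simp
  have h7 : 1 ≤ t ^ 6 / a := by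
    rw [one_le_div ha0]
    exact ha1.trans (hpow 6)
  rw [e]
  calc _ ≤ 2 / (1 - l2) * (4 * c + 41) * t ^ 6 / a + t ^ 6 / a := by linarith
    _ = _ := by ring

/-- The exponents 7, 5 and 9 are chosen so that, up to constants, α, γ²/α, Tγ² and τγ² are at most
a/t, while ατ and α²T stay bounded. Every noise term thus gains 1/t over the target a, which later
absorbs the constants. -/
theorem error_bound_le_exp {K μ L n σg σc R t τ T a α γ : ℝ} (hK : 0 < K) (hμ : 0 < μ) (hL : 0 < L)
    (hn : 1 ≤ n) (hR : 0 ≤ R) (ht : 1 ≤ t) (ha : a = Real.exp (-t))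
    (hα : α = a / t ^ 7) (hγ : γ = a / t ^ 5) (hτ0 : 0 ≤ τ) (hτ : τ ≤ K * t ^ 6 / a)
    (hT : T ≤ 2 * t ^ 9 / a) {E : ℝ} (hE : E ≤ Real.exp (-(4 * t)))
    (htμ : 2 * μ ≤ t) :
    E * (R + 800 * (1 + τ ^ 2) * L / (n * (1 - α * μ / 4) * μ) * R)
      + (4 * α / μ + 101920 * L * (τ + 1) * n * α ^ 2 / μ) * (σg ^ 2 / n)
      + (4 * (1 + 2 * μ⁻¹ * T * α) / μ * (γ ^ 2 / α)
          + 33280 * (2 + α ^ 2 * (τ ^ 2 + 1 / 2) + α ^ 2 * T) * L / μ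
            * n * τ * γ ^ 2) * (σc ^ 2 / n)
      ≤ a * (R * (1 + 1600 * L / μ * (1 + K ^ 2)) * (t ^ 12 * Real.exp (-t))
        + ((4 / μ + 101920 * (K + 1) * L / μ) * σg ^ 2
          + (4 / μ + 16 / μ ^ 2 + 33280 * (5 + K ^ 2) * (L / μ) * K) * σc ^ 2) / t) := by
  have ht0 : 0 < t := by linarith
  have hn0 : 0 < n := by linarith
  have ha0 : 0 < a := ha ▸ Real.exp_pos _
  have ha1 : a ≤ 1 := ha ▸ Real.exp_le_one_iff.2 (by linarith)
  have hpow : ∀ k : ℕ, 1 ≤ t ^ k := fun k => one_le_pow₀ ht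
  have hα0 : 0 < α := by rw [hα]; positivity
  have hγ0 : 0 < γ := by rw [hγ]; positivity
  have hαt : α ≤ a / t := by
    rw [hα]
    exact div_le_div_of_nonneg_left ha0.le ht0 (le_self_pow₀ ht (by norm_num))
  have hαt1 : α ≤ 1 / t := hαt.trans (by gcongr)
  have hα1 : α ≤ 1 := hαt1.trans (by rw [div_le_one ht0]; exact ht)
  have hατ : α * τ ≤ K / t := by
    calc α * τ ≤ a / t ^ 7 * (K * t ^ 6 / a) := by rw [hα]; gcongr
      _ = K / t := by field_simp
  have hατK : α * τ ≤ K := hατ.trans (div_le_self hK.le ht)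
  have hαμ : 1 / 2 ≤ 1 - α * μ / 4 := by
    have : α * μ ≤ 1 / t * μ := by gcongr
    have h2 : 1 / t * μ ≤ 1 / 2 := by
      rw [one_div, inv_mul_le_iff₀ ht0]; linarith
    linarith
  have p1 : E * (R + 800 * (1 + τ ^ 2) * L / (n * (1 - α * μ / 4) * μ) * R)
      ≤ a * (R * (1 + 1600 * L / μ * (1 + K ^ 2)) * (t ^ 12 * Real.exp (-t))) := by
    have h1 : 800 * (1 + τ ^ 2) * L / (n * (1 - α * μ / 4) * μ)
        ≤ 800 * (1 + (K * t ^ 6 / a) ^ 2) * L / (1 * (1 / 2) * μ) := by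
      gcongr
    have h2 : 1 ≤ t ^ 12 / a ^ 2 := by
      rw [one_le_div (by positivity)]
      exact (pow_le_one₀ ha0.le ha1).trans (hpow 12)
    have h3 : 800 * (1 + (K * t ^ 6 / a) ^ 2) * L / (1 * (1 / 2) * μ)
        = 1600 * L / μ * (1 + K ^ 2 * (t ^ 12 / a ^ 2)) := by field_simp; ring
    have h4 : 1600 * L / μ * (1 + K ^ 2 * (t ^ 12 / a ^ 2))
        ≤ 1600 * L / μ * (t ^ 12 / a ^ 2 + K ^ 2 * (t ^ 12 / a ^ 2)) := by gcongr
    have h5 : R + 800 * (1 + τ ^ 2) * L / (n * (1 - α * μ / 4) * μ) * R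
        ≤ R * (1 + 1600 * L / μ * (1 + K ^ 2)) * (t ^ 12 / a ^ 2) := by
      have h6 : R ≤ R * (t ^ 12 / a ^ 2) := le_mul_of_one_le_right hR h2
      have h7 := mul_le_mul_of_nonneg_right ((h1.trans h3.le).trans h4) hR
      linarith
    have hexp : Real.exp (-(4 * t)) = a ^ 4 := by
      rw [ha, ← Real.exp_nat_mul]; congr 1; push_cast; ring
    rw [hexp] at hE
    calc _ ≤ a ^ 4 * (R * (1 + 1600 * L / μ * (1 + K ^ 2)) * (t ^ 12 / a ^ 2)) :=
          mul_le_mul hE h5 (by positivity) (by positivity)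
      _ = _ := by rw [← ha]; field_simp
  have p2 : (4 * α / μ + 101920 * L * (τ + 1) * n * α ^ 2 / μ) * (σg ^ 2 / n)
      ≤ a * ((4 / μ + 101920 * (K + 1) * L / μ) * σg ^ 2 / t) := by
    have h1 : σg ^ 2 / n ≤ σg ^ 2 := div_le_self (sq_nonneg _) hn
    have h2 : (4 * α / μ + 101920 * L * (τ + 1) * n * α ^ 2 / μ) * (σg ^ 2 / n)
        = 4 * α / μ * (σg ^ 2 / n) + 101920 * L / μ * (α * τ + α) * α * σg ^ 2 := by
      field_simp
    rw [h2]
    calc _ ≤ 4 * (a / t) / μ * σg ^ 2 + 101920 * L / μ * (K + 1) * (a / t) * σg ^ 2 := by gcongr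
      _ = _ := by field_simp
  have p3 : (4 * (1 + 2 * μ⁻¹ * T * α) / μ * (γ ^ 2 / α)) * (σc ^ 2 / n)
      ≤ a * ((4 / μ + 16 / μ ^ 2) * σc ^ 2 / t) := by
    have h1 : σc ^ 2 / n ≤ σc ^ 2 := div_le_self (sq_nonneg _) hn
    have h2 : 4 * (1 + 2 * μ⁻¹ * T * α) / μ * (γ ^ 2 / α)
        = 4 / μ * (γ ^ 2 / α) + 8 / μ ^ 2 * (T * γ ^ 2) := by field_simp; ring
    have h3 : γ ^ 2 / α ≤ a / t := by
      have e : γ ^ 2 / α = a / t ^ 3 := by rw [hγ, hα]; field_simp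
      rw [e]
      exact div_le_div_of_nonneg_left ha0.le ht0 (le_self_pow₀ ht (by norm_num))
    have h4 : T * γ ^ 2 ≤ 2 * (a / t) := by
      calc T * γ ^ 2 ≤ 2 * t ^ 9 / a * γ ^ 2 := by gcongr
        _ = 2 * (a / t) := by rw [hγ]; field_simp
    rw [h2]
    calc _ ≤ (4 / μ * (a / t) + 8 / μ ^ 2 * (2 * (a / t))) * σc ^ 2 := by gcongr
      _ = _ := by field_simp; ring
  have p4 : (33280 * (2 + α ^ 2 * (τ ^ 2 + 1 / 2) + α ^ 2 * T) * L / μ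
            * n * τ * γ ^ 2) * (σc ^ 2 / n)
      ≤ a * ((33280 * (5 + K ^ 2) * (L / μ) * K) * σc ^ 2 / t) := by
    have e : (33280 * (2 + α ^ 2 * (τ ^ 2 + 1 / 2) + α ^ 2 * T) * L / μ
            * n * τ * γ ^ 2) * (σc ^ 2 / n)
        = 33280 * (2 + (α * τ) ^ 2 + α ^ 2 / 2 + α ^ 2 * T) * (L / μ) * (τ * γ ^ 2) * σc ^ 2 := by
      field_simp; ring
    have h1 : α ^ 2 * T ≤ 2 := by
      calc α ^ 2 * T ≤ α ^ 2 * (2 * t ^ 9 / a) := by gcongr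
        _ = 2 * (a / t ^ 5) := by rw [hα]; field_simp
        _ ≤ 2 * 1 := by
          gcongr
          exact (div_le_self ha0.le (hpow 5)).trans ha1
        _ = 2 := by norm_num
    have h2 : α ^ 2 ≤ 1 := pow_le_one₀ hα0.le hα1
    have h3 : (α * τ) ^ 2 ≤ K ^ 2 := by gcongr
    have h4 : τ * γ ^ 2 ≤ K * (a / t) := by
      calc τ * γ ^ 2 ≤ K * t ^ 6 / a * γ ^ 2 := by gcongr
        _ = K * (a / t ^ 4) := by rw [hγ]; field_simp
        _ ≤ K * (a / t) := by
          gcongr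
          exact le_self_pow₀ ht (by norm_num)
    have h5 : 2 + (α * τ) ^ 2 + α ^ 2 / 2 + α ^ 2 * T ≤ 5 + K ^ 2 := by linarith
    rw [e]
    calc _ ≤ 33280 * (5 + K ^ 2) * (L / μ) * (K * (a / t)) * σc ^ 2 := by gcongr
      _ = _ := by field_simp
  have e : a * (R * (1 + 1600 * L / μ * (1 + K ^ 2)) * (t ^ 12 * Real.exp (-t))
        + ((4 / μ + 101920 * (K + 1) * L / μ) * σg ^ 2
          + (4 / μ + 16 / μ ^ 2 + 33280 * (5 + K ^ 2) * (L / μ) * K) * σc ^ 2) / t)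
      = a * (R * (1 + 1600 * L / μ * (1 + K ^ 2)) * (t ^ 12 * Real.exp (-t)))
        + a * ((4 / μ + 101920 * (K + 1) * L / μ) * σg ^ 2 / t)
        + (a * ((4 / μ + 16 / μ ^ 2) * σc ^ 2 / t)
        + a * ((33280 * (5 + K ^ 2) * (L / μ) * K) * σc ^ 2 / t)) := by ring
  rw [e, add_mul _ _ (σc ^ 2 / n)]
  linarith

/-- For every sufficiently large `t` there are admissible parameters for which the error bound
drops below `exp (-t)` within `2 t⁹ exp t` iterations. -/
theorem exists_threshold {n : ℕ} (hn : 2 ≤ n) {l2 μ L : ℝ} (σg σc R : ℝ) (h1 : l2 < 1)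
    (h2 : -1 < l2) (hμ : 0 < μ) (hL : 0 < L) (hR : 0 ≤ R) :
    ∃ t0 : ℝ, 1 ≤ t0 ∧ ∀ t : ℝ, t0 ≤ t → ∃ (α γ : ℝ) (T : ℕ), 0 < α ∧ 0 < γ ∧ γ < 1 / 4 ∧
      α ≤ min 1 (1 / (161280 * tau γ l2 * L)) ∧ (T : ℝ) ≤ 2 * t ^ 9 * Real.exp t ∧
      0 ≤ 1 - α * μ / 4 ∧
      (1 - α * μ / 4) ^ T *
        (R + 800 * (1 + (tau γ l2 : ℝ) ^ 2) * L / (n * (1 - α * μ / 4) * μ) * R)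
      + (4 * α / μ + 101920 * L * (tau γ l2 + 1) * n * α ^ 2 / μ) * (σg ^ 2 / n)
      + (4 * (1 + 2 * μ⁻¹ * T * α) / μ * (γ ^ 2 / α)
          + 33280 * (2 + α ^ 2 * ((tau γ l2 : ℝ) ^ 2 + 1 / 2) + α ^ 2 * T) * L / μ
            * n * tau γ l2 * γ ^ 2) * (σc ^ 2 / n) ≤ Real.exp (-t) := by
  obtain ⟨K, hK, hτ⟩ := tau_le_of_le_one h1 h2
  set A := R * (1 + 1600 * L / μ * (1 + K ^ 2)) with hA
  set B := (4 / μ + 101920 * (K + 1) * L / μ) * σg ^ 2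
    + (4 / μ + 16 / μ ^ 2 + 33280 * (5 + K ^ 2) * (L / μ) * K) * σc ^ 2 with hB
  have hlim : Filter.Tendsto (fun t : ℝ => A * (t ^ 12 * Real.exp (-t)) + B / t) Filter.atTop
      (nhds (A * 0 + 0)) :=
    ((Real.tendsto_pow_mul_exp_neg_atTop_nhds_zero 12).const_mul A).add
      (tendsto_const_nhds.div_atTop Filter.tendsto_id)
  rw [mul_zero, add_zero] at hlim
  obtain ⟨s, hs⟩ := Filter.eventually_atTop.1 (hlim.eventually (ge_mem_nhds zero_lt_one))
  -- The thresholds serve, in order: γ < 1/4; the bracket in `error_bound_le_exp` being at most 1; 1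
  -- - αμ/4 ≥ 1/2; the decay e⁻⁴ᵗ; and the step size condition.
  refine ⟨max 2 (max s (max (2 * μ) (max (16 / μ) (161280 * K * L)))), ?_, fun t ht => ?_⟩
  · exact le_trans one_le_two (le_max_left _ _)
  simp only [max_le_iff] at ht
  obtain ⟨ht2, hts, htμ, ht16, htK⟩ := ht
  have ht1 : 1 ≤ t := by linarith
  have ht0 : 0 < t := by linarith
  set a := Real.exp (-t) with ha
  have ha0 : 0 < a := Real.exp_pos _
  have ha1 : a ≤ 1 := Real.exp_le_one_iff.2 (by linarith)
  have hae : a * Real.exp t = 1 := by rw [ha, ← Real.exp_add]; simp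
  have hpow : ∀ k : ℕ, 1 ≤ t ^ k := fun k => one_le_pow₀ ht1
  have hexp : Real.exp t = 1 / a := by field_simp; linarith
  have hτt := hτ t ht1
  have hγ0 : 0 < a / t ^ 5 := by positivity
  have hα0 : 0 < a / t ^ 7 := by positivity
  have hα1 : a / t ^ 7 ≤ 1 / t := by
    have := le_self_pow₀ ht1 (by norm_num : 7 ≠ 0)
    gcongr
  have hτ0 : (0 : ℝ) < tau (a / t ^ 5) l2 :=
    lt_of_lt_of_le (div_pos two_pos (mul_pos hγ0 (by linarith)))
      (two_div_le_tau (mul_pos hγ0 (by linarith)))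
  have hT1 : (⌈t ^ 9 * Real.exp t⌉₊ : ℝ) ≤ 2 * t ^ 9 * Real.exp t := by
    have h3 := (Nat.ceil_lt_add_one (by positivity : 0 ≤ t ^ 9 * Real.exp t)).le
    have h4 : 1 ≤ t ^ 9 * Real.exp t :=
      one_le_mul_of_one_le_of_one_le (hpow 9) (Real.one_le_exp ht0.le)
    linarith
  have hq : a / t ^ 7 * μ / 4 ≤ 1 := by
    have h3 : a / t ^ 7 * μ ≤ 1 / t * μ := by gcongr
    have h4 : 1 / t * μ ≤ 1 := by rw [one_div, inv_mul_le_iff₀ ht0]; linarith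
    linarith
  refine ⟨a / t ^ 7, a / t ^ 5, ⌈t ^ 9 * Real.exp t⌉₊, hα0, hγ0, ?_, le_min ?_ ?_, hT1,
    by linarith, ?_⟩
  · have h3 : a / t ^ 5 ≤ a := div_le_self ha0.le (hpow 5)
    have h4 : a ≤ Real.exp (-2) := Real.exp_le_exp.2 (by linarith)
    have h5 : Real.exp (-2) < 1 / 4 := by
      have h6 : (2.7 : ℝ) < Real.exp 1 := lt_trans (by norm_num) Real.exp_one_gt_d9
      have h7 : Real.exp 2 = Real.exp 1 * Real.exp 1 := by rw [← Real.exp_add]; norm_num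
      rw [Real.exp_neg, inv_lt_comm₀ (Real.exp_pos _) (by norm_num), h7]
      nlinarith
    linarith
  · exact (div_le_self ha0.le (hpow 7)).trans ha1
  · rw [le_div_iff₀ (by positivity)]
    calc a / t ^ 7 * (161280 * tau (a / t ^ 5) l2 * L)
        ≤ a / t ^ 7 * (161280 * (K * t ^ 6 / a) * L) := by gcongr
      _ = 161280 * K * L / t := by field_simp
      _ ≤ 1 := by rw [div_le_one ht0]; exact htK
  · have hE : (1 - a / t ^ 7 * μ / 4) ^ ⌈t ^ 9 * Real.exp t⌉₊ ≤ Real.exp (-(4 * t)) := by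
      have h3 : 1 - a / t ^ 7 * μ / 4 ≤ Real.exp (-(a / t ^ 7 * μ / 4)) := by
        have := Real.add_one_le_exp (-(a / t ^ 7 * μ / 4))
        linarith
      refine (pow_le_pow_left₀ (by linarith) h3 _).trans ?_
      rw [← Real.exp_nat_mul]
      apply Real.exp_le_exp.2
      have h4 : t ^ 9 * Real.exp t ≤ (⌈t ^ 9 * Real.exp t⌉₊ : ℝ) := Nat.le_ceil _
      have h5 : t ^ 9 * Real.exp t * (a / t ^ 7 * μ / 4)
          ≤ (⌈t ^ 9 * Real.exp t⌉₊ : ℝ) * (a / t ^ 7 * μ / 4) := by gcongr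
      -- Tαμ/4 is at least μt²/4, hence at least 4t once t ≥ 16/μ.
      have h6 : t ^ 9 * Real.exp t * (a / t ^ 7 * μ / 4) = t * (μ * t / 4) := by
        rw [hexp]; field_simp
      have h7 : 4 ≤ μ * t / 4 := by
        rw [div_le_iff₀ hμ] at ht16
        linarith
      have h8 : t * 4 ≤ t * (μ * t / 4) := by gcongr
      linarith
    have hn1 : (1 : ℝ) ≤ n := by
      have : 1 ≤ n := by omega
      exact_mod_cast this
    have h3 := error_bound_le_exp (σg := σg) (σc := σc) (T := ⌈t ^ 9 * Real.exp t⌉₊)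
      hK hμ hL hn1 hR ht1 ha rfl rfl hτ0.le hτt
      (by rw [hexp] at hT1; rw [hexp]; linarith [mul_one_div (2 * t ^ 9) a])
      hE htμ
    refine h3.trans ?_
    exact mul_le_of_le_one_right ha0.le (hs t hts)

/-- From exponential accuracy to accuracy `acc ∈ (0, 1/2]`. -/
theorem iterations_le {t0 acc : ℝ} (ht0 : 1 ≤ t0) (h0 : 0 < acc) (h1 : acc ≤ 1 / 2) :
    2 * max t0 (Real.log (1 / acc)) ^ 9 * Real.exp (max t0 (Real.log (1 / acc)))
      ≤ (2 + 2 * t0 ^ 9 * Real.exp t0 / Real.log 2 ^ 9) * (1 / acc) * Real.log (1 / acc) ^ 9 := by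
  have h2 : 2 ≤ 1 / acc := by rw [le_div_iff₀ h0]; linarith
  have h3 : Real.log 2 ≤ Real.log (1 / acc) := Real.log_le_log two_pos h2
  have h4 : 0 < Real.log 2 := Real.log_pos one_lt_two
  have h5 : 0 < Real.log (1 / acc) := h4.trans_le h3
  have h6 : 0 ≤ 2 * t0 ^ 9 * Real.exp t0 / Real.log 2 ^ 9 := by positivity
  rcases le_total t0 (Real.log (1 / acc)) with h | h
  · rw [max_eq_right h, Real.exp_log (by positivity)]
    have h7 : 0 ≤ 1 / acc * Real.log (1 / acc) ^ 9 := by positivity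
    nlinarith [mul_nonneg h6 h7]
  -- For moderate accuracy the count is a fixed number; since acc ≤ 1/2 keeps the logarithm at least
  -- log 2, the constant can absorb it.
  · rw [max_eq_left h]
    have h7 : Real.log 2 ^ 9 ≤ 1 / acc * Real.log (1 / acc) ^ 9 := by
      calc Real.log 2 ^ 9 ≤ Real.log (1 / acc) ^ 9 := by gcongr
        _ ≤ 1 / acc * Real.log (1 / acc) ^ 9 :=
          le_mul_of_one_le_left (by positivity) (by linarith)
    have h8 := mul_le_mul_of_nonneg_left h7 h6
    have h9 : 2 * t0 ^ 9 * Real.exp t0 / Real.log 2 ^ 9 * Real.log 2 ^ 9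
        = 2 * t0 ^ 9 * Real.exp t0 := by field_simp
    have h10 : 0 ≤ 1 / acc * Real.log (1 / acc) ^ 9 := by positivity
    rw [h9] at h8
    linarith

end ICGT

theorem theorem1 {n d : ℕ} (hn : 2 ≤ n) (Q : Matrix (Fin n) (Fin n) ℝ) (hQ : ICGT.IsMixing hn Q)
    (f : Fin n → ICGT.Vec d → ℝ) (L μ σg σc : ℝ) (hL : 0 < L) (hμ : 0 < μ)
    (hσg : 0 ≤ σg) (hσc : 0 ≤ σc) (hf : ICGT.IsRegular f L μ)
    (xs : ICGT.Vec d) (hxs : ICGT.IsOptimal f xs) :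
    -- the error bound, for every admissible choice of the parameters
    (∀ (α γ : ℝ), 0 < α → 0 < γ → γ < 1 / 4 →
      ∀ τ : ℕ, τ = ICGT.tau γ (ICGT.lam2 hQ) → α ≤ min 1 (1 / (161280 * τ * L)) →
      ∀ (Ω : Type u) [MeasurableSpace Ω] (P : Measure Ω) [IsProbabilityMeasure P]
        (S : Fin n → Type v) [∀ i, MeasurableSpace (S i)]
        (F : (i : Fin n) → ICGT.Vec d → S i → ℝ) (x0 : Ω → ICGT.Stack n d)
        (ξ : ℕ → (i : Fin n) → Ω → S i) (ε : ℕ → Fin n → Ω → ICGT.Vec d),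
        ICGT.IsRun P Q α γ f F x0 ξ ε σg σc →
        ∀ T : ℕ,
          Integrable (ICGT.errSq Q α γ F x0 ξ ε xs T) P ∧
          Integrable (ICGT.psiSq Q α γ F x0 ξ ε 0) P ∧
          ∫ ω, ICGT.errSq Q α γ F x0 ξ ε xs T ω ∂P ≤
            (1 - α * μ / 4) ^ T *
              (∫ ω, ICGT.errSq Q α γ F x0 ξ ε xs 0 ω ∂P +
                800 * (1 + (τ : ℝ) ^ 2) * L / (n * (1 - α * μ / 4) * μ) *
                  ∫ ω, ICGT.psiSq Q α γ F x0 ξ ε 0 ω ∂P)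
            + (4 * α / μ + 101920 * L * (τ + 1) * n * α ^ 2 / μ) * (σg ^ 2 / n)
            + (4 * (1 + 2 * μ⁻¹ * T * α) / μ * (γ ^ 2 / α)
                + 33280 * (2 + α ^ 2 * ((τ : ℝ) ^ 2 + 1 / 2) + α ^ 2 * T) * L / μ
                  * n * τ * γ ^ 2) * (σc ^ 2 / n)) ∧
    -- the iteration complexity: `ε`-accuracy after `Õ(1/ε)` iterations for tuned parameters
    (∀ R : ℝ, ∃ (C : ℝ) (p : ℕ), ∀ acc : ℝ, 0 < acc → acc ≤ 1 / 2 →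
      ∃ (α γ : ℝ) (T : ℕ), 0 < α ∧ 0 < γ ∧ γ < 1 / 4 ∧
        α ≤ min 1 (1 / (161280 * ICGT.tau γ (ICGT.lam2 hQ) * L)) ∧
        (T : ℝ) ≤ C * (1 / acc) * Real.log (1 / acc) ^ p ∧
        ∀ (Ω : Type u) [MeasurableSpace Ω] (P : Measure Ω) [IsProbabilityMeasure P]
          (S : Fin n → Type v) [∀ i, MeasurableSpace (S i)]
          (F : (i : Fin n) → ICGT.Vec d → S i → ℝ) (x0 : Ω → ICGT.Stack n d)
          (ξ : ℕ → (i : Fin n) → Ω → S i) (ε : ℕ → Fin n → Ω → ICGT.Vec d),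
          ICGT.IsRun P Q α γ f F x0 ξ ε σg σc →
          ∫ ω, ICGT.errSq Q α γ F x0 ξ ε xs 0 ω ∂P ≤ R →
          ∫ ω, ICGT.psiSq Q α γ F x0 ξ ε 0 ω ∂P ≤ R →
          ∫ ω, ICGT.errSq Q α γ F x0 ξ ε xs T ω ∂P ≤ acc) := by
  refine ⟨?_, fun R => ?_⟩
  · intro α γ hα hγ hγ1 τ hτ hατ Ω _ P _ S _ F x0 ξ ε h T
    exact ⟨h.integrable_errSq hf xs T, h.integrable_psiSq hf,
      h.error_bound hQ hf hxs hL hμ hα hγ hγ1 hτ (hατ.trans (min_le_right _ _)) T⟩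
  -- R may be negative, so the threshold is taken for |R|; then t = max t0 (log (1/acc)) ensures e⁻ᵗ
  -- ≤ acc.
  · obtain ⟨t0, ht0, H⟩ := ICGT.exists_threshold hn σg σc |R| (l2 := ICGT.lam2 hQ) hQ.eig_second
      (hQ.eig_all _) hμ hL (abs_nonneg R)
    refine ⟨2 + 2 * t0 ^ 9 * Real.exp t0 / Real.log 2 ^ 9, 9, fun acc h0 h1 => ?_⟩
    obtain ⟨α, γ, T, hα, hγ, hγ1, hατ, hT, hq, hB⟩ := H _ (le_max_left t0 (Real.log (1 / acc)))
    refine ⟨α, γ, T, hα, hγ, hγ1, hατ, hT.trans (ICGT.iterations_le ht0 h0 h1), ?_⟩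
    intro Ω _ P _ S _ F x0 ξ ε h hR1 hR2
    have hacc : Real.exp (-max t0 (Real.log (1 / acc))) ≤ acc := by
      rw [Real.exp_neg]
      apply inv_le_of_inv_le₀ h0
      rw [← one_div]
      exact (Real.exp_log (by positivity : 0 < 1 / acc)).symm.le.trans
        (Real.exp_le_exp.2 (le_max_right _ _))
    refine (h.error_bound hQ hf hxs hL hμ hα hγ hγ1 rfl (hατ.trans (min_le_right _ _)) T).trans
      (le_trans ?_ (hB.trans hacc))
    have hR1' := hR1.trans (le_abs_self R)
    have hR2' := hR2.trans (le_abs_self R)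
    gcongr
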